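/- For a function $t:\mathbb N\to\mathbb R$ let $\mathrm{NTIME}(t)$ be the class of languages over $\{0,1\}$ accepted by nondeterministic multitape Turing machines all of whose computation paths on inputs of length $n$ halt within $O(t(n))$ steps. A function $t:\mathbb N\to\mathbb N$ is time-constructible if a deterministic multitape Turing machine computes $1^{t(n)}$ from $1^n$ within $O(t(n))$ steps. A set $S$ of positive integers is robust if for each positive integer $k$ there is an integer $m\ge 2$ such that $n\in S$ for all $m\le n\le m^k$. For a class $\mathcal C$ of languages, $\mathrm{r.o.}\,\mathcal C$ is the class of languages $L$ for which there are a robust set $S$ and a language $L'\in\mathcal C$ such that $L\cap\{0,1\}^n=L'\cap\{0,1\}^n$ for all $n\in S$. (1) Let $t_1,t_2:\mathbb N\to\mathbb N$ be time-constructible functions such that $t_1(n)=o(t_2(n))$, $t_1(n+1)=o(t_2(n))$, and, for some constant $c$, $n\le t_1(n)\le n^c$ for all sufficiently large $n$. Then $\mathrm{NTIME}(t_2(n))\not\subseteq\mathrm{r.o.}\,\mathrm{NTIME}(t_1(n))$. (2) For all real numbers $1\le r<s$, $\mathrm{NTIME}(n^s)\not\subseteq\mathrm{r.o.}\,\mathrm{NTIME}(n^r)$.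 -/

import Mathlib

open Filter Asymptotics

/-- A nondeterministic multitape Turing machine. The index type `K` of the tapes, the set `Q` of
states and the set `A` of auxiliary tape symbols are finite. The tape alphabet is
`Option (Bool ⊕ A)`: `none` is the blank, and `some (.inl b)` are the two input symbols. -/
structure NTM where
  /-- indices of the tapes -/
  K : Type
  /-- states -/
  Q : Type
  /-- auxiliary tape symbols -/
  A : Type
  finite_K : Finite K
  finite_Q : Finite Q
  finite_A : Finite A
  /-- the tape that holds the input, and the output of machines that compute a function -/
  io : K
  /-- initial state -/
  start : Q
  /-- accepting states -/
  accept : Set Q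
  /-- The possible actions in a given state when the given symbols are scanned: the new state and,
  for each tape, the symbol to be written and the move of the head (`none`: stay). -/
  trans : Q → (K → Option (Bool ⊕ A)) →
    Set (Q × (K → Option (Bool ⊕ A) × Option Turing.Dir))

namespace NTM

attribute [instance] NTM.finite_K NTM.finite_Q NTM.finite_A

/-- The tape alphabet. -/
abbrev Sym (M : NTM) : Type := Option (Bool ⊕ M.A)

/-- A configuration: the state, and the two-way infinite tapes with their head positions. -/
structure Cfg (M : NTM) where
  state : M.Q
  tape : M.K → Turing.Tape M.Sym

/-- The tape that contains the word `x` and is blank elsewhere, with the head on the first letter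
of `x`. -/
def wordTape (M : NTM) (x : List Bool) : Turing.Tape M.Sym :=
  Turing.Tape.mk₁ (x.map fun b => some (Sum.inl b))

/-- The initial configuration on input `x`: all tapes but the input tape are blank. -/
noncomputable def init (M : NTM) (x : List Bool) : M.Cfg where
  state := M.start
  tape := open Classical in fun k => M.wordTape (if k = M.io then x else [])

/-- Write the symbol `a.1`, then move the head as `a.2` says. -/
def act {M : NTM} (a : M.Sym × Option Turing.Dir) (T : Turing.Tape M.Sym) : Turing.Tape M.Sym :=
  match a.2 with
  | none => T.write a.1
  | some d => (T.write a.1).move d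

/-- The actions that are available in a configuration. -/
def actions {M : NTM} (c : M.Cfg) : Set (M.Q × (M.K → M.Sym × Option Turing.Dir)) :=
  M.trans c.state fun k => (c.tape k).head

/-- One step of a computation. -/
def Step {M : NTM} (c d : M.Cfg) : Prop :=
  ∃ a ∈ actions c, d = ⟨a.1, fun k => act (a.2 k) (c.tape k)⟩

/-- `Steps m c d`: some computation path leads from `c` to `d` in exactly `m` steps. -/
inductive Steps {M : NTM} : ℕ → M.Cfg → M.Cfg → Prop
  | refl (c : M.Cfg) : Steps 0 c c
  | head {m : ℕ} {c d e : M.Cfg} : Step c d → Steps m d e → Steps (m + 1) c e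

/-- The machine halts in a configuration in which no action is available. -/
def Halted {M : NTM} (c : M.Cfg) : Prop := actions c = ∅

/-- The input `x` is accepted: some computation path halts in an accepting state. -/
def Accepts (M : NTM) (x : List Bool) : Prop :=
  ∃ m c, Steps m (M.init x) c ∧ Halted c ∧ c.state ∈ M.accept

/-- On each input `x` every computation path halts after at most `T |x|` steps. -/
def RunsInTime (M : NTM) (T : ℕ → ℕ) : Prop :=
  ∀ (x : List Bool) (m : ℕ) (c : M.Cfg), Steps m (M.init x) c → m ≤ T x.length

/-- There is at most one action in every situation. -/
def Deterministic (M : NTM) : Prop := ∀ q s, (M.trans q s).Subsingleton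

end NTM

/-- `NTIME t`: the languages over `{0, 1}` that are accepted by a nondeterministic multitape Turing
machine all of whose computation paths on inputs of length `n` halt within `O(t(n))` steps. -/
def NTIME (t : ℕ → ℝ) : Set (Language Bool) :=
  {L | ∃ (M : NTM) (T : ℕ → ℕ), M.RunsInTime T ∧ (fun n => (T n : ℝ)) =O[atTop] t ∧
    ∀ x, x ∈ L ↔ M.Accepts x}

/-- `t` is time-constructible: a deterministic multitape Turing machine computes `1^{t(n)}` from
`1^n` within `O(t(n))` steps. -/
def TimeConstructible (t : ℕ → ℕ) : Prop :=
  ∃ (M : NTM) (T : ℕ → ℕ), M.Deterministic ∧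
    (fun n => (T n : ℝ)) =O[atTop] (fun n => (t n : ℝ)) ∧
    ∀ n, ∃ m ≤ T n, ∃ c, NTM.Steps m (M.init (List.replicate n true)) c ∧ NTM.Halted c ∧
      c.tape M.io = M.wordTape (List.replicate (t n) true)

/-- A set `S` of positive integers is robust if for each positive `k` it contains all `n` with
`m ≤ n ≤ m ^ k`, for some `m ≥ 2`. -/
def Robust (S : Set ℕ) : Prop :=
  (∀ n ∈ S, 0 < n) ∧ ∀ k : ℕ, 0 < k → ∃ m : ℕ, 2 ≤ m ∧ ∀ n, m ≤ n → n ≤ m ^ k → n ∈ S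

/-- The words of length `n` in `L`. -/
def slice (L : Language Bool) (n : ℕ) : Set (List Bool) := {x | x ∈ L ∧ x.length = n}

/-- `L ∈ C` on `S`: some language in `C` agrees with `L` on all input lengths in `S`. -/
def InClassOn (L : Language Bool) (C : Set (Language Bool)) (S : Set ℕ) : Prop :=
  ∃ L' ∈ C, ∀ n ∈ S, slice L n = slice L' n

/-- The class `ro C` of the languages that are robustly often in `C`. -/
def ro (C : Set (Language Bool)) : Set (Language Bool) :=
  {L | ∃ S, Robust S ∧ InClassOn L C S}

/-! ### Computation paths of nondeterministic Turing machines -/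

namespace NTM

variable {M : NTM}

/-! The diagonal language lives on a tree of words. Let `M` be a machine of the smaller class with
program `D` and time bound `T`, and let `x` be a padded code of `D`. In a word `x w` the bits of `w`
say, rule by rule, which rules of `D` to take, so that `w` spells a tentative computation path of
`M` on `x`. The universal machine `U` accepts `x w` when `w` asks for a rule beyond the end of `D`.
When `w` has reached an accepting rule, it accepts iff the path is not a computation of `M` on `x`.
In all other cases it accepts iff the path is not a computation of `M` on `x`, or `M` accepts both
`x w 0` and `x w 1`.

Suppose that `M` decides the language `L` of the clocked `U` on these words. If `x ∈ L`, then `M`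
accepts `x`, along some accepting path. Membership in `L` passes from a node on a genuine path to
its children (`mem_append_of_mem`), hence down to the leaf of this accepting path, which `U`
rejects. So `x ∉ L` (`base_not_mem`) and `M` rejects `x`. But then no leaf carries a genuine
accepting path, all leaves are in `L`, and membership climbs from the leaves to the root
(`mem_of_not_accepts`), so `x ∈ L`: a contradiction (`not_agrees`).

A genuine path has at most `T |x|` rules, and each costs at most `|D|` bits, so only lengths between
`|x|` and a polynomial in `|x|` are involved. A robust set contains such an interval of lengths, and
padding moves `|x|` to its left end. At a word of length `n` the machine `M` is simulated on words
of length `n + 1`, whence the condition on `t₁ (n + 1)`.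

For a fixed `M` the simulation may only cost a constant factor, although `U` has a fixed number of
tapes and symbols. Therefore `U` guesses a whole sequence of rules and verifies it piecemeal. The
behaviour of `M` splits into independent binary tracks, one for each pair of a tape and a symbol and
one for each state, and a sequence of rules is a computation iff each track by itself can follow it
(`simulates_program`). `U` checks the tracks one after the other, in one pass over the sequence per
track (`forces_check`).

It remains to clock `U`. A clock may be nondeterministic: all its paths must have length `O(t₂)`,
and one path must be long compared with `t₁ (n + 1)` (`not_NTIME_subset_ro`). A machine that prints
`1^{t₂(n)}` is such a clock, as its output grows by at most one cell per step. For real exponents `r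
< s` choose a rational `p / q` in between; the clock guesses `m`, checks against the input that `(m
+ 1) ^ q` is at most about `n`, and runs for `(m + 1) ^ p` steps. -/

theorem Steps.trans {m n : ℕ} {c d e : M.Cfg} (h₁ : Steps m c d) (h₂ : Steps n d e) :
    Steps (m + n) c e := by
  induction h₁ with
  | refl c => simpa using h₂
  | head hs _ ih =>
    rw [Nat.add_right_comm]
    exact .head hs (ih h₂)

theorem Steps.zero_eq {c d : M.Cfg} (h : Steps 0 c d) : c = d := by
  cases h; rfl

theorem Steps.exists_head {m : ℕ} {c e : M.Cfg} (h : Steps (m + 1) c e) :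
    ∃ d, Step c d ∧ Steps m d e := by
  cases h with
  | head h₁ h₂ => exact ⟨_, h₁, h₂⟩

theorem Steps.exists_steps_of_le {m : ℕ} {c e : M.Cfg} (h : Steps m c e) :
    ∀ l ≤ m, ∃ d, Steps l c d := by
  induction h with
  | refl c => intro l hl; obtain rfl : l = 0 := by omega
              exact ⟨c, .refl c⟩
  | head hs _ ih =>
    intro l hl
    cases l with
    | zero => exact ⟨_, .refl _⟩
    | succ l =>
      obtain ⟨d, hd⟩ := ih l (by omega)
      exact ⟨d, .head hs hd⟩

theorem not_halted_of_step {c d : M.Cfg} (h : Step c d) : ¬ Halted c := by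
  obtain ⟨a, ha, -⟩ := h
  intro hc
  rw [Halted] at hc
  rw [hc] at ha
  exact ha

/-- `Forces b c d`: every computation path from `c` follows the same path from `c` to `d`, which
has at most `b` steps, unless it stops earlier. -/
inductive Forces : ℕ → M.Cfg → M.Cfg → Prop
  | refl (b : ℕ) (c : M.Cfg) : Forces b c c
  | head {b : ℕ} {c d e : M.Cfg} : (∀ d', Step c d' ↔ d' = d) → Forces b d e → Forces (b + 1) c e

theorem Forces.mono {b b' : ℕ} {c d : M.Cfg} (h : Forces b c d) (hb : b ≤ b') :
    Forces b' c d := by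
  induction h generalizing b' with
  | refl b c => exact .refl _ _
  | head hs _ ih =>
    obtain ⟨k, rfl⟩ : ∃ k, b' = k + 1 := ⟨b' - 1, by omega⟩
    exact .head hs (ih (by omega))

theorem Forces.trans {b b' : ℕ} {c d e : M.Cfg} (h₁ : Forces b c d) (h₂ : Forces b' d e) :
    Forces (b + b') c e := by
  induction h₁ with
  | refl b c => exact h₂.mono (by omega)
  | head hs _ ih =>
    rw [Nat.add_right_comm]
    exact .head hs (ih h₂)

theorem Forces.single {c d : M.Cfg} (h : ∀ d', Step c d' ↔ d' = d) : Forces 1 c d :=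
  .head h (.refl 0 d)

theorem Forces.exists_steps {b : ℕ} {c d : M.Cfg} (h : Forces b c d) : ∃ l ≤ b, Steps l c d := by
  induction h with
  | refl b c => exact ⟨0, Nat.zero_le _, .refl _⟩
  | head hs _ ih =>
    obtain ⟨l, hl, hst⟩ := ih
    exact ⟨l + 1, by omega, .head ((hs _).2 rfl) hst⟩

/-- A path either stops before the end of the forced path or continues from its end. -/
theorem Forces.steps_cases {b : ℕ} {c d : M.Cfg} (h : Forces b c d) {m : ℕ} {e : M.Cfg}
    (he : Steps m c e) : (m < b ∧ ¬ Halted e) ∨ ∃ l ≤ b, ∃ m', m = l + m' ∧ Steps m' d e := by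
  induction h generalizing m with
  | refl b c => exact .inr ⟨0, Nat.zero_le _, m, by simp, he⟩
  | head hs _ ih =>
    cases he with
    | refl => exact .inl ⟨by omega, not_halted_of_step ((hs _).2 rfl)⟩
    | head h₁ h₂ =>
      rw [(hs _).1 h₁] at h₂
      rcases ih h₂ with h | ⟨l, hl, m', rfl, h⟩
      · exact .inl ⟨by omega, h.2⟩
      · exact .inr ⟨l + 1, by omega, m', by omega, h⟩

/-- Some computation path of length `m` from `c` halts in an accepting state. -/
def AcceptsIn (m : ℕ) (c : M.Cfg) : Prop :=
  ∃ e, Steps m c e ∧ Halted e ∧ e.state ∈ M.accept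

theorem accepts_iff_acceptsIn {x : List Bool} : M.Accepts x ↔ ∃ m, AcceptsIn m (M.init x) :=
  Iff.rfl

/-- No configuration before the end of a forced path is halted, so an accepting path has to run
through its end. -/
theorem Forces.acceptsIn_of {b m : ℕ} {c d : M.Cfg} (h : Forces b c d) (hc : AcceptsIn m c) :
    ∃ m' ≤ m, AcceptsIn m' d := by
  obtain ⟨e, he, hh, ha⟩ := hc
  rcases h.steps_cases he with h | ⟨l, -, m', rfl, h⟩
  · exact absurd hh h.2
  · exact ⟨m', by omega, e, h, hh, ha⟩

/-- Some computation path of length at most `b` from `c` halts in an accepting state. -/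
def AcceptsWithin (b : ℕ) (c : M.Cfg) : Prop := ∃ m ≤ b, AcceptsIn m c

theorem AcceptsWithin.mono {b b' : ℕ} {c : M.Cfg} (h : AcceptsWithin b c) (hb : b ≤ b') :
    AcceptsWithin b' c := by
  obtain ⟨m, hm, h⟩ := h
  exact ⟨m, hm.trans hb, h⟩

theorem Steps.acceptsWithin {m b : ℕ} {c d : M.Cfg} (h : Steps m c d) (hd : AcceptsWithin b d) :
    AcceptsWithin (m + b) c := by
  obtain ⟨l, hl, e, he, hh⟩ := hd
  exact ⟨m + l, by omega, e, h.trans he, hh⟩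

theorem Forces.acceptsWithin {a b : ℕ} {c d : M.Cfg} (h : Forces a c d)
    (hd : AcceptsWithin b d) : AcceptsWithin (a + b) c := by
  obtain ⟨l, hl, hs⟩ := h.exists_steps
  exact (hs.acceptsWithin hd).mono (by omega)

theorem Halted.acceptsIn_iff {m : ℕ} {c : M.Cfg} (h : Halted c) :
    AcceptsIn m c ↔ m = 0 ∧ c.state ∈ M.accept := by
  constructor
  · rintro ⟨e, he, -, ha⟩
    cases he with
    | refl => exact ⟨rfl, ha⟩
    | head h₁ _ => exact absurd h (not_halted_of_step h₁)
  · rintro ⟨rfl, ha⟩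
    exact ⟨c, .refl c, h, ha⟩

theorem Deterministic.forces (hM : M.Deterministic) {m : ℕ} {c d : M.Cfg} (h : Steps m c d) :
    Forces m c d := by
  induction h with
  | refl c => exact .refl 0 c
  | @head m c d e hs _ ih =>
    refine .head (fun d' => ⟨fun h => ?_, fun h => h ▸ hs⟩) ih
    obtain ⟨a, ha, rfl⟩ := hs
    obtain ⟨a', ha', rfl⟩ := h
    rw [hM _ _ ha ha']

end NTM

/-! ### Elementary facts on two-way infinite tapes -/

namespace Turing.Tape

variable {Γ : Type*} [Inhabited Γ]

/-- Move the head, or leave it where it is. -/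
def move? : Option Dir → Tape Γ → Tape Γ
  | none, T => T
  | some d, T => T.move d

@[simp] theorem move?_none (T : Tape Γ) : T.move? none = T := rfl

@[simp] theorem move?_some (d : Dir) (T : Tape Γ) : T.move? (some d) = T.move d := rfl

/-- The opposite move. -/
def opp : Option Dir → Option Dir
  | none => none
  | some .left => some .right
  | some .right => some .left

@[simp] theorem move?_opp_move? (d : Option Dir) (T : Tape Γ) : (T.move? d).move? (opp d) = T := by
  rcases d with _ | _ | _ <;> simp [opp]

@[simp] theorem write_write (a b : Γ) (T : Tape Γ) : (T.write a).write b = T.write b := rfl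

@[simp] theorem write_head_self (T : Tape Γ) : T.write T.head = T := rfl

theorem map_move? {Γ' : Type*} [Inhabited Γ'] (f : PointedMap Γ Γ') (T : Tape Γ)
    (d : Option Dir) : (T.move? d).map f = (T.map f).move? d := by
  cases d
  · rfl
  · exact map_move f T _

theorem ext_nth {T₁ T₂ : Tape Γ} (h : ∀ i, T₁.nth i = T₂.nth i) : T₁ = T₂ := by
  have h0 : T₁.head = T₂.head := h 0
  have hl : T₁.left = T₂.left := ListBlank.ext fun i => h (-(i + 1 : ℕ))
  have hr : T₁.right = T₂.right := ListBlank.ext fun i => h (i + 1 : ℕ)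
  cases T₁; cases T₂
  simp_all

@[simp] theorem mk₂_head_cons (a : Γ) (L R : List Γ) : (mk₂ L (a :: R)).head = a := rfl

@[simp] theorem mk₂_head_nil (L : List Γ) : (mk₂ L []).head = default := rfl

@[simp] theorem mk₂_move_right (a : Γ) (L R : List Γ) :
    (mk₂ L (a :: R)).move .right = mk₂ (a :: L) R := by
  simp [mk₂]

@[simp] theorem mk₂_move_left (a : Γ) (L R : List Γ) :
    (mk₂ (a :: L) R).move .left = mk₂ L (a :: R) := by
  simp [mk₂]

@[simp] theorem mk₂_write_cons (a b : Γ) (L R : List Γ) :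
    (mk₂ L (a :: R)).write b = mk₂ L (b :: R) := by
  simp [mk₂]

@[simp] theorem mk₂_write_nil (b : Γ) (L : List Γ) :
    (mk₂ L []).write b = mk₂ L [b] := by
  simp [mk₂]

@[simp] theorem mk₂_nil_move_left_head (R : List Γ) : ((mk₂ [] R).move .left).head = default :=
  rfl

theorem mk_append_default (l : List Γ) : ListBlank.mk (l ++ [default]) = ListBlank.mk l := by
  apply ListBlank.ext
  intro i
  simp only [ListBlank.nth_mk]
  rcases lt_or_ge i l.length with h | h
  · rw [List.getI_append _ _ _ h]
  · rw [List.getI_append_right _ _ _ h, List.getI_eq_default _ h]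
    rcases Nat.eq_zero_or_pos (i - l.length) with h' | h'
    · rw [h']; rfl
    · exact List.getI_eq_default _ (by simp only [List.length_singleton]; omega)

theorem mk_append_replicate_default (l : List Γ) (k : ℕ) :
    ListBlank.mk (l ++ List.replicate k default) = ListBlank.mk l := by
  induction k with
  | zero => simp
  | succ k ih => rw [List.replicate_succ', ← List.append_assoc, mk_append_default, ih]

theorem mk₂_append_replicate_default (L R : List Γ) (k : ℕ) :
    mk₂ L (R ++ List.replicate k default) = mk₂ L R := by
  rw [mk₂, mk_append_replicate_default, mk₂]

end Turing.Tape

namespace NTM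

theorem act_eq {M : NTM} (a : M.Sym) (d : Option Turing.Dir) (T : Turing.Tape M.Sym) :
    act (a, d) T = (T.write a).move? d := by
  cases d <;> rfl

end NTM

theorem Turing.Tape.map_nth {Γ Γ' : Type*} [Inhabited Γ] [Inhabited Γ'] (f : PointedMap Γ Γ')
    (T : Tape Γ) (i : ℤ) : (T.map f).nth i = f (T.nth i) := by
  rcases i with (_ | i) | i
  · rfl
  · exact ListBlank.nth_map f T.right i
  · exact ListBlank.nth_map f T.left i

/-! ### Programs: lists of rules that act on independent binary tracks -/

/-- What a rule does on one track: compare the input symbol below the head with `chk`, read the bit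
`r`, write the bit `w`, and move. -/
structure Comp where
  chk : Option (Option Bool)
  r : Bool
  w : Bool
  d : Option Turing.Dir

instance : Finite Turing.Dir :=
  Finite.of_injective (fun d => (match d with | .left => false | .right => true : Bool))
    (by intro a b; cases a <;> cases b <;> simp)

instance : Finite Comp :=
  Finite.of_injective (fun c : Comp => (c.chk, c.r, c.w, c.d))
    (by rintro ⟨⟩ ⟨⟩; simp)

instance : Inhabited Comp := ⟨⟨none, false, false, none⟩⟩

/-- A rule has a component for each track, and a flag that tells whether it accepts. -/
abbrev Rule := List Comp × Bool

namespace Track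

variable {S : Type*} [Inhabited S]

/-- The state of a track: the read-only input tape and a binary tape with the same head position. -/
abbrev St (S : Type*) [Inhabited S] := Turing.Tape S × Turing.Tape Bool

/-- The effect of a component; `v` tells which input letter is seen on the input tape. -/
def step (v : S → Option Bool) (c : Comp) (s : St S) : Option (St S) :=
  if (c.chk = none ∨ c.chk = some (v s.1.head)) ∧ s.2.head = c.r then
    some (s.1.move? c.d, (s.2.write c.w).move? c.d)
  else none

/-- The effect of a sequence of components. -/
def run (v : S → Option Bool) : List Comp → St S → Option (St S)
  | [], s => some s
  | c :: cs, s => (step v c s).bind (run v cs)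

theorem run_append (v : S → Option Bool) (l₁ l₂ : List Comp) (s : St S) :
    run v (l₁ ++ l₂) s = (run v l₁ s).bind (run v l₂) := by
  induction l₁ generalizing s with
  | nil => rfl
  | cons c cs ih =>
    simp only [List.cons_append, run, Option.bind_assoc]
    congr 1
    funext s'
    exact ih s'

/-- The components for track `j` in a sequence of rules. -/
def col (j : ℕ) (τ : List (List Comp)) : List Comp := τ.map fun l => l.getD j default

@[simp] theorem col_append (j : ℕ) (τ σ : List (List Comp)) :
    col j (τ ++ σ) = col j τ ++ col j σ := by simp [col]

@[simp] theorem col_cons (j : ℕ) (l : List Comp) (τ : List (List Comp)) :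
    col j (l :: τ) = l.getD j default :: col j τ := rfl

@[simp] theorem col_nil (j : ℕ) : col j [] = [] := rfl

/-- A sequence of rules can be executed on each of the first `N` tracks. -/
def Consistent (v : S → Option Bool) (I : Turing.Tape S) (N : ℕ) (τ : List (List Comp)) : Prop :=
  ∀ j < N, (run v (col j τ) (I, Turing.Tape.mk₁ [])).isSome

/-- An accepting execution of a program with `m` rules before the accepting one. -/
def AcceptsBy (v : S → Option Bool) (I : Turing.Tape S) (N : ℕ) (D : List Rule) (m : ℕ) : Prop :=
  ∃ (τ : List (List Comp)) (l : List Comp), τ.length = m ∧ (∀ ρ ∈ τ, (ρ, false) ∈ D) ∧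
    (l, true) ∈ D ∧ Consistent v I N (τ ++ [l])

theorem Consistent.of_append {v : S → Option Bool} {I : Turing.Tape S} {N : ℕ}
    {τ σ : List (List Comp)} (h : Consistent v I N (τ ++ σ)) : Consistent v I N τ := by
  intro j hj
  have := h j hj
  rw [col_append, run_append] at this
  cases hr : run v (col j τ) (I, Turing.Tape.mk₁ []) with
  | none => rw [hr] at this; simp at this
  | some s => rfl

end Track

/-! ### Decomposition of a machine into independent binary tracks -/

namespace NTM

/-- The program describes the computations of `M`, which accepts within `T`, on inputs that are
seen through any view. -/
def Simulates (M : NTM) (N : ℕ) (D : List Rule) : Prop :=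
  (∀ ρ ∈ D, ρ.1.length = N) ∧
  ∀ {S : Type} [Inhabited S] (v : S → Option Bool) (hv : v default = default)
    (I : Turing.Tape S) (y : List Bool), I.map ⟨v, hv⟩ = Turing.Tape.mk₁ (y.map some) →
    (∀ m, (∃ c, Steps m (M.init y) c ∧ Halted c ∧ c.state ∈ M.accept) ↔
      Track.AcceptsBy v I N D m) ∧
    (∀ τ : List (List Comp), (∀ ρ ∈ τ, (ρ, false) ∈ D) → Track.Consistent v I N τ →
      ∃ c, Steps τ.length (M.init y) c)

section Tracks

variable (M : NTM)

/-- The tracks of a machine: one for each tape and tape symbol, and one for each state. -/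
abbrev TrackIdx : Type := (M.K × M.Sym) ⊕ M.Q

instance : Finite M.TrackIdx := inferInstance

/-- The symbol that is in a cell of tape `k` initially, if the input letter in this cell is `o`. -/
noncomputable def initSym (k : M.K) (o : Option Bool) : M.Sym :=
  open Classical in if k = M.io then o.map Sum.inl else none

open Classical in
/-- The components of the rule for the replacement of `(q, s)` by `(q', a)`. -/
noncomputable def comp (q : M.Q) (s : M.K → M.Sym) (o : Option Bool) (q' : M.Q)
    (a : M.K → M.Sym × Option Turing.Dir) : M.TrackIdx → Comp
  | .inl (k, b) =>
    ⟨if k = M.io then some o else none, xor (decide (s k = b)) (decide (M.initSym k o = b)),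
      xor (decide ((a k).1 = b)) (decide (M.initSym k o = b)), (a k).2⟩
  | .inr p => ⟨none, xor (decide (q = p)) (decide (M.start = p)),
      xor (decide (q' = p)) (decide (M.start = p)), none⟩

@[simp] theorem comp_io_chk (q : M.Q) (s : M.K → M.Sym) (o : Option Bool) (q' : M.Q)
    (a : M.K → M.Sym × Option Turing.Dir) (b : M.Sym) :
    (M.comp q s o q' a (.inl (M.io, b))).chk = some o := by
  simp [comp]

variable {M}

open Classical in
/-- The tracks represent the configuration `c`, and the input tape is in position `J`. -/
def Represents {S : Type} [Inhabited S] (v : S → Option Bool) (c : M.Cfg)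
    (J : Turing.Tape S) (Φ : M.TrackIdx → Track.St S) : Prop :=
  (∀ b, (Φ (.inl (M.io, b))).1 = J) ∧
  (∀ k b i, (Φ (.inl (k, b))).2.nth i =
    xor (decide ((c.tape k).nth i = b))
      (decide (M.initSym k (v ((Φ (.inl (k, b))).1.nth i)) = b))) ∧
  ∀ p, (Φ (.inr p)).2.head = xor (decide (c.state = p)) (decide (M.start = p))

theorem initSym_of_ne {k : M.K} (hk : k ≠ M.io) (o : Option Bool) : M.initSym k o = none := by
  simp [initSym, hk]

/-- The displacement of a move. -/
def shift : Option Turing.Dir → ℤ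
  | none => 0
  | some .left => -1
  | some .right => 1

theorem nth_move? {Γ : Type*} [Inhabited Γ] (d : Option Turing.Dir) (T : Turing.Tape Γ) (i : ℤ) :
    (T.move? d).nth i = T.nth (i + shift d) := by
  rcases d with _ | _ | _ <;> simp [shift, sub_eq_add_neg]

variable {S : Type} [Inhabited S] {v : S → Option Bool}

theorem Represents.xor_cancel {a b c : Bool} : (xor a c = xor b c) ↔ a = b := by
  cases a <;> cases b <;> cases c <;> simp

-- The track of the symbol that is really scanned on tape `k` forces `s k`, the track of the current
-- state forces `q`, and the tracks of the input tape force the guessed letter `o`. Tracks store the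
-- difference to the initial contents, so that all of them can start blank; once `o` is known to be
-- correct, the xor with the initial symbol cancels.
open Classical in
theorem Represents.step_iff {c : M.Cfg} {J : Turing.Tape S} {Φ : M.TrackIdx → Track.St S}
    (h : Represents v c J Φ) (q : M.Q) (s : M.K → M.Sym) (o : Option Bool) (q' : M.Q)
    (a : M.K → M.Sym × Option Turing.Dir) :
    (∀ i, (Track.step v (M.comp q s o q' a i) (Φ i)).isSome) ↔
      c.state = q ∧ (fun k => (c.tape k).head) = s ∧ v J.head = o := by
  obtain ⟨h₁, h₂, h₃⟩ := h
  have hk : ∀ k b, (Φ (.inl (k, b))).2.head =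
      xor (decide ((c.tape k).head = b)) (decide (M.initSym k (v (Φ (.inl (k, b))).1.head) = b)) :=
    fun k b => h₂ k b 0
  simp only [Track.step, Option.isSome_ite]
  constructor
  · intro H
    refine ⟨?_, ?_, ?_⟩
    · have := (H (.inr c.state)).2
      rw [h₃] at this
      simp only [comp, Represents.xor_cancel] at this
      simpa [eq_comm] using this
    · funext k
      have := (H (.inl (k, (c.tape k).head)))
      rw [hk] at this
      have hin : M.initSym k (v (Φ (.inl (k, (c.tape k).head))).1.head) = M.initSym k o := by
        by_cases hio : k = M.io
        · subst hio
          have := this.1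
          rw [comp_io_chk] at this
          rcases this with h | h
          · simp at h
          · rw [Option.some.inj h]
        · rw [initSym_of_ne hio, initSym_of_ne hio]
      rw [hin] at this
      have := this.2
      simp only [comp, Represents.xor_cancel] at this
      simpa [eq_comm] using this
    · have := (H (.inl (M.io, default))).1
      rw [comp_io_chk, h₁] at this
      rcases this with h | h
      · simp at h
      · exact (Option.some.inj h).symm
  · rintro ⟨rfl, rfl, rfl⟩ (⟨k, b⟩ | p)
    · constructor
      · by_cases hio : k = M.io
        · subst hio
          simp [comp, h₁]
        · simp [comp, hio]
      · rw [hk]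
        simp only [comp]
        by_cases hio : k = M.io
        · subst hio
          rw [h₁]
        · rw [initSym_of_ne hio, initSym_of_ne hio]
    · simp [comp, h₃]

open Classical in
theorem Represents.step {c : M.Cfg} {J : Turing.Tape S} {Φ Φ' : M.TrackIdx → Track.St S}
    (h : Represents v c J Φ) (q : M.Q) (s : M.K → M.Sym) (o : Option Bool) (q' : M.Q)
    (a : M.K → M.Sym × Option Turing.Dir)
    (H : ∀ i, Track.step v (M.comp q s o q' a i) (Φ i) = some (Φ' i)) :
    Represents v ⟨q', fun k => act (a k) (c.tape k)⟩ (J.move? (a M.io).2) Φ' := by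
  have ho := ((h.step_iff q s o q' a).1 fun i => by rw [H]; rfl).2.2
  obtain ⟨h₁, h₂, h₃⟩ := h
  have hΦ : ∀ i, Φ' i = ((Φ i).1.move? (M.comp q s o q' a i).d,
      ((Φ i).2.write (M.comp q s o q' a i).w).move? (M.comp q s o q' a i).d) := by
    intro i
    have := H i
    rw [Track.step] at this
    split_ifs at this
    exact (Option.some.inj this).symm
  refine ⟨fun b => ?_, fun k b i => ?_, fun p => ?_⟩
  · rw [hΦ, h₁]; rfl
  · have hact : act (a k) (c.tape k) = ((c.tape k).write (a k).1).move? (a k).2 := act_eq _ _ _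
    have hd : (M.comp q s o q' a (.inl (k, b))).d = (a k).2 := rfl
    have hw : (M.comp q s o q' a (.inl (k, b))).w =
      xor (decide ((a k).1 = b)) (decide (M.initSym k o = b)) := rfl
    simp only [hΦ, hact, hd, hw, nth_move?, Turing.Tape.write_nth]
    -- Only the cell that was scanned before the move changes, and there the initial letter is the
    -- guessed `o`.
    by_cases hi : i + shift (a k).2 = 0
    · simp only [hi, if_true, Turing.Tape.nth_zero]
      by_cases hio : k = M.io
      · subst hio
        rw [h₁, ← ho]
      · rw [initSym_of_ne hio, initSym_of_ne hio]
    · simp only [hi, if_false, h₂]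
  · rw [hΦ]; rfl

/-- Every tape still has its initial contents, so all the differences stored on the tracks vanish.
-/
theorem Represents.init (hv : v default = default) {I : Turing.Tape S} {y : List Bool}
    (hI : I.map ⟨v, hv⟩ = Turing.Tape.mk₁ (y.map some)) :
    Represents v (M.init y) I (fun _ => (I, Turing.Tape.mk₁ [])) := by
  classical
  have hnth : ∀ i, v (I.nth i) = (Turing.Tape.mk₁ (y.map some)).nth i := by
    intro i
    rw [← hI, Turing.Tape.map_nth]
  have hblank : ∀ i, (Turing.Tape.mk₁ ([] : List Bool)).nth i = false := by
    rintro ((_ | i) | i) <;> rfl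
  have hinit : ∀ k i, ((M.init y).tape k).nth i =
      M.initSym k ((Turing.Tape.mk₁ (y.map some)).nth i) := by
    intro k i
    simp only [NTM.init, wordTape, initSym]
    by_cases hk : k = M.io
    · simp only [hk, if_true]
      have hp : Option.map (Sum.inl : Bool → Bool ⊕ M.A) default = default := rfl
      have := Turing.Tape.map_mk₁ ⟨Option.map (Sum.inl : Bool → Bool ⊕ M.A), hp⟩ (y.map some)
      rw [List.map_map] at this
      have h' : (y.map fun b => some (Sum.inl b) : List M.Sym) =
        y.map ((⟨Option.map (Sum.inl : Bool → Bool ⊕ M.A), hp⟩ :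
          Turing.PointedMap (Option Bool) M.Sym) ∘ some) := rfl
      rw [h', ← this, Turing.Tape.map_nth]
    · simp only [hk, if_false, List.map_nil]
      rcases i with (_ | i) | i <;> rfl
  refine ⟨fun _ => rfl, fun k b i => ?_, fun p => ?_⟩
  · rw [hblank, hnth, hinit]
    simp
  · exact (Bool.xor_self _).symm

variable (M)

/-- The number of tracks. -/
noncomputable def numTracks : ℕ := Nat.card M.TrackIdx

noncomputable def trackEquiv : M.TrackIdx ≃ Fin M.numTracks := Finite.equivFin _

/-- The rule with the given components. -/
noncomputable def ruleList (f : M.TrackIdx → Comp) : List Comp :=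
  List.ofFn fun j => f (M.trackEquiv.symm j)

@[simp] theorem length_ruleList (f : M.TrackIdx → Comp) : (M.ruleList f).length = M.numTracks := by
  simp [ruleList]

@[simp] theorem ruleList_getD (f : M.TrackIdx → Comp) (i : M.TrackIdx) :
    (M.ruleList f).getD (M.trackEquiv i) default = f i := by
  rw [List.getD_eq_getElem _ _ (by simp)]
  simp [ruleList]

/-- The rules of the program for `M`. -/
def rules : Set Rule :=
  {ρ | (∃ q s o q' a, (q', a) ∈ M.trans q s ∧ ρ = (M.ruleList (M.comp q s o q' a), false)) ∨
    ∃ q s o, M.trans q s = ∅ ∧ q ∈ M.accept ∧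
      ρ = (M.ruleList (M.comp q s o q fun k => (s k, none)), true)}

theorem finite_rules : M.rules.Finite := by
  refine (Set.finite_range fun x : M.Q × (M.K → M.Sym) × Option Bool × M.Q ×
    (M.K → M.Sym × Option Turing.Dir) × Bool => ((M.ruleList
      (M.comp x.1 x.2.1 x.2.2.1 x.2.2.2.1 x.2.2.2.2.1), x.2.2.2.2.2) : Rule)).subset ?_
  rintro ρ (⟨q, s, o, q', a, -, rfl⟩ | ⟨q, s, o, -, -, rfl⟩)
  · exact ⟨(q, s, o, q', a, false), rfl⟩
  · exact ⟨(q, s, o, q, fun k => (s k, none), true), rfl⟩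

/-- The program for `M`. -/
noncomputable def program : List Rule := M.finite_rules.toFinset.toList

theorem mem_program {ρ : Rule} : ρ ∈ M.program ↔ ρ ∈ M.rules := by simp [program]

variable {M}

/-- The tracks are tested without reference to one another, yet at each rule their joint success
pins down the state, the scanned symbols and the input letter, so that the rule is an action
available in the represented configuration. -/
theorem Represents.of_run {τ : List (List Comp)} (hτ : ∀ ρ ∈ τ, (ρ, false) ∈ M.program)
    {c : M.Cfg} {J : Turing.Tape S} {Φ : M.TrackIdx → Track.St S} (h : Represents v c J Φ)
    (H : ∀ i : M.TrackIdx, (Track.run v (Track.col (M.trackEquiv i) τ) (Φ i)).isSome) :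
    ∃ c' J' Φ', Steps τ.length c c' ∧ Represents v c' J' Φ' ∧
      ∀ i : M.TrackIdx, Track.run v (Track.col (M.trackEquiv i) τ) (Φ i) = some (Φ' i) := by
  induction τ generalizing c J Φ with
  | nil => exact ⟨c, J, Φ, .refl c, h, fun _ => rfl⟩
  | cons ρ τ ih =>
    rcases M.mem_program.1 (hτ ρ List.mem_cons_self) with
      ⟨q, s, o, q', a, ha, hρ⟩ | ⟨q, s, o, -, -, hρ⟩
    swap
    · simp at hρ
    obtain rfl : ρ = M.ruleList (M.comp q s o q' a) := congrArg Prod.fst hρ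
    simp only [Track.col_cons, ruleList_getD, Track.run] at H ⊢
    have H₁ : ∀ i, (Track.step v (M.comp q s o q' a i) (Φ i)).isSome := fun i => by
      cases hs : Track.step v (M.comp q s o q' a i) (Φ i) with
      | none => have := H i; rw [hs] at this; simp at this
      | some _ => rfl
    choose Φ' hΦ' using fun i => Option.isSome_iff_exists.1 (H₁ i)
    obtain ⟨hq, hs, -⟩ := (h.step_iff q s o q' a).1 H₁
    have h' := h.step q s o q' a hΦ'
    simp only [hΦ', Option.bind_some] at H ⊢
    obtain ⟨c', J', Φ'', h₁, h₂, h₃⟩ := ih (fun ρ hρ => hτ ρ (List.mem_cons_of_mem _ hρ)) h' H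
    refine ⟨c', J', Φ'', .head ⟨(q', a), ?_, rfl⟩ h₁, h₂, h₃⟩
    rw [actions, hq, hs]
    exact ha

theorem Represents.exists_run {m : ℕ} {c c' : M.Cfg} (hs : Steps m c c') {J : Turing.Tape S}
    {Φ : M.TrackIdx → Track.St S} (h : Represents v c J Φ) :
    ∃ (τ : List (List Comp)) (J' : Turing.Tape S) (Φ' : M.TrackIdx → Track.St S),
      τ.length = m ∧ (∀ ρ ∈ τ, (ρ, false) ∈ M.program) ∧ Represents v c' J' Φ' ∧
      ∀ i : M.TrackIdx, Track.run v (Track.col (M.trackEquiv i) τ) (Φ i) = some (Φ' i) := by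
  induction hs generalizing J Φ with
  | refl c => exact ⟨[], J, Φ, rfl, by simp, h, fun _ => rfl⟩
  | @head m c d e hcd _ ih =>
    obtain ⟨⟨q', a⟩, ha, rfl⟩ := hcd
    have H₁ := (h.step_iff c.state (fun k => (c.tape k).head) (v J.head) q' a).2 ⟨rfl, rfl, rfl⟩
    choose Φ' hΦ' using fun i => Option.isSome_iff_exists.1 (H₁ i)
    obtain ⟨τ, J', Φ'', h₁, h₂, h₃, h₄⟩ := ih (h.step _ _ _ _ _ hΦ')
    refine ⟨M.ruleList (M.comp c.state (fun k => (c.tape k).head) (v J.head) q' a) :: τ, J', Φ'',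
      by simp [h₁], ?_, h₃, fun i => ?_⟩
    · intro ρ hρ
      rcases List.mem_cons.1 hρ with rfl | hρ
      · exact M.mem_program.2 (.inl ⟨_, _, _, _, _, ha, rfl⟩)
      · exact h₂ ρ hρ
    · simp only [Track.col_cons, ruleList_getD, Track.run, hΦ', Option.bind_some, h₄]

/-- An accepting rule only tests that the situation is halted and accepting. A consistent `τ ++ [l]`
is therefore a path of length `τ.length` together with a certificate that it ends well. The second
clause of `Simulates` makes the time bound of `M` available for unfinished traces. -/
theorem simulates_program (M : NTM) : M.Simulates M.numTracks M.program := by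
  refine ⟨?_, ?_⟩
  · intro ρ hρ
    rcases M.mem_program.1 hρ with ⟨q, s, o, q', a, -, rfl⟩ | ⟨q, s, o, -, -, rfl⟩ <;> simp
  intro S _ v hv I y hI
  have h0 := Represents.init (M := M) hv hI
  refine ⟨fun m => ⟨?_, ?_⟩, ?_⟩
  · rintro ⟨c, hc, hh, hacc⟩
    obtain ⟨τ, J, Φ, h₁, h₂, h₃, h₄⟩ := h0.exists_run hc
    have hst := (h₃.step_iff c.state (fun k => (c.tape k).head) (v J.head) c.state
      fun k => ((c.tape k).head, none)).2 ⟨rfl, rfl, rfl⟩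
    refine ⟨τ, _, h₁, h₂, M.mem_program.2 (.inr ⟨c.state, fun k => (c.tape k).head, v J.head, hh,
      hacc, rfl⟩), fun j hj => ?_⟩
    have h₄ := h₄ (M.trackEquiv.symm ⟨j, hj⟩)
    have hst := hst (M.trackEquiv.symm ⟨j, hj⟩)
    have hg := M.ruleList_getD (M.comp c.state (fun k => (c.tape k).head) (v J.head) c.state
      fun k => ((c.tape k).head, none)) (M.trackEquiv.symm ⟨j, hj⟩)
    rw [Equiv.apply_symm_apply] at h₄ hg
    rw [Track.col_append, Track.run_append, h₄, Option.bind_some, Track.col_cons, hg]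
    obtain ⟨s, hs⟩ := Option.isSome_iff_exists.1 hst
    simp [Track.run, hs]
  · rintro ⟨τ, l, rfl, hτ, hl, hcons⟩
    have hcons' : ∀ i : M.TrackIdx, (Track.run v (Track.col (M.trackEquiv i) (τ ++ [l]))
      (I, Turing.Tape.mk₁ [])).isSome := fun i => hcons _ (M.trackEquiv i).2
    have hcons'' : ∀ i : M.TrackIdx, (Track.run v (Track.col (M.trackEquiv i) τ)
      (I, Turing.Tape.mk₁ [])).isSome := fun i => hcons.of_append _ (M.trackEquiv i).2
    obtain ⟨c, J, Φ, h₁, h₂, h₃⟩ := h0.of_run hτ hcons''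
    rcases M.mem_program.1 hl with ⟨q, s, o, q', a, ha, hρ⟩ | ⟨q, s, o, hh, hacc, hρ⟩
    · simp at hρ
    obtain rfl : l = _ := congrArg Prod.fst hρ
    have hst : ∀ i, (Track.step v (M.comp q s o q (fun k => (s k, none)) i) (Φ i)).isSome := by
      intro i
      have := hcons' i
      rw [Track.col_append, Track.run_append, h₃, Option.bind_some, Track.col_cons,
        ruleList_getD] at this
      cases hs : Track.step v (M.comp q s o q (fun k => (s k, none)) i) (Φ i) with
      | none => rw [Track.run, hs] at this; simp at this
      | some _ => rfl
    obtain ⟨rfl, hs, -⟩ := (h₂.step_iff _ _ _ _ _).1 hst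
    refine ⟨c, h₁, ?_, hacc⟩
    rw [Halted, actions, hs]
    exact hh
  · intro τ hτ hcons
    obtain ⟨c, -, -, h, -⟩ := h0.of_run hτ fun i => hcons _ (M.trackEquiv i).2
    exact ⟨c, h⟩

end Tracks

end NTM

/-! ### The universal machine -/

namespace Universal

/-- The auxiliary tape symbols: components of rules, which may be marked, ends of rules, separators
and erased components in the trace, and input letters that belong to the choice string. -/
inductive Aux
  | comp (c : Comp) (m : Bool)
  | rend (f : Bool)
  | sep
  | era
  | wb (b : Bool)
  | ext

instance : Finite Aux :=
  Finite.of_injective (β := (Comp × Bool) ⊕ Bool ⊕ Bool ⊕ Fin 3) (fun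
    | .comp c m => .inl (c, m)
    | .rend f => .inr (.inl f)
    | .wb b => .inr (.inr (.inl b))
    | .sep => .inr (.inr (.inr 0))
    | .era => .inr (.inr (.inr 1))
    | .ext => .inr (.inr (.inr 2)))
    (by intro a b; cases a <;> cases b <;> simp)

abbrev Sym := Option (Bool ⊕ Aux)

/-- The symbols in the description of a program. -/
abbrev PSym := Comp ⊕ Bool

/-- The additional value `none` marks the end of a coded program. -/
noncomputable def numSym : ℕ := Nat.card (Option PSym)

instance : NeZero numSym := ⟨Nat.card_pos.ne'⟩

noncomputable def symEquiv : Option PSym ≃ Fin numSym := Finite.equivFin _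

/-- What the current pass verifies: that the trace given by the choice string is inconsistent, or
that the input with the letter `e` appended is accepted. -/
inductive Mode
  | path (f : Bool)
  | child (e : Bool)

instance : Finite Mode :=
  Finite.of_injective (β := Bool ⊕ Bool) (fun
    | .path f => .inl f
    | .child e => .inr e)
    (by intro a b; cases a <;> cases b <;> simp)

/-- In `select`, `copy`, `skip` and `rew` the argument `o` is `none` while the choice string
dictates the rules, and `some e` while a trace for the child with last letter `e` is guessed. The
flag `f` tells whether an accepting rule was taken. In `fwd`, `need` says that the current rule
still awaits the execution of its component. -/
inductive State
  | parse (n : Fin numSym)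
  | prew
  | pad
  | select (o : Option Bool)
  | copy (o : Option Bool)
  | skip (o : Option Bool)
  | rew (o : Option Bool) (f : Bool)
  | exh
  | mark (f : Bool)
  | home (f : Bool)
  | back (m : Mode)
  | fix (m : Mode) (r : Bool)
  | fwd (m : Mode) (need : Bool)
  | clear (m : Mode)
  | acc

instance : Finite State :=
  Finite.of_injective (β := Fin numSym ⊕ Fin 4 ⊕ (Fin 3 × Option Bool) ⊕ (Option Bool × Bool) ⊕
      (Fin 2 × Bool) ⊕ (Fin 2 × Mode) ⊕ (Fin 2 × Mode × Bool)) (fun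
    | .parse n => .inl n
    | .prew => .inr (.inl 0)
    | .pad => .inr (.inl 1)
    | .exh => .inr (.inl 2)
    | .acc => .inr (.inl 3)
    | .select o => .inr (.inr (.inl (0, o)))
    | .copy o => .inr (.inr (.inl (1, o)))
    | .skip o => .inr (.inr (.inl (2, o)))
    | .rew o f => .inr (.inr (.inr (.inl (o, f))))
    | .mark f => .inr (.inr (.inr (.inr (.inl (0, f)))))
    | .home f => .inr (.inr (.inr (.inr (.inl (1, f)))))
    | .back m => .inr (.inr (.inr (.inr (.inr (.inl (0, m))))))
    | .clear m => .inr (.inr (.inr (.inr (.inr (.inl (1, m))))))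
    | .fix m r => .inr (.inr (.inr (.inr (.inr (.inr (0, m, r))))))
    | .fwd m b => .inr (.inr (.inr (.inr (.inr (.inr (1, m, b)))))))
    (by intro a b; cases a <;> cases b <;> simp)

/-- The tapes: input, bits of the simulated track, program, trace. -/
inductive Idx | io | ov | pr | tr

instance : Finite Idx :=
  Finite.of_injective (β := Fin 4) (fun
    | .io => 0
    | .ov => 1
    | .pr => 2
    | .tr => 3)
    (by intro a b; cases a <;> cases b <;> simp)

/-- What to write on a tape (`none`: nothing) and how to move. -/
abbrev Upd := Option Sym × Option Turing.Dir

structure Move where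
  q : State
  io : Upd := (none, none)
  ov : Upd := (none, none)
  pr : Upd := (none, none)
  tr : Upd := (none, none)

def Move.upd (a : Move) : Idx → Upd
  | .io => a.io
  | .ov => a.ov
  | .pr => a.pr
  | .tr => a.tr

abbrev R : Option Turing.Dir := some .right
abbrev L : Option Turing.Dir := some .left

/-- A letter of the input. -/
def ltr (b : Bool) : Sym := some (.inl b)

def aux (a : Aux) : Sym := some (.inr a)

/-- A bit of a track. -/
def bit : Bool → Sym
  | true => some (.inl true)
  | false => none

/-- The input letter that is seen in a cell of the input tape. -/
def view : Mode → Sym → Option Bool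
  | _, none => none
  | _, some (.inl b) => some b
  | .child _, some (.inr (.wb b)) => some b
  | .child e, some (.inr .ext) => some e
  | _, some (.inr _) => none

def psym : PSym → Sym
  | .inl c => aux (.comp c false)
  | .inr f => aux (.rend f)

open Classical in
/-- The transitions; `b` is the nondeterministic choice. -/
noncomputable def delta (b : Bool) : State → Sym → Sym → Sym → Sym → Option Move
  | .parse n, some (.inl true), _, _, _ =>
    if h : n.1 + 1 < numSym then some { q := .parse ⟨n.1 + 1, h⟩, io := (none, R) } else none
  | .parse n, some (.inl false), _, _, _ =>
    match symEquiv.symm n with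
    | none => some { q := .prew, io := (none, R), pr := (none, L) }
    | some x => some { q := .parse 0, io := (none, R), pr := (some (psym x), R) }
  | .prew, _, _, some _, _ => some { q := .prew, pr := (none, L) }
  | .prew, _, _, none, _ => some { q := .pad, pr := (none, R) }
  | .pad, some (.inl true), _, _, _ => some { q := .pad, io := (none, R) }
  | .pad, some (.inl false), _, _, _ => some { q := .select none, io := (none, R) }
  -- A choice string that passes the last rule describes no path and is accepted. A guess that does
  -- so gets stuck and is rejected, as `select (some e)` has no transition here.
  | .select none, _, _, none, _ => some { q := .acc }
  | .select none, some (.inl true), _, some _, _ =>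
    some { q := .copy none, io := (some (aux (.wb true)), R), tr := (some (aux .sep), R) }
  | .select none, some (.inl false), _, some _, _ =>
    some { q := .skip none, io := (some (aux (.wb false)), R) }
  | .select none, none, _, some _, _ => some { q := .exh, pr := (none, L) }
  | .select (some e), _, _, some _, _ =>
    if b then some { q := .copy (some e), tr := (some (aux .sep), R) }
    else some { q := .skip (some e) }
  | .copy o, _, _, some (.inr (.comp c _)), _ =>
    some { q := .copy o, pr := (none, R), tr := (some (aux (.comp c false)), R) }
  | .copy o, _, _, some (.inr (.rend f)), _ => some { q := .rew o f, pr := (none, L) }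
  | .skip o, _, _, some (.inr (.comp _ _)), _ => some { q := .skip o, pr := (none, R) }
  | .skip o, _, _, some (.inr (.rend _)), _ => some { q := .select o, pr := (none, R) }
  | .rew o f, _, _, some _, _ => some { q := .rew o f, pr := (none, L) }
  | .rew o false, _, _, none, _ => some { q := .select o, pr := (none, R) }
  | .rew none true, _, _, none, _ => some { q := .mark true, pr := (none, R) }
  | .rew (some e) true, _, _, none, _ =>
    some { q := .back (.child e), pr := (none, R), tr := (none, L) }
  | .exh, _, _, some _, _ => some { q := .exh, pr := (none, L) }
  | .exh, _, _, none, _ => some { q := .mark false, pr := (none, R) }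
  | .mark f, some (.inl b), _, _, _ => some { q := .mark f, io := (some (aux (.wb b)), R) }
  | .mark f, none, _, _, _ => some { q := .home f, io := (some (aux .ext), L) }
  | .home f, some _, _, _, _ => some { q := .home f, io := (none, L) }
  | .home f, none, _, _, _ => some { q := .back (.path f), io := (none, R), tr := (none, L) }
  | .back m, _, _, _, none => some { q := .fwd m true, tr := (none, R) }
  -- Undo the component: retrace its move, then let `fix` restore the bit `c.r` that had been read.
  -- The bit tape is thus blank again after every pass.
  | .back m, _, _, _, some (.inr (.comp c true)) =>
    some { q := .fix m c.r, tr := (some (aux .era), none), io := (none, Turing.Tape.opp c.d),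
           ov := (none, Turing.Tape.opp c.d) }
  | .back m, _, _, _, some _ => some { q := .back m, tr := (none, L) }
  | .fix m r, _, _, _, _ => some { q := .back m, ov := (some (bit r), none), tr := (none, L) }
  -- If `need` is still set at the end, no component is left and all tracks have been checked;
  -- otherwise the pass is to be undone.
  | .fwd m true, _, _, _, none => some { q := .clear m, tr := (none, L) }
  | .fwd m false, _, _, _, none => some { q := .back m, tr := (none, L) }
  | .fwd m _, _, _, _, some (.inr .sep) => some { q := .fwd m true, tr := (none, R) }
  | .fwd m need, _, _, _, some (.inr .era) => some { q := .fwd m need, tr := (none, R) }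
  | .fwd m false, _, _, _, some (.inr (.comp _ _)) => some { q := .fwd m false, tr := (none, R) }
  | .fwd m true, i, o, _, some (.inr (.comp c _)) =>
    if (c.chk = none ∨ c.chk = some (view m i)) ∧ o.isSome = c.r then
      some { q := .fwd m false, io := (none, c.d), ov := (some (bit c.w), c.d),
             tr := (some (aux (.comp c true)), R) }
    -- A mismatch refutes the trace. For the trace given by the choice string this is a reason to
    -- accept, for a guessed trace it is a failure.
    else match m with
      | .path _ => some { q := .acc }
      | .child _ => none
  | .clear m, _, _, _, some _ => some { q := .clear m, tr := (some none, L) }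
  -- A genuine path that is still open leads to the verification of the two children in turn. For
  -- `.path true` there is no transition: a genuine accepting path makes the machine reject.
  | .clear (.path false), _, _, _, none => some { q := .select (some false) }
  | .clear (.child false), _, _, _, none => some { q := .select (some true) }
  | .clear (.child true), _, _, _, none => some { q := .acc }
  | _, _, _, _, _ => none

/-- The universal machine. -/
noncomputable def U : NTM where
  K := Idx
  Q := State
  A := Aux
  finite_K := inferInstance
  finite_Q := inferInstance
  finite_A := inferInstance
  io := .io
  start := .parse 0
  accept := {.acc}
  trans q s := {a | ∃ b m, delta b q (s .io) (s .ov) (s .pr) (s .tr) = some m ∧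
    a = (m.q, fun k => ((m.upd k).1.getD (s k), (m.upd k).2))}

/-- The effect of an update on a tape. -/
def apply (u : Upd) (T : Turing.Tape Sym) : Turing.Tape Sym :=
  match u.1 with
  | none => T.move? u.2
  | some a => (T.write a).move? u.2

@[simp] theorem apply_none (d : Option Turing.Dir) (T : Turing.Tape Sym) :
    apply (none, d) T = T.move? d := rfl

@[simp] theorem apply_some (a : Sym) (d : Option Turing.Dir) (T : Turing.Tape Sym) :
    apply (some a, d) T = (T.write a).move? d := rfl

/-- The configuration with the given state and tapes. -/
def cfg (q : State) (I V P T : Turing.Tape Sym) : U.Cfg :=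
  ⟨q, fun | .io => I | .ov => V | .pr => P | .tr => T⟩

/-- The configuration after a move. -/
def Move.target (m : Move) (I V P T : Turing.Tape Sym) : U.Cfg :=
  cfg m.q (apply m.io I) (apply m.ov V) (apply m.pr P) (apply m.tr T)

theorem step_cfg_iff {q : State} {I V P T : Turing.Tape Sym} {d : U.Cfg} :
    NTM.Step (cfg q I V P T) d ↔
      ∃ b m, delta b q I.head V.head P.head T.head = some m ∧ d = m.target I V P T := by
  have key : ∀ m : Move, (⟨m.q, fun k => NTM.act (M := U)
      ((m.upd k).1.getD (((cfg q I V P T).tape k).head), (m.upd k).2)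
      ((cfg q I V P T).tape k)⟩ : U.Cfg) = m.target I V P T := by
    intro m
    unfold Move.target cfg
    congr 1
    funext k
    refine (NTM.act_eq _ _ _).trans ?_
    rcases m with ⟨q', ⟨_ | i, di⟩, ⟨_ | o, dv⟩, ⟨_ | p, dp⟩, ⟨_ | t, dt⟩⟩ <;> cases k <;> rfl
  constructor
  · rintro ⟨_, ⟨b, m, hm, rfl⟩, rfl⟩
    exact ⟨b, m, hm, key m⟩
  · rintro ⟨b, m, hm, rfl⟩
    exact ⟨_, ⟨b, m, hm, rfl⟩, (key m).symm⟩

theorem forces_cfg {q q' : State} {I V P T I' V' P' T' : Turing.Tape Sym} (m : Move)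
    (h : ∀ b, delta b q I.head V.head P.head T.head = some m) (hq : m.q = q' := by rfl)
    (hI : apply m.io I = I' := by simp) (hV : apply m.ov V = V' := by simp)
    (hP : apply m.pr P = P' := by simp) (hT : apply m.tr T = T' := by simp) :
    NTM.Forces 1 (cfg q I V P T) (cfg q' I' V' P' T') := by
  subst hq hI hV hP hT
  refine NTM.Forces.single fun d' => ?_
  rw [step_cfg_iff]
  constructor
  · rintro ⟨b, m', hm, rfl⟩
    rw [h] at hm
    rw [← Option.some.inj hm]; rfl
  · rintro rfl
    exact ⟨true, m, h _, rfl⟩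

theorem halted_cfg {q : State} {I V P T : Turing.Tape Sym}
    (h : ∀ b, delta b q I.head V.head P.head T.head = none) : NTM.Halted (cfg q I V P T) := by
  rw [NTM.Halted, Set.eq_empty_iff_forall_notMem]
  rintro a ⟨b, m, hm, -⟩
  exact absurd hm (by rw [show ((cfg q I V P T).state) = q from rfl]; simp [h b, cfg])

theorem trans_eq_empty_of_mem_accept (q : State) (hq : q ∈ U.accept) (s : Idx → Sym) :
    U.trans q s = ∅ := by
  obtain rfl : q = State.acc := hq
  rw [Set.eq_empty_iff_forall_notMem]
  rintro a ⟨b, m, hm, -⟩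
  simp [delta] at hm

theorem halted_of_acc {c : U.Cfg} (h : c.state = State.acc) : NTM.Halted c :=
  trans_eq_empty_of_mem_accept c.state h _

end Universal

/-! ### Runs of the universal machine -/

namespace Universal

open Turing NTM

/-- The code of a symbol, in unary. -/
noncomputable def ucode (x : Option PSym) : List Bool :=
  List.replicate (symEquiv x).1 true ++ [false]

/-- The symbols of a rule. -/
def encR (ρ : Rule) : List PSym := ρ.1.map .inl ++ [.inr ρ.2]

/-- The symbols of a program. -/
def encP (D : List Rule) : List PSym := D.flatMap encR

/-- The code of a program. -/
noncomputable def code (D : List Rule) : List Bool :=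
  ((encP D).map some ++ [none]).flatMap ucode

/-- The contents of the program tape. -/
def ptape (D : List Rule) : List Sym := (encP D).map psym

theorem ptape_cons (ρ : Rule) (D : List Rule) :
    ptape (ρ :: D) = (encR ρ).map psym ++ ptape D := by simp [ptape, encP]

theorem ptape_append (D E : List Rule) : ptape (D ++ E) = ptape D ++ ptape E := by
  simp [ptape, encP]

theorem psym_ne_none (x : PSym) : psym x ≠ none := by cases x <;> simp [psym, aux]

theorem forces_parse_ones (k : ℕ) : ∀ (n n' : Fin numSym), n.1 + k = n'.1 →
    ∀ (X : List Sym) (Y : List Sym) (V P T : Tape Sym),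
    Forces k (cfg (.parse n) (Tape.mk₂ X ((List.replicate k true).map ltr ++ Y)) V P T)
      (cfg (.parse n') (Tape.mk₂ (List.replicate k (ltr true) ++ X) Y) V P T) := by
  induction k with
  | zero =>
    intro n n' h X Y V P T
    obtain rfl : n = n' := Fin.ext (by simpa using h)
    exact .refl _ _
  | succ k ih =>
    intro n n' h X Y V P T
    have hn : n.1 + 1 < numSym := by have := n'.2; omega
    have h₁ : Forces 1 (cfg (.parse n)
        (Tape.mk₂ X ((List.replicate (k + 1) true).map ltr ++ Y)) V P T)
        (cfg (.parse ⟨n.1 + 1, hn⟩)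
          (Tape.mk₂ (ltr true :: X) ((List.replicate k true).map ltr ++ Y)) V P T) :=
      forces_cfg { q := .parse ⟨n.1 + 1, hn⟩, io := (none, R) }
        (fun b => by simp [List.replicate_succ, ltr, delta, hn])
        (hI := by simp [List.replicate_succ])
    have h₂ := ih ⟨n.1 + 1, hn⟩ n' (by simp only; omega) (ltr true :: X) Y V P T
    have := h₁.trans h₂
    rw [show List.replicate k (ltr true) ++ ltr true :: X =
      List.replicate (k + 1) (ltr true) ++ X by
        rw [List.replicate_succ', List.append_assoc]; rfl] at this
    exact this.mono (by omega)

theorem forces_parse_sym (x : PSym) (X PL : List Sym) (Y : List Bool) (V T : Tape Sym) :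
    Forces (ucode (some x)).length
      (cfg (.parse 0) (Tape.mk₂ X ((ucode (some x) ++ Y).map ltr)) V (Tape.mk₂ PL []) T)
      (cfg (.parse 0) (Tape.mk₂ ((ucode (some x)).map ltr |>.reverse |>.append X) (Y.map ltr)) V
        (Tape.mk₂ (psym x :: PL) []) T) := by
  have h₁ := forces_parse_ones (symEquiv (some x)).1 0 (symEquiv (some x)) (by simp) X
    (ltr false :: Y.map ltr) V (Tape.mk₂ PL []) T
  have h₂ : Forces 1 (cfg (.parse (symEquiv (some x)))
      (Tape.mk₂ (List.replicate (symEquiv (some x)).1 (ltr true) ++ X) (ltr false :: Y.map ltr)) V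
        (Tape.mk₂ PL []) T) (cfg (.parse 0) (Tape.mk₂ (ltr false ::
          (List.replicate (symEquiv (some x)).1 (ltr true) ++ X)) (Y.map ltr)) V
        (Tape.mk₂ (psym x :: PL) []) T) :=
    forces_cfg { q := .parse 0, io := (none, R), pr := (some (psym x), R) }
      (fun b => by simp [ltr, delta])
  have := h₁.trans h₂
  simpa [ucode] using this

theorem forces_parse (l : List PSym) : ∀ (X PL : List Sym) (Y : List Bool) (V T : Tape Sym),
    Forces ((l.map some ++ [none]).flatMap ucode).length
      (cfg (.parse 0) (Tape.mk₂ X (((l.map some ++ [none]).flatMap ucode ++ Y).map ltr)) V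
        (Tape.mk₂ PL []) T)
      (cfg .prew (Tape.mk₂ (((l.map some ++ [none]).flatMap ucode).map ltr |>.reverse |>.append X)
        (Y.map ltr)) V ((Tape.mk₂ ((l.map psym).reverse ++ PL) []).move .left) T) := by
  induction l with
  | nil =>
    intro X PL Y V T
    have h₁ := forces_parse_ones (symEquiv none).1 0 (symEquiv none) (by simp) X
      (ltr false :: Y.map ltr) V (Tape.mk₂ PL []) T
    have h₂ : Forces 1 (cfg (.parse (symEquiv none))
        (Tape.mk₂ (List.replicate (symEquiv none).1 (ltr true) ++ X) (ltr false :: Y.map ltr)) V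
          (Tape.mk₂ PL []) T) (cfg .prew (Tape.mk₂ (ltr false ::
            (List.replicate (symEquiv none).1 (ltr true) ++ X)) (Y.map ltr)) V
          ((Tape.mk₂ PL []).move .left) T) :=
      forces_cfg { q := .prew, io := (none, R), pr := (none, L) }
        (fun b => by simp [ltr, delta])
    have := h₁.trans h₂
    simpa [ucode] using this
  | cons x l ih =>
    intro X PL Y V T
    have h₁ := forces_parse_sym x X PL ((l.map some ++ [none]).flatMap ucode ++ Y) V T
    have := h₁.trans (ih _ (psym x :: PL) Y V T)
    simpa [List.append_assoc] using this

/-- Moving back to the left end on the program tape. -/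
theorem forces_rewind_pr {q q' : State} {tm : Upd}
    (h₁ : ∀ b i o x t, delta b q i o (some x) t = some { q := q, pr := (none, L) })
    (h₂ : ∀ b i o t, delta b q i o none t = some { q := q', pr := (none, R), tr := tm })
    (X : List Sym) (hX : ∀ x ∈ X, x ≠ none) : ∀ (Y : List Sym) (I V T : Tape Sym),
    Forces (X.length + 1) (cfg q I V ((Tape.mk₂ X Y).move .left) T)
      (cfg q' I V (Tape.mk₂ [] (X.reverse ++ Y)) (apply tm T)) := by
  induction X with
  | nil =>
    intro Y I V T
    exact forces_cfg { q := q', pr := (none, R), tr := tm } (fun b => h₂ b _ _ _)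
  | cons x X ih =>
    intro Y I V T
    obtain ⟨s, hs⟩ := Option.ne_none_iff_exists'.1 (hX x List.mem_cons_self)
    have h := ih (fun x hx => hX x (List.mem_cons_of_mem _ hx)) (x :: Y) I V T
    have h' : Forces 1 (cfg q I V ((Tape.mk₂ (x :: X) Y).move .left) T)
        (cfg q I V ((Tape.mk₂ X (x :: Y)).move .left) T) :=
      forces_cfg { q := q, pr := (none, L) } (fun b => by
        rw [Tape.mk₂_move_left, Tape.mk₂_head_cons, hs]; exact h₁ b _ _ _ _)
    have := h'.trans h
    rw [List.reverse_cons, List.append_assoc]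
    exact this.mono (by simp only [List.length_cons]; omega)

theorem forces_pad (p : ℕ) : ∀ (X Y : List Sym) (V P T : Tape Sym),
    Forces (p + 1)
      (cfg .pad (Tape.mk₂ X ((List.replicate p true ++ [false]).map ltr ++ Y)) V P T)
      (cfg (.select none)
        (Tape.mk₂ (((List.replicate p true ++ [false]).map ltr).reverse ++ X) Y) V P T) := by
  induction p with
  | zero =>
    intro X Y V P T
    exact forces_cfg { q := .select none, io := (none, R) } (fun b => by simp [ltr, delta])
  | succ p ih =>
    intro X Y V P T
    have h₁ : Forces 1
        (cfg .pad (Tape.mk₂ X ((List.replicate (p + 1) true ++ [false]).map ltr ++ Y)) V P T)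
        (cfg .pad (Tape.mk₂ (ltr true :: X)
          ((List.replicate p true ++ [false]).map ltr ++ Y)) V P T) :=
      forces_cfg { q := .pad, io := (none, R) }
        (fun b => by simp [List.replicate_succ, ltr, delta]) (hI := by simp [List.replicate_succ])
    have := h₁.trans (ih (ltr true :: X) Y V P T)
    refine Forces.mono ?_ (show 1 + (p + 1) ≤ p + 1 + 1 by omega)
    simpa [List.replicate_succ] using this

/-- The fixed part of the input. -/
noncomputable def base (D : List Rule) (p : ℕ) : List Bool :=
  code D ++ (List.replicate p true ++ [false])

/-- The empty tape. -/
abbrev blank : Tape Sym := Tape.mk₂ [] []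

theorem forces_start (D : List Rule) (p : ℕ) (w : List Bool) :
    Forces ((base D p).length + (ptape D).length + 1) (U.init (base D p ++ w))
      (cfg (.select none) (Tape.mk₂ ((base D p).map ltr).reverse (w.map ltr)) blank
        (Tape.mk₂ [] (ptape D)) blank) := by
  have h₁ := forces_parse (encP D) [] [] ((List.replicate p true ++ [false]) ++ w) blank blank
  have h₂ := forces_rewind_pr (q := .prew) (q' := .pad) (tm := (none, none))
    (fun b i o x t => by simp [delta]) (fun b i o t => by simp [delta])
    ((encP D).map psym).reverse (by
      intro x hx
      obtain ⟨y, -, rfl⟩ := List.mem_map.1 (List.mem_reverse.1 hx)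
      exact psym_ne_none y) [] (Tape.mk₂ ((code D).map ltr).reverse
        (((List.replicate p true ++ [false]) ++ w).map ltr)) blank blank
  have h₃ := forces_pad p ((code D).map ltr).reverse (w.map ltr) blank
    (Tape.mk₂ [] (ptape D)) blank
  have hinit : U.init (base D p ++ w) = cfg (.parse 0) (Tape.mk₂ []
      (((base D p) ++ w).map ltr)) blank (Tape.mk₂ [] []) blank := by
    unfold NTM.init cfg
    congr 1
    funext k
    cases k <;> simp [U, NTM.wordTape, Tape.mk₁] <;> rfl
  rw [hinit]
  have h₁' : Forces (code D).length (cfg (.parse 0) (Tape.mk₂ []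
      ((base D p ++ w).map ltr)) blank (Tape.mk₂ [] []) blank) (cfg .prew (Tape.mk₂ ((code D).map ltr).reverse
        (((List.replicate p true ++ [false]) ++ w).map ltr)) blank
        ((Tape.mk₂ (((encP D).map psym).reverse) []).move .left) blank) := by
    simpa [code, base, List.append_assoc] using h₁
  have h₂' : Forces ((ptape D).length + 1) (cfg .prew (Tape.mk₂ ((code D).map ltr).reverse
        (((List.replicate p true ++ [false]) ++ w).map ltr)) blank
        ((Tape.mk₂ (((encP D).map psym).reverse) []).move .left) blank) (cfg .pad (Tape.mk₂ ((code D).map ltr).reverse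
        (((List.replicate p true ++ [false]) ++ w).map ltr)) blank
        (Tape.mk₂ [] (ptape D)) blank) := by
    simpa [ptape] using h₂
  have := (h₁'.trans h₂').trans (by simpa using h₃)
  refine Forces.mono (b := (code D).length + ((ptape D).length + 1) + (p + 1)) ?_ ?_
  · simpa [base] using this
  · simp only [base, List.length_append, List.length_replicate, List.length_singleton]; omega

end Universal

/-! ### The passes over the trace -/

namespace Universal

open Turing NTM

/-- A component on the trace tape. -/
def csym (m : Bool) (c : Comp) : Sym := aux (.comp c m)

/-- A rule on the trace tape after `j` passes. -/
def rec (j : ℕ) (l : List Comp) : List Sym :=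
  aux .sep :: (List.replicate j (aux .era) ++ (l.drop j).map (csym false))

/-- A rule on the trace tape after the forward part of pass `j`. -/
def recM (j : ℕ) (l : List Comp) : List Sym :=
  aux .sep :: (List.replicate j (aux .era) ++
    csym true (l.getD j default) :: (l.drop (j + 1)).map (csym false))

def trace (j : ℕ) (τ : List (List Comp)) : List Sym := τ.flatMap (rec j)

def traceM (j : ℕ) (τ : List (List Comp)) : List Sym := τ.flatMap (recM j)

theorem drop_eq_getD_cons {l : List Comp} {j : ℕ} (h : j < l.length) :
    l.drop j = l.getD j default :: l.drop (j + 1) := by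
  rw [List.drop_eq_getElem_cons h, List.getD_eq_getElem _ _ h]

theorem length_rec {j : ℕ} {l : List Comp} (h : j ≤ l.length) :
    (rec j l).length = l.length + 1 := by
  simp [rec]; omega

theorem length_trace {j N : ℕ} {τ : List (List Comp)} (h : ∀ l ∈ τ, l.length = N) (hj : j ≤ N) :
    (trace j τ).length = (N + 1) * τ.length := by
  induction τ with
  | nil => simp [trace]
  | cons l τ ih =>
    have hl := h l List.mem_cons_self
    have := ih fun l' hl' => h l' (List.mem_cons_of_mem _ hl')
    simp only [trace] at this ⊢
    rw [List.flatMap_cons, List.length_append, this, length_rec (by omega), hl, List.length_cons]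
    ring

/-- The symbols that are skipped on the way back. -/
def Skippable (s : Sym) : Prop := s ≠ none ∧ ∀ c, s ≠ aux (.comp c true)

theorem skippable_of_mem_rec {j : ℕ} {l : List Comp} {s : Sym} (h : s ∈ rec j l) :
    Skippable s := by
  simp only [rec, List.mem_cons, List.mem_append, List.mem_replicate, List.mem_map] at h
  rcases h with rfl | ⟨-, rfl⟩ | ⟨c, -, rfl⟩ <;> simp [Skippable, aux, csym]

theorem skippable_of_mem_trace {j : ℕ} {τ : List (List Comp)} {s : Sym} (h : s ∈ trace j τ) :
    Skippable s := by
  obtain ⟨l, -, h⟩ := List.mem_flatMap.1 h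
  exact skippable_of_mem_rec h

theorem delta_back {s : Sym} (hs : Skippable s) (b : Bool) (m : Mode) (i o p : Sym) :
    delta b (.back m) i o p s = some { q := .back m, tr := (none, L) } := by
  obtain ⟨h₁, h₂⟩ := hs
  rcases s with _ | x | (⟨c, _ | _⟩ | _ | _ | _ | _ | _)
  · exact absurd rfl h₁
  all_goals first | exact absurd rfl (h₂ c) | simp [delta]

theorem forces_back_skip (m : Mode) (I V P : Tape Sym) (X : List Sym)
    (hX : ∀ x ∈ X, Skippable x) : ∀ (Y Z : List Sym),
    Forces X.length (cfg (.back m) I V P ((Tape.mk₂ (X.reverse ++ Y) Z).move .left))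
      (cfg (.back m) I V P ((Tape.mk₂ Y (X ++ Z)).move .left)) := by
  induction X using List.reverseRecOn with
  | nil => intro Y Z; exact .refl _ _
  | append_singleton X x ih =>
    intro Y Z
    have h := ih (fun x hx => hX x (by simp [hx])) Y (x :: Z)
    have h' : Forces 1 (cfg (.back m) I V P ((Tape.mk₂ ((X ++ [x]).reverse ++ Y) Z).move .left))
        (cfg (.back m) I V P ((Tape.mk₂ (X.reverse ++ Y) (x :: Z)).move .left)) :=
      forces_cfg { q := .back m, tr := (none, L) } (fun b => by
        simpa using delta_back (hX x (by simp)) b m _ _ _)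
    have := h'.trans h
    rw [List.append_assoc]
    exact this.mono (by simp; omega)

theorem forces_back_home (m : Mode) (I V P : Tape Sym) (Z : List Sym) :
    Forces 1 (cfg (.back m) I V P ((Tape.mk₂ [] Z).move .left))
      (cfg (.fwd m true) I V P (Tape.mk₂ [] Z)) :=
  forces_cfg { q := .fwd m true, tr := (none, R) } (fun b => by
    rw [Tape.mk₂_nil_move_left_head]; rfl)

theorem forces_fwd_era (m : Mode) (need : Bool) (I V P : Tape Sym) (j : ℕ) :
    ∀ (Y Z : List Sym), Forces j
      (cfg (.fwd m need) I V P (Tape.mk₂ Y (List.replicate j (aux .era) ++ Z)))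
      (cfg (.fwd m need) I V P (Tape.mk₂ (List.replicate j (aux .era) ++ Y) Z)) := by
  induction j with
  | zero => intro Y Z; exact .refl _ _
  | succ j ih =>
    intro Y Z
    have h' : Forces 1
        (cfg (.fwd m need) I V P (Tape.mk₂ Y (List.replicate (j + 1) (aux .era) ++ Z)))
        (cfg (.fwd m need) I V P
          (Tape.mk₂ (aux .era :: Y) (List.replicate j (aux .era) ++ Z))) :=
      forces_cfg { q := .fwd m need, tr := (none, R) }
        (fun b => by cases need <;> simp [List.replicate_succ, aux, delta])
        (hT := by simp [List.replicate_succ])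
    have := h'.trans (ih (aux .era :: Y) Z)
    rw [show List.replicate j (aux .era) ++ aux .era :: Y =
      List.replicate (j + 1) (aux .era) ++ Y by
        rw [List.replicate_succ', List.append_assoc]; rfl] at this
    exact this.mono (by omega)

theorem forces_fwd_comps (m : Mode) (I V P : Tape Sym) (l : List Comp) :
    ∀ (Y Z : List Sym), Forces l.length
      (cfg (.fwd m false) I V P (Tape.mk₂ Y (l.map (csym false) ++ Z)))
      (cfg (.fwd m false) I V P (Tape.mk₂ ((l.map (csym false)).reverse ++ Y) Z)) := by
  induction l with
  | nil => intro Y Z; exact .refl _ _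
  | cons c l ih =>
    intro Y Z
    have h' : Forces 1
        (cfg (.fwd m false) I V P (Tape.mk₂ Y ((c :: l).map (csym false) ++ Z)))
        (cfg (.fwd m false) I V P
          (Tape.mk₂ (csym false c :: Y) (l.map (csym false) ++ Z))) :=
      forces_cfg { q := .fwd m false, tr := (none, R) } (fun b => by simp [csym, aux, delta])
    have := h'.trans (ih (csym false c :: Y) Z)
    rw [List.map_cons, List.reverse_cons, List.append_assoc]
    exact this.mono (by simp; omega)

theorem forces_fwd_sep (m : Mode) (need : Bool) (I V P : Tape Sym) (Y Z : List Sym) :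
    Forces 1 (cfg (.fwd m need) I V P (Tape.mk₂ Y (aux .sep :: Z)))
      (cfg (.fwd m true) I V P (Tape.mk₂ (aux .sep :: Y) Z)) :=
  forces_cfg { q := .fwd m true, tr := (none, R) }
    (fun b => by cases need <;> simp [aux, delta])

/-- The bits of a track, as tape symbols. -/
def bitMap : PointedMap Bool Sym := ⟨bit, rfl⟩

theorem isSome_bit (b : Bool) : (bit b).isSome = b := by cases b <;> rfl

/-- The result of executing a component, or of failing to do so. -/
theorem forces_fwd_comp (m : Mode) (I : Tape Sym) (V : Tape Bool) (P : Tape Sym) (c : Comp)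
    (Y Z : List Sym) {I' : Tape Sym} {V' : Tape Bool}
    (h : Track.step (view m) c (I, V) = some (I', V')) :
    Forces 1 (cfg (.fwd m true) I (V.map bitMap) P (Tape.mk₂ Y (csym false c :: Z)))
      (cfg (.fwd m false) I' (V'.map bitMap) P (Tape.mk₂ (csym true c :: Y) Z)) := by
  rw [Track.step] at h
  split_ifs at h with hc
  have hI := congrArg Prod.fst (Option.some.inj h)
  have hV := congrArg Prod.snd (Option.some.inj h)
  dsimp only at hI hV hc
  refine forces_cfg
    { q := .fwd m false, io := (none, c.d), ov := (some (bit c.w), c.d),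
      tr := (some (aux (.comp c true)), R) } (fun b => ?_) rfl (by simpa using hI) ?_ (by simp) ?_
  · have : (c.chk = none ∨ c.chk = some (view m I.head)) ∧
        ((V.map bitMap).head.isSome) = c.r := by
      refine ⟨hc.1, ?_⟩
      rw [Tape.map_fst]
      exact (isSome_bit _).trans hc.2
    rw [show (Tape.mk₂ Y (csym false c :: Z)).head = aux (.comp c false) from rfl]
    simp only [aux, delta]
    rw [if_pos this]
  · rw [← hV, Tape.map_move?, Tape.map_write]
    rfl
  · simp [csym]

theorem forces_fwd_comp_fail (m : Mode) (I : Tape Sym) (V : Tape Bool) (P : Tape Sym) (c : Comp)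
    (Y Z : List Sym) (h : Track.step (view m) c (I, V) = none) :
    ∃ d, Forces 1 (cfg (.fwd m true) I (V.map bitMap) P (Tape.mk₂ Y (csym false c :: Z))) d ∧
      Halted d ∧ (d.state = State.acc ↔ ∃ f, m = .path f) := by
  rw [Track.step] at h
  have hc : ¬ ((c.chk = none ∨ c.chk = some (view m I.head)) ∧
        ((V.map bitMap).head.isSome) = c.r) := by
    intro hc
    rw [if_pos] at h
    · simp at h
    · refine ⟨hc.1, ?_⟩
      rw [Tape.map_fst] at hc
      exact (isSome_bit _).symm.trans hc.2
  cases m with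
  | path f =>
    refine ⟨_, forces_cfg (I' := I) (V' := V.map bitMap) (P' := P) (T' := Tape.mk₂ Y (csym false c :: Z))
      { q := .acc } fun b => ?_, halted_of_acc rfl, ?_⟩
    · rw [show (Tape.mk₂ Y (csym false c :: Z)).head = aux (.comp c false) from rfl]
      simp only [aux, delta]
      rw [if_neg hc]
    · exact ⟨fun _ => ⟨f, rfl⟩, fun _ => rfl⟩
  | child e =>
    refine ⟨_, .refl _ _, halted_cfg fun b => ?_, ?_⟩
    · rw [show (Tape.mk₂ Y (csym false c :: Z)).head = aux (.comp c false) from rfl]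
      simp only [aux, delta]
      rw [if_neg hc]
    · simp [cfg]

theorem trace_cons (j : ℕ) (l : List Comp) (τ : List (List Comp)) :
    trace j (l :: τ) = rec j l ++ trace j τ := rfl

theorem traceM_cons (j : ℕ) (l : List Comp) (τ : List (List Comp)) :
    traceM j (l :: τ) = recM j l ++ traceM j τ := rfl

theorem forces_fwd_rec (m : Mode) (need : Bool) (I : Tape Sym) (V : Tape Bool) (P : Tape Sym)
    {j : ℕ} {l : List Comp} (hj : j < l.length) (Y Z : List Sym) :
    Forces (j + 1) (cfg (.fwd m need) I (V.map bitMap) P (Tape.mk₂ Y (rec j l ++ Z)))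
      (cfg (.fwd m true) I (V.map bitMap) P
        (Tape.mk₂ (List.replicate j (aux .era) ++ aux .sep :: Y)
          (csym false (l.getD j default) :: ((l.drop (j + 1)).map (csym false) ++ Z)))) := by
  have h₁ := forces_fwd_sep m need I (V.map bitMap) P Y
    (List.replicate j (aux .era) ++ (csym false (l.getD j default) ::
      ((l.drop (j + 1)).map (csym false) ++ Z)))
  have h₂ := forces_fwd_era m true I (V.map bitMap) P j (aux .sep :: Y)
    (csym false (l.getD j default) :: ((l.drop (j + 1)).map (csym false) ++ Z))
  have := h₁.trans h₂
  have he : rec j l ++ Z = aux .sep :: (List.replicate j (aux .era) ++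
      (csym false (l.getD j default) :: ((l.drop (j + 1)).map (csym false) ++ Z))) := by
    rw [rec, drop_eq_getD_cons hj]
    simp
  rw [he]
  exact this.mono (by omega)

/-- Since `j < N`, each rule has one component to execute, which leaves `need` unset; only an empty
trace preserves the flag. A rule occupies `N + 1` cells, its separator included. -/
theorem forces_fwd (m : Mode) (P : Tape Sym) {j N : ℕ} (hj : j < N) (τ : List (List Comp))
    (hτ : ∀ l ∈ τ, l.length = N) :
    ∀ (need : Bool) (I : Tape Sym) (V : Tape Bool) (Y Z : List Sym) {I' : Tape Sym}
      {V' : Tape Bool}, Track.run (view m) (Track.col j τ) (I, V) = some (I', V') →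
    Forces ((N + 1) * τ.length)
      (cfg (.fwd m need) I (V.map bitMap) P (Tape.mk₂ Y (trace j τ ++ Z)))
      (cfg (.fwd m (if τ = [] then need else false)) I' (V'.map bitMap) P
        (Tape.mk₂ ((traceM j τ).reverse ++ Y) Z)) := by
  induction τ with
  | nil =>
    intro need I V Y Z I' V' h
    obtain ⟨rfl, rfl⟩ := Prod.mk.inj (Option.some.inj h)
    exact .refl _ _
  | cons l τ ih =>
    intro need I V Y Z I' V' h
    have hl := hτ l List.mem_cons_self
    rw [Track.col_cons, Track.run] at h
    obtain ⟨⟨I₁, V₁⟩, hs, hr⟩ := Option.bind_eq_some_iff.1 h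
    have h₁ := forces_fwd_rec m need I V P (hl ▸ hj) Y (trace j τ ++ Z)
    have h₂ := forces_fwd_comp m I V P (l.getD j default)
      (List.replicate j (aux .era) ++ aux .sep :: Y)
      ((l.drop (j + 1)).map (csym false) ++ (trace j τ ++ Z)) hs
    have h₃ := forces_fwd_comps m I₁ (V₁.map bitMap) P (l.drop (j + 1))
      (csym true (l.getD j default) :: (List.replicate j (aux .era) ++ aux .sep :: Y))
      (trace j τ ++ Z)
    have h₄ := ih (fun l' hl' => hτ l' (List.mem_cons_of_mem _ hl')) false I₁ V₁
      (((l.drop (j + 1)).map (csym false)).reverse ++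
        (csym true (l.getD j default) :: (List.replicate j (aux .era) ++ aux .sep :: Y))) Z hr
    have := ((h₁.trans h₂).trans h₃).trans h₄
    have e₁ : (traceM j (l :: τ)).reverse ++ Y = (traceM j τ).reverse ++
        (((l.drop (j + 1)).map (csym false)).reverse ++
          (csym true (l.getD j default) :: (List.replicate j (aux .era) ++ aux .sep :: Y))) := by
      rw [traceM_cons, recM]
      simp
    rw [trace_cons, List.append_assoc, e₁]
    have e₂ : (if l :: τ = [] then need else false) = if τ = [] then false else false := by simp
    rw [e₂]
    refine this.mono ?_
    rw [List.length_drop, List.length_cons, hl, Nat.mul_succ]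
    omega

theorem forces_fwd_fail (m : Mode) (P : Tape Sym) {j N : ℕ} (hj : j < N) (τ : List (List Comp))
    (hτ : ∀ l ∈ τ, l.length = N) :
    ∀ (need : Bool) (I : Tape Sym) (V : Tape Bool) (Y Z : List Sym),
      Track.run (view m) (Track.col j τ) (I, V) = none →
    ∃ d, Forces ((N + 1) * τ.length)
      (cfg (.fwd m need) I (V.map bitMap) P (Tape.mk₂ Y (trace j τ ++ Z))) d ∧
      Halted d ∧ (d.state = State.acc ↔ ∃ f, m = .path f) := by
  induction τ with
  | nil => intro need I V Y Z h; simp [Track.run] at h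
  | cons l τ ih =>
    intro need I V Y Z h
    have hl := hτ l List.mem_cons_self
    rw [Track.col_cons, Track.run] at h
    have h₁ := forces_fwd_rec m need I V P (hl ▸ hj) Y (trace j τ ++ Z)
    rw [trace_cons, List.append_assoc]
    cases hs : Track.step (view m) (l.getD j default) (I, V) with
    | none =>
      obtain ⟨d, h₂, h₃⟩ := forces_fwd_comp_fail m I V P (l.getD j default)
        (List.replicate j (aux .era) ++ aux .sep :: Y)
        ((l.drop (j + 1)).map (csym false) ++ (trace j τ ++ Z)) hs
      refine ⟨d, (h₁.trans h₂).mono ?_, h₃⟩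
      rw [List.length_cons, Nat.mul_succ]
      omega
    | some s =>
      obtain ⟨I₁, V₁⟩ := s
      rw [hs, Option.bind_some] at h
      have h₂ := forces_fwd_comp m I V P (l.getD j default)
        (List.replicate j (aux .era) ++ aux .sep :: Y)
        ((l.drop (j + 1)).map (csym false) ++ (trace j τ ++ Z)) hs
      have h₃ := forces_fwd_comps m I₁ (V₁.map bitMap) P (l.drop (j + 1))
        (csym true (l.getD j default) :: (List.replicate j (aux .era) ++ aux .sep :: Y))
        (trace j τ ++ Z)
      obtain ⟨d, h₄, h₅⟩ := ih (fun l' hl' => hτ l' (List.mem_cons_of_mem _ hl')) false I₁ V₁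
        (((l.drop (j + 1)).map (csym false)).reverse ++
          (csym true (l.getD j default) :: (List.replicate j (aux .era) ++ aux .sep :: Y))) Z h
      refine ⟨d, (((h₁.trans h₂).trans h₃).trans h₄).mono ?_, h₅⟩
      rw [List.length_drop, List.length_cons, hl, Nat.mul_succ]
      omega

/-- A component is undone on the way back. -/
theorem forces_back_comp (m : Mode) (I : Tape Sym) (V : Tape Bool) (P : Tape Sym) (c : Comp)
    (Y Z : List Sym) {I' : Tape Sym} {V' : Tape Bool}
    (h : Track.step (view m) c (I, V) = some (I', V')) :
    Forces 2 (cfg (.back m) I' (V'.map bitMap) P (Tape.mk₂ Y (csym true c :: Z)))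
      (cfg (.back m) I (V.map bitMap) P ((Tape.mk₂ Y (aux .era :: Z)).move .left)) := by
  rw [Track.step] at h
  split_ifs at h with hc
  obtain ⟨rfl, rfl⟩ := Prod.mk.inj (Option.some.inj h)
  dsimp only at hc
  have h₁ : Forces 1 (cfg (.back m) (I.move? c.d) (((V.write c.w).move? c.d).map bitMap) P
        (Tape.mk₂ Y (csym true c :: Z)))
      (cfg (.fix m c.r) I ((V.write c.w).map bitMap) P (Tape.mk₂ Y (aux .era :: Z))) := by
    refine forces_cfg
      { q := .fix m c.r, tr := (some (aux .era), none),
        io := (none, Tape.opp c.d), ov := (none, Tape.opp c.d) } (fun b => ?_)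
      rfl (by simp) ?_ (by simp) (by simp)
    · rw [show (Tape.mk₂ Y (csym true c :: Z)).head = aux (.comp c true) from rfl]
      simp [aux, delta]
    · rw [apply_none, ← Tape.map_move?, Tape.move?_opp_move?]
  have h₂ : Forces 1 (cfg (.fix m c.r) I ((V.write c.w).map bitMap) P
        (Tape.mk₂ Y (aux .era :: Z)))
      (cfg (.back m) I (V.map bitMap) P ((Tape.mk₂ Y (aux .era :: Z)).move .left)) := by
    refine forces_cfg { q := .back m, ov := (some (bit c.r), none), tr := (none, L) }
      (fun b => by simp [delta]) rfl (by simp) ?_ (by simp) (by simp)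
    rw [apply_some, Tape.move?_none, show bit c.r = bitMap c.r from rfl, ← Tape.map_write,
      Tape.write_write, ← hc.2, Tape.write_head_self]
  exact h₁.trans h₂

/-- The components are inverted in reverse order, so the input head and the bit tape return to their
initial state without a separate reset. Each rule costs one step more than its `N + 1` cells,
because undoing a component takes two steps. -/
theorem forces_back (m : Mode) (P : Tape Sym) {j N : ℕ} (hj : j < N) (τ : List (List Comp))
    (hτ : ∀ l ∈ τ, l.length = N) :
    ∀ (I : Tape Sym) (V : Tape Bool) (Y Z : List Sym) {I' : Tape Sym}
      {V' : Tape Bool}, Track.run (view m) (Track.col j τ) (I, V) = some (I', V') →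
    Forces ((N + 2) * τ.length)
      (cfg (.back m) I' (V'.map bitMap) P
        ((Tape.mk₂ ((traceM j τ).reverse ++ Y) Z).move .left))
      (cfg (.back m) I (V.map bitMap) P ((Tape.mk₂ Y (trace (j + 1) τ ++ Z)).move .left)) := by
  induction τ with
  | nil =>
    intro I V Y Z I' V' h
    obtain ⟨rfl, rfl⟩ := Prod.mk.inj (Option.some.inj h)
    exact .refl _ _
  | cons l τ ih =>
    intro I V Y Z I' V' h
    have hl := hτ l List.mem_cons_self
    rw [Track.col_cons, Track.run] at h
    obtain ⟨⟨I₁, V₁⟩, hs, hr⟩ := Option.bind_eq_some_iff.1 h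
    have h₁ := ih (fun l' hl' => hτ l' (List.mem_cons_of_mem _ hl')) I₁ V₁
      ((recM j l).reverse ++ Y) Z hr
    have e₁ : (recM j l).reverse ++ Y = ((l.drop (j + 1)).map (csym false)).reverse ++
        (csym true (l.getD j default) :: ((aux .sep :: List.replicate j (aux .era)).reverse ++ Y)) := by
      rw [recM]; simp
    have h₂ := forces_back_skip m I₁ (V₁.map bitMap) P ((l.drop (j + 1)).map (csym false))
      (by intro x hx; obtain ⟨c, -, rfl⟩ := List.mem_map.1 hx; simp [Skippable, csym, aux])
      (csym true (l.getD j default) :: ((aux .sep :: List.replicate j (aux .era)).reverse ++ Y))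
      (trace (j + 1) τ ++ Z)
    rw [Tape.mk₂_move_left (csym true _)] at h₂
    have h₃ := forces_back_comp m I V P (l.getD j default)
      ((aux .sep :: List.replicate j (aux .era)).reverse ++ Y)
      ((l.drop (j + 1)).map (csym false) ++ (trace (j + 1) τ ++ Z)) hs
    have h₄ := forces_back_skip m I (V.map bitMap) P (aux .sep :: List.replicate j (aux .era))
      (by
        intro x hx
        rcases List.mem_cons.1 hx with rfl | hx
        · simp [Skippable, aux]
        · rw [List.eq_of_mem_replicate hx]; simp [Skippable, aux]) Y
      (aux .era :: ((l.drop (j + 1)).map (csym false) ++ (trace (j + 1) τ ++ Z)))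
    rw [e₁] at h₁
    have := ((h₁.trans h₂).trans h₃).trans h₄
    have e₂ : (traceM j (l :: τ)).reverse ++ Y = (traceM j τ).reverse ++
      (((l.drop (j + 1)).map (csym false)).reverse ++
        (csym true (l.getD j default) ::
          ((aux .sep :: List.replicate j (aux .era)).reverse ++ Y))) := by
      rw [← e₁, traceM_cons]; simp
    have e₃ : trace (j + 1) (l :: τ) ++ Z = (aux .sep :: List.replicate j (aux .era)) ++
        (aux .era :: ((l.drop (j + 1)).map (csym false) ++ (trace (j + 1) τ ++ Z))) := by
      rw [trace_cons, rec, List.replicate_succ']; simp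
    rw [e₂, e₃]
    refine this.mono ?_
    rw [List.length_map, List.length_drop, List.length_cons, List.length_cons, hl,
      List.length_replicate, Nat.mul_succ]
    omega

/-- Per rule, `N + 1` steps forward and `N + 2` steps back; the summand `2` pays for the two turns.
An empty trace is excluded because it would leave `need` set and end the passes. -/
theorem forces_pass (m : Mode) (P : Tape Sym) {j N : ℕ} (hj : j < N) {τ : List (List Comp)}
    (hτ : ∀ l ∈ τ, l.length = N) (hne : τ ≠ []) (I : Tape Sym)
    (h : (Track.run (view m) (Track.col j τ) (I, Tape.mk₁ [])).isSome) :
    Forces ((2 * N + 3) * τ.length + 2)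
      (cfg (.fwd m true) I blank P (Tape.mk₂ [] (trace j τ)))
      (cfg (.fwd m true) I blank P (Tape.mk₂ [] (trace (j + 1) τ))) := by
  obtain ⟨⟨I', V'⟩, h⟩ := Option.isSome_iff_exists.1 h
  have hb : (Tape.mk₁ ([] : List Bool)).map bitMap = blank := by
    rw [Tape.map_mk₁]; rfl
  have h₁ := forces_fwd m P hj τ hτ true I (Tape.mk₁ []) [] [] h
  have h₂ : Forces 1 (cfg (.fwd m false) I' (V'.map bitMap) P
      (Tape.mk₂ ((traceM j τ).reverse ++ []) []))
      (cfg (.back m) I' (V'.map bitMap) P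
      ((Tape.mk₂ ((traceM j τ).reverse ++ []) []).move .left)) :=
    forces_cfg { q := .back m, tr := (none, L) } (fun b => by rw [Tape.mk₂_head_nil]; rfl)
  have h₃ := forces_back m P hj τ hτ I (Tape.mk₁ []) [] [] h
  have h₄ := forces_back_home m I blank P (trace (j + 1) τ)
  rw [if_neg hne, hb, List.append_nil (trace j τ)] at h₁
  rw [hb, List.append_nil (trace (j + 1) τ)] at h₃
  refine (((h₁.trans h₂).trans h₃).trans h₄).mono (le_of_eq ?_)
  ring

theorem forces_clear_loop (m : Mode) (I V P : Tape Sym) (X : List Sym)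
    (hX : ∀ x ∈ X, x ≠ none) :
    Forces X.length (cfg (.clear m) I V P ((Tape.mk₂ X []).move .left))
      (cfg (.clear m) I V P blank) := by
  have hmv : (Tape.mk₂ ([] : List Sym) []).move .left = blank := by
    apply Tape.ext_nth
    intro i
    rw [Tape.move_left_nth]
    rcases i with (_ | i) | i <;> rcases h : (_ - 1 : ℤ) with (_ | k) | k <;> rfl
  induction X with
  | nil => rw [hmv]; exact .refl _ _
  | cons x X ih =>
    obtain ⟨s, hs⟩ := Option.ne_none_iff_exists'.1 (hX x List.mem_cons_self)
    have hdef : Tape.mk₂ X [(none : Sym)] = Tape.mk₂ X [] :=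
      Tape.mk₂_append_replicate_default X [] 1
    have h' : Forces 1 (cfg (.clear m) I V P ((Tape.mk₂ (x :: X) []).move .left))
        (cfg (.clear m) I V P ((Tape.mk₂ X []).move .left)) :=
      forces_cfg { q := .clear m, tr := (some none, L) } (fun b => by
        rw [Tape.mk₂_move_left, Tape.mk₂_head_cons, hs]; simp [delta])
        (hT := by rw [Tape.mk₂_move_left, apply_some, Tape.mk₂_write_cons, hdef]; rfl)
    exact (h'.trans (ih fun x hx => hX x (List.mem_cons_of_mem _ hx))).mono (by simp; omega)

/-- A pass that finds no component. -/
theorem forces_last_pass (m : Mode) (P : Tape Sym) {N : ℕ} {τ : List (List Comp)}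
    (hτ : ∀ l ∈ τ, l.length = N) (I V : Tape Sym) :
    Forces (2 * (N + 1) * τ.length + 1)
      (cfg (.fwd m true) I V P (Tape.mk₂ [] (trace N τ))) (cfg (.clear m) I V P blank) := by
  have h₁ : ∀ (σ : List (List Comp)), (∀ l ∈ σ, l.length = N) → ∀ Y, Forces ((N + 1) * σ.length)
      (cfg (.fwd m true) I V P (Tape.mk₂ Y (trace N σ)))
      (cfg (.fwd m true) I V P (Tape.mk₂ ((trace N σ).reverse ++ Y) [])) := by
    intro σ
    induction σ with
    | nil => intro _ Y; exact .refl _ _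
    | cons l σ ih =>
      intro hσ Y
      have e : rec N l = aux .sep :: List.replicate N (aux .era) := by
        rw [rec, List.drop_of_length_le (hσ l List.mem_cons_self).le]; simp
      have h₁ := forces_fwd_sep m true I V P Y (List.replicate N (aux .era) ++ trace N σ)
      have h₂ := forces_fwd_era m true I V P N (aux .sep :: Y) (trace N σ)
      have h₃ := ih (fun l' hl' => hσ l' (List.mem_cons_of_mem _ hl'))
        (List.replicate N (aux .era) ++ aux .sep :: Y)
      rw [trace_cons, e]
      have := (h₁.trans h₂).trans h₃
      simp only [List.cons_append, List.reverse_cons, List.reverse_append, List.reverse_replicate,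
        List.append_assoc, List.nil_append] at this ⊢
      refine this.mono ?_
      rw [List.length_cons, Nat.mul_succ]
      omega
  have h₁ := h₁ τ hτ []
  have h₂ : Forces 1 (cfg (.fwd m true) I V P (Tape.mk₂ ((trace N τ).reverse ++ []) []))
      (cfg (.clear m) I V P ((Tape.mk₂ ((trace N τ).reverse ++ []) []).move .left)) :=
    forces_cfg { q := .clear m, tr := (none, L) } (fun b => by rw [Tape.mk₂_head_nil]; rfl)
  have h₃ := forces_clear_loop m I V P ((trace N τ).reverse ++ []) (by
    intro x hx
    rw [List.append_nil, List.mem_reverse] at hx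
    exact (skippable_of_mem_trace hx).1)
  refine ((h₁.trans h₂).trans h₃).mono ?_
  rw [List.append_nil, List.length_reverse, length_trace hτ le_rfl]
  linarith

/-- The time for all passes over a trace of `m` rules. -/
def passTime (N m : ℕ) : ℕ := (N + 2) * ((2 * N + 3) * m + 2)

/-- Induction on the number `k` of tracks still to be checked. The first failing track stops the
machine; the `+ 1` stands for the last pass, which finds nothing left to execute. -/
theorem forces_check_aux (m : Mode) (P : Tape Sym) {N : ℕ} {τ : List (List Comp)}
    (hτ : ∀ l ∈ τ, l.length = N) (hne : τ ≠ []) (I : Tape Sym) (k : ℕ) :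
    ∀ j, j + k = N →
    ((∀ i, j ≤ i → i < N → (Track.run (view m) (Track.col i τ) (I, Tape.mk₁ [])).isSome) →
      Forces ((k + 1) * ((2 * N + 3) * τ.length + 2))
        (cfg (.fwd m true) I blank P (Tape.mk₂ [] (trace j τ))) (cfg (.clear m) I blank P blank)) ∧
    ((∃ i, j ≤ i ∧ i < N ∧ ¬ (Track.run (view m) (Track.col i τ) (I, Tape.mk₁ [])).isSome) →
      ∃ d, Forces ((k + 1) * ((2 * N + 3) * τ.length + 2))
        (cfg (.fwd m true) I blank P (Tape.mk₂ [] (trace j τ))) d ∧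
        Halted d ∧ (d.state = State.acc ↔ ∃ f, m = .path f)) := by
  induction k with
  | zero =>
    intro j hj
    obtain rfl : j = N := by omega
    refine ⟨fun _ => (forces_last_pass m P hτ I blank).mono ?_, ?_⟩
    · nlinarith [Nat.zero_le τ.length]
    · rintro ⟨i, hi, hi', -⟩; omega
  | succ k ih =>
    intro j hj
    obtain ⟨ih₁, ih₂⟩ := ih (j + 1) (by omega)
    have hjN : j < N := by omega
    constructor
    · intro h
      have h₁ := forces_pass m P hjN hτ hne I (h j le_rfl hjN)
      have h₂ := ih₁ fun i hi hi' => h i (by omega) hi'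
      exact (h₁.trans h₂).mono (le_of_eq (by ring))
    · rintro ⟨i, hi, hi', h⟩
      by_cases hr : (Track.run (view m) (Track.col j τ) (I, Tape.mk₁ [])).isSome
      · have h₁ := forces_pass m P hjN hτ hne I hr
        have hij : j ≠ i := by rintro rfl; exact h hr
        obtain ⟨d, h₂, h₃⟩ := ih₂ ⟨i, by omega, hi', h⟩
        exact ⟨d, (h₁.trans h₂).mono (le_of_eq (by ring)), h₃⟩
      · have hb : (Tape.mk₁ ([] : List Bool)).map bitMap = blank := by
          rw [Tape.map_mk₁]; rfl
        obtain ⟨d, h₁, h₂⟩ := forces_fwd_fail m P hjN τ hτ true I (Tape.mk₁ []) [] []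
          (Option.not_isSome_iff_eq_none.1 hr)
        rw [hb, List.append_nil] at h₁
        refine ⟨d, h₁.mono ?_, h₂⟩
        nlinarith [Nat.zero_le τ.length, Nat.zero_le (k * ((2 * N + 3) * τ.length + 2))]

/-- The passes find out whether the trace is consistent. -/
theorem forces_check (m : Mode) (P : Tape Sym) {N : ℕ} {τ : List (List Comp)}
    (hτ : ∀ l ∈ τ, l.length = N) (I : Tape Sym) :
    (Track.Consistent (view m) I N τ → Forces (passTime N τ.length + (N + 1) * τ.length)
      (cfg (.back m) I blank P ((Tape.mk₂ (trace 0 τ).reverse []).move .left))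
      (cfg (.clear m) I blank P blank)) ∧
    (¬ Track.Consistent (view m) I N τ →
      ∃ d, Forces (passTime N τ.length + (N + 1) * τ.length)
        (cfg (.back m) I blank P ((Tape.mk₂ (trace 0 τ).reverse []).move .left)) d ∧
        Halted d ∧ (d.state = State.acc ↔ ∃ f, m = .path f)) := by
  have h₁ := forces_back_skip m I blank P (trace 0 τ) (fun x hx => skippable_of_mem_trace hx) [] []
  have h₂ := forces_back_home m I blank P (trace 0 τ)
  rw [List.append_nil, List.append_nil, length_trace hτ (Nat.zero_le _)] at h₁
  have h₃ := h₁.trans h₂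
  have hcons : Track.Consistent (view m) I N τ ↔ ∀ i, 0 ≤ i → i < N →
      (Track.run (view m) (Track.col i τ) (I, Tape.mk₁ [])).isSome := by
    simp [Track.Consistent]
  by_cases hne : τ = []
  · subst hne
    have hc : Track.Consistent (view m) I N [] := by
      intro j _; rfl
    refine ⟨fun _ => ?_, fun h => absurd hc h⟩
    have h₄ := forces_last_pass (N := N) m P (τ := []) (by simp) I blank
    exact (h₃.trans h₄).mono (by simp [passTime])
  · obtain ⟨h₄, h₅⟩ := forces_check_aux m P hτ hne I N 0 (by omega)
    constructor
    · intro h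
      refine (h₃.trans (h₄ (hcons.1 h))).mono ?_
      rw [passTime]
      nlinarith
    · intro h
      rw [hcons] at h
      push Not at h
      obtain ⟨i, hi, hi', h⟩ := h
      obtain ⟨d, h₆, h₇⟩ := h₅ ⟨i, hi, hi', by simpa using h⟩
      refine ⟨d, (h₃.trans h₆).mono ?_, h₇⟩
      rw [passTime]
      nlinarith

end Universal

/-! ### The selection of a trace -/

namespace Universal

open Turing NTM

/-- The result of selecting rules by a choice string: the end of the program was reached, or an
accepting rule was taken, or the choice string was exhausted. -/
inductive Sel
  | dead
  | flagged (τ : List (List Comp))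
  | opened (τ : List (List Comp)) (rest : List Rule)

/-- Select rules from the program `D`; `cur` is the part of `D` that is still to be considered for
the next rule, and the bits tell whether to take its first rule. -/
def sel (D : List Rule) : List Bool → List Rule → List (List Comp) → Sel
  | _, [], _ => .dead
  | [], ρ :: cur, τ => .opened τ (ρ :: cur)
  | false :: w, _ :: cur, τ => sel D w cur τ
  | true :: w, ρ :: _, τ => if ρ.2 then .flagged (τ ++ [ρ.1]) else sel D w D (τ ++ [ρ.1])

theorem trace_append (j : ℕ) (τ σ : List (List Comp)) :
    trace j (τ ++ σ) = trace j τ ++ trace j σ := by simp [trace]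

theorem trace_zero_singleton (l : List Comp) :
    trace 0 [l] = aux .sep :: l.map (csym false) := by simp [trace, rec]

theorem psym_mem_ptape_ne_none {D : List Rule} {x : Sym} (hx : x ∈ ptape D) : x ≠ none := by
  obtain ⟨y, -, rfl⟩ := List.mem_map.1 hx
  exact psym_ne_none y

theorem forces_skip (o : Option Bool) (I V T : Tape Sym) (ρ : Rule) (X Y : List Sym) :
    Forces (encR ρ).length
      (cfg (.skip o) I V (Tape.mk₂ X ((encR ρ).map psym ++ Y)) T)
      (cfg (.select o) I V (Tape.mk₂ (((encR ρ).map psym).reverse ++ X) Y) T) := by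
  obtain ⟨l, f⟩ := ρ
  induction l generalizing X with
  | nil =>
    exact forces_cfg { q := .select o, pr := (none, R) }
      (fun b => by simp [encR, psym, aux, delta]) (hP := by simp [encR])
  | cons c l ih =>
    have h : Forces 1 (cfg (.skip o) I V (Tape.mk₂ X ((encR (c :: l, f)).map psym ++ Y)) T)
        (cfg (.skip o) I V (Tape.mk₂ (psym (.inl c) :: X) ((encR (l, f)).map psym ++ Y)) T) :=
      forces_cfg { q := .skip o, pr := (none, R) }
        (fun b => by simp [encR, psym, aux, delta]) (hP := by simp [encR])
    have := h.trans (ih (psym (.inl c) :: X))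
    refine Forces.mono (b := 1 + (encR (l, f)).length) ?_ (by simp [encR]; omega)
    simpa [encR] using this

theorem forces_copy (o : Option Bool) (I V : Tape Sym) (ρ : Rule) (X Y TL : List Sym) :
    Forces (encR ρ).length
      (cfg (.copy o) I V (Tape.mk₂ X ((encR ρ).map psym ++ Y)) (Tape.mk₂ TL []))
      (cfg (.rew o ρ.2) I V ((Tape.mk₂ ((ρ.1.map fun c => psym (.inl c)).reverse ++ X)
        (psym (.inr ρ.2) :: Y)).move .left)
        (Tape.mk₂ ((ρ.1.map (csym false)).reverse ++ TL) [])) := by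
  obtain ⟨l, f⟩ := ρ
  induction l generalizing X TL with
  | nil =>
    exact forces_cfg { q := .rew o f, pr := (none, L) }
      (fun b => by simp [encR, psym, aux, delta]) (hP := by simp [encR])
  | cons c l ih =>
    have h : Forces 1
        (cfg (.copy o) I V (Tape.mk₂ X ((encR (c :: l, f)).map psym ++ Y)) (Tape.mk₂ TL []))
        (cfg (.copy o) I V (Tape.mk₂ (psym (.inl c) :: X) ((encR (l, f)).map psym ++ Y))
          (Tape.mk₂ (csym false c :: TL) [])) :=
      forces_cfg { q := .copy o, pr := (none, R), tr := (some (aux (.comp c false)), R) }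
        (fun b => by simp [encR, psym, aux, delta]) (hP := by simp [encR])
        (hT := by simp [csym])
    have := h.trans (ih (psym (.inl c) :: X) (csym false c :: TL))
    refine Forces.mono (b := 1 + (encR (l, f)).length) ?_ (by simp [encR]; omega)
    simpa using this

theorem forces_rew (o : Option Bool) (I V T : Tape Sym) (X Y : List Sym)
    (hX : ∀ x ∈ X, x ≠ none) :
    Forces (X.length + 1) (cfg (.rew o false) I V ((Tape.mk₂ X Y).move .left) T)
      (cfg (.select o) I V (Tape.mk₂ [] (X.reverse ++ Y)) T) :=
  forces_rewind_pr (q := .rew o false) (q' := .select o) (tm := (none, none))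
    (fun b i o x t => by simp [delta]) (fun b i o t => by simp [delta]) X hX Y I V T

theorem forces_rew_none (I V T : Tape Sym) (X Y : List Sym) (hX : ∀ x ∈ X, x ≠ none) :
    Forces (X.length + 1) (cfg (.rew none true) I V ((Tape.mk₂ X Y).move .left) T)
      (cfg (.mark true) I V (Tape.mk₂ [] (X.reverse ++ Y)) T) :=
  forces_rewind_pr (q := .rew none true) (q' := .mark true) (tm := (none, none))
    (fun b i o x t => by simp [delta]) (fun b i o t => by simp [delta]) X hX Y I V T

theorem forces_rew_some (e : Bool) (I V T : Tape Sym) (X Y : List Sym)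
    (hX : ∀ x ∈ X, x ≠ none) :
    Forces (X.length + 1) (cfg (.rew (some e) true) I V ((Tape.mk₂ X Y).move .left) T)
      (cfg (.back (.child e)) I V (Tape.mk₂ [] (X.reverse ++ Y)) (T.move .left)) :=
  forces_rewind_pr (q := .rew (some e) true) (q' := .back (.child e)) (tm := (none, L))
    (fun b i o x t => by simp [delta]) (fun b i o t => by simp [delta]) X hX Y I V T

theorem forces_exh (I V T : Tape Sym) (X Y : List Sym) (hX : ∀ x ∈ X, x ≠ none) :
    Forces (X.length + 1) (cfg .exh I V ((Tape.mk₂ X Y).move .left) T)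
      (cfg (.mark false) I V (Tape.mk₂ [] (X.reverse ++ Y)) T) :=
  forces_rewind_pr (q := .exh) (q' := .mark false) (tm := (none, none))
    (fun b i o x t => by simp [delta]) (fun b i o t => by simp [delta]) X hX Y I V T

/-- The state after a rule was copied and the program tape was rewound. -/
def afterCopy : Option Bool → Bool → State
  | o, false => .select o
  | none, true => .mark true
  | some e, true => .back (.child e)

/-- The trace tape after a rule was copied and the program tape was rewound. -/
def afterCopyTape : Option Bool → Bool → Tape Sym → Tape Sym
  | some _, true, T => T.move .left
  | _, _, T => T

theorem forces_copy_rew (o : Option Bool) (I V : Tape Sym) (done cur : List Rule) (ρ : Rule)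
    (τ : List (List Comp)) :
    Forces (2 * (ptape (done ++ ρ :: cur)).length + 1)
      (cfg (.copy o) I V (Tape.mk₂ (ptape done).reverse (ptape (ρ :: cur)))
        (Tape.mk₂ (aux .sep :: (trace 0 τ).reverse) []))
      (cfg (afterCopy o ρ.2) I V (Tape.mk₂ [] (ptape (done ++ ρ :: cur)))
        (afterCopyTape o ρ.2 (Tape.mk₂ (trace 0 (τ ++ [ρ.1])).reverse []))) := by
  have h₁ := forces_copy o I V ρ (ptape done).reverse (ptape cur)
    (aux .sep :: (trace 0 τ).reverse)
  have htr : (ρ.1.map (csym false)).reverse ++ aux .sep :: (trace 0 τ).reverse =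
      (trace 0 (τ ++ [ρ.1])).reverse := by
    rw [trace_append, trace_zero_singleton]; simp
  rw [htr] at h₁
  set X := (ρ.1.map fun c => psym (.inl c)).reverse ++ (ptape done).reverse with hXdef
  have hX : ∀ x ∈ X, x ≠ none := by
    intro x hx
    rcases List.mem_append.1 hx with hx | hx
    · obtain ⟨c, -, rfl⟩ := List.mem_map.1 (List.mem_reverse.1 hx)
      exact psym_ne_none _
    · exact psym_mem_ptape_ne_none (List.mem_reverse.1 hx)
  have hp : X.reverse ++ psym (.inr ρ.2) :: ptape cur = ptape (done ++ ρ :: cur) := by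
    rw [ptape_append, ptape_cons, encR, hXdef]; simp
  have hlen : X.length + 1 + (ptape cur).length = (ptape (done ++ ρ :: cur)).length := by
    rw [← hp]; simp; omega
  have hlen' : (encR ρ).length ≤ (ptape (done ++ ρ :: cur)).length := by
    rw [ptape_append, ptape_cons]; simp; omega
  rw [ptape_cons]
  set T := Tape.mk₂ (trace 0 (τ ++ [ρ.1])).reverse ([] : List Sym)
  have h₂ : Forces (X.length + 1)
      (cfg (.rew o ρ.2) I V ((Tape.mk₂ X (psym (.inr ρ.2) :: ptape cur)).move .left) T)
      (cfg (afterCopy o ρ.2) I V (Tape.mk₂ [] (X.reverse ++ psym (.inr ρ.2) :: ptape cur))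
        (afterCopyTape o ρ.2 T)) := by
    rcases o with _ | e <;> cases ρ.2
    · exact forces_rew none I V T X _ hX
    · exact forces_rew_none I V T X _ hX
    · exact forces_rew (some e) I V T X _ hX
    · exact forces_rew_some e I V T X _ hX
  rw [hp] at h₂
  exact (h₁.trans h₂).mono (by omega)

/-- The marked letters of the choice string. -/
def mrk (b : Bool) : Sym := aux (.wb b)

/-- The selection of a trace by the choice string. -/
theorem forces_select (D : List Rule) (V : Tape Sym) (w : List Bool) :
    ∀ (done cur : List Rule) (τ : List (List Comp)) (X : List Sym), D = done ++ cur →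
    (sel D w cur τ = .dead → ∃ d, Forces ((3 * (ptape D).length + 3) * (w.length + 1))
      (cfg (.select none) (Tape.mk₂ X (w.map ltr)) V
        (Tape.mk₂ (ptape done).reverse (ptape cur)) (Tape.mk₂ (trace 0 τ).reverse [])) d ∧
      d.state = State.acc) ∧
    ∀ (f : Bool) (σ : List (List Comp)),
      (f = true ∧ sel D w cur τ = .flagged σ) ∨ (f = false ∧ ∃ c, sel D w cur τ = .opened σ c) →
      ∃ u v, w = u ++ v ∧ Forces ((3 * (ptape D).length + 3) * (w.length + 1))
        (cfg (.select none) (Tape.mk₂ X (w.map ltr)) V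
          (Tape.mk₂ (ptape done).reverse (ptape cur)) (Tape.mk₂ (trace 0 τ).reverse []))
        (cfg (.mark f) (Tape.mk₂ ((u.map mrk).reverse ++ X) (v.map ltr)) V
          (Tape.mk₂ [] (ptape D)) (Tape.mk₂ (trace 0 σ).reverse [])) := by
  induction w with
  | nil =>
    intro done cur τ X hD
    cases cur with
    | nil =>
      refine ⟨fun _ => ?_, ?_⟩
      · refine ⟨_, (forces_cfg (I' := Tape.mk₂ X []) (V' := V)
          (P' := Tape.mk₂ (ptape done).reverse (ptape [])) (T' := Tape.mk₂ (trace 0 τ).reverse [])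
          { q := .acc } (fun b => by
            rw [show ptape [] = [] from rfl, Tape.mk₂_head_nil]; rfl)).mono (by nlinarith), rfl⟩
      · rintro f σ (⟨-, h⟩ | ⟨-, c, h⟩) <;> simp [sel] at h
    | cons ρ cur =>
      refine ⟨fun h => by simp [sel] at h, ?_⟩
      rintro f σ (⟨-, h⟩ | ⟨rfl, c, h⟩)
      · simp [sel] at h
      · simp only [sel, Sel.opened.injEq] at h
        obtain ⟨rfl, -⟩ := h
        refine ⟨[], [], rfl, ?_⟩
        obtain ⟨s, Y, hs⟩ : ∃ s Y, ptape (ρ :: cur) = some s :: Y := by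
          rw [ptape_cons]
          obtain ⟨_ | ⟨c, l⟩, f⟩ := ρ
          · exact ⟨_, _, rfl⟩
          · exact ⟨_, _, rfl⟩
        have h₁ : Forces 1 (cfg (.select none) (Tape.mk₂ X []) V
            (Tape.mk₂ (ptape done).reverse (ptape (ρ :: cur))) (Tape.mk₂ (trace 0 τ).reverse []))
            (cfg .exh (Tape.mk₂ X []) V
            ((Tape.mk₂ (ptape done).reverse (ptape (ρ :: cur))).move .left)
              (Tape.mk₂ (trace 0 τ).reverse [])) :=
          forces_cfg { q := .exh, pr := (none, L) } (fun b => by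
            rw [Tape.mk₂_head_nil, hs, Tape.mk₂_head_cons]; rfl)
        have h₂ := forces_exh (Tape.mk₂ X []) V (Tape.mk₂ (trace 0 τ).reverse [])
          (ptape done).reverse (ptape (ρ :: cur)) (fun x hx =>
            psym_mem_ptape_ne_none (List.mem_reverse.1 hx))
        rw [List.reverse_reverse, ← ptape_append, ← hD] at h₂
        refine (h₁.trans h₂).mono ?_
        rw [List.length_reverse, hD, ptape_append, List.length_append, List.length_nil]
        omega
  | cons b w ih =>
    intro done cur τ X hD
    cases cur with
    | nil =>
      refine ⟨fun _ => ?_, ?_⟩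
      · refine ⟨_, (forces_cfg (I' := Tape.mk₂ X ((b :: w).map ltr)) (V' := V)
          (P' := Tape.mk₂ (ptape done).reverse (ptape [])) (T' := Tape.mk₂ (trace 0 τ).reverse [])
          { q := .acc } (fun b => by
            rw [show ptape [] = [] from rfl, Tape.mk₂_head_nil]; rfl)).mono (by nlinarith), rfl⟩
      · rintro f σ (⟨-, h⟩ | ⟨-, c, h⟩) <;> simp [sel] at h
    | cons ρ cur =>
      obtain ⟨s, Y, hs⟩ : ∃ s Y, ptape (ρ :: cur) = some s :: Y := by
        rw [ptape_cons]
        obtain ⟨_ | ⟨c, l⟩, f⟩ := ρ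
        · exact ⟨_, _, rfl⟩
        · exact ⟨_, _, rfl⟩
      have hDlen : (ptape (done ++ ρ :: cur)).length = (ptape D).length := by rw [hD]
      have hρ : (encR ρ).length ≤ (ptape D).length := by
        rw [hD, ptape_append, ptape_cons]; simp; omega
      cases b with
      | false =>
        have h₁ : Forces 1 (cfg (.select none) (Tape.mk₂ X ((false :: w).map ltr)) V
            (Tape.mk₂ (ptape done).reverse (ptape (ρ :: cur))) (Tape.mk₂ (trace 0 τ).reverse []))
            (cfg (.skip none) (Tape.mk₂ (mrk false :: X) (w.map ltr)) V
            (Tape.mk₂ (ptape done).reverse (ptape (ρ :: cur)))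
              (Tape.mk₂ (trace 0 τ).reverse [])) :=
          forces_cfg { q := .skip none, io := (some (aux (.wb false)), R) } (fun b => by
            rw [hs, Tape.mk₂_head_cons]; rfl) (hI := by simp [mrk])
        have h₂ := forces_skip none (Tape.mk₂ (mrk false :: X) (w.map ltr)) V
          (Tape.mk₂ (trace 0 τ).reverse []) ρ (ptape done).reverse (ptape cur)
        rw [← List.reverse_append, ← ptape_cons,
          show ptape done ++ (encR ρ).map psym = ptape (done ++ [ρ]) by
            rw [ptape_append, ptape_cons]; simp [ptape, encP]] at h₂
        have h₃ := h₁.trans h₂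
        obtain ⟨ih₁, ih₂⟩ := ih (done ++ [ρ]) cur τ (mrk false :: X) (by simp [hD])
        constructor
        · intro h
          obtain ⟨d, h₄, h₅⟩ := ih₁ (by simpa [sel] using h)
          refine ⟨d, (h₃.trans h₄).mono ?_, h₅⟩
          rw [List.length_cons]
          nlinarith
        · intro f σ h
          obtain ⟨u, v, rfl, h₄⟩ := ih₂ f σ (by simpa [sel] using h)
          refine ⟨false :: u, v, rfl, ?_⟩
          have := h₃.trans h₄
          rw [show ((false :: u).map mrk).reverse ++ X = (u.map mrk).reverse ++ (mrk false :: X) by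
            simp]
          refine this.mono ?_
          rw [List.length_cons]
          nlinarith
      | true =>
        have h₁ : Forces 1 (cfg (.select none) (Tape.mk₂ X ((true :: w).map ltr)) V
            (Tape.mk₂ (ptape done).reverse (ptape (ρ :: cur))) (Tape.mk₂ (trace 0 τ).reverse []))
            (cfg (.copy none) (Tape.mk₂ (mrk true :: X) (w.map ltr)) V
            (Tape.mk₂ (ptape done).reverse (ptape (ρ :: cur)))
              (Tape.mk₂ (aux .sep :: (trace 0 τ).reverse) [])) :=
          forces_cfg { q := .copy none, io := (some (aux (.wb true)), R), tr := (some (aux .sep), R) }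
            (fun b => by rw [hs, Tape.mk₂_head_cons]; rfl) (hI := by simp [mrk])
        have h₂ := forces_copy_rew none (Tape.mk₂ (mrk true :: X) (w.map ltr)) V done cur ρ τ
        have h₃ := h₁.trans h₂
        rw [hDlen, ← hD] at h₃
        obtain ⟨ih₁, ih₂⟩ := ih [] D (τ ++ [ρ.1]) (mrk true :: X) rfl
        cases hf : ρ.2 with
        | true =>
          rw [hf] at h₃
          constructor
          · intro h; simp [sel, hf] at h
          · rintro f σ (⟨rfl, h⟩ | ⟨rfl, c, h⟩)
            · simp only [sel, hf, if_true, Sel.flagged.injEq] at h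
              subst h
              refine ⟨[true], w, rfl, h₃.mono ?_⟩
              rw [List.length_cons]
              nlinarith
            · simp [sel, hf] at h
        | false =>
          rw [hf] at h₃
          have hsel : sel D (true :: w) (ρ :: cur) τ = sel D w D (τ ++ [ρ.1]) := by
            simp [sel, hf]
          rw [hsel]
          constructor
          · intro h
            obtain ⟨d, h₄, h₅⟩ := ih₁ h
            refine ⟨d, (h₃.trans h₄).mono ?_, h₅⟩
            rw [List.length_cons]
            nlinarith
          · intro f σ h
            obtain ⟨u, v, rfl, h₄⟩ := ih₂ f σ h
            refine ⟨true :: u, v, rfl, ?_⟩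
            have := h₃.trans h₄
            rw [show ((true :: u).map mrk).reverse ++ X = (u.map mrk).reverse ++ (mrk true :: X) by
              simp]
            refine this.mono ?_
            rw [List.length_cons]
            nlinarith

end Universal

/-! ### The language of the universal machine -/

namespace Universal

open Turing NTM

theorem forces_mark (f : Bool) (V P T : Tape Sym) (v : List Bool) : ∀ X : List Sym,
    Forces (v.length + 1) (cfg (.mark f) (Tape.mk₂ X (v.map ltr)) V P T)
      (cfg (.home f) ((Tape.mk₂ ((v.map mrk).reverse ++ X) [aux .ext]).move .left) V P T) := by
  induction v with
  | nil =>
    intro X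
    exact forces_cfg { q := .home f, io := (some (aux .ext), L) }
      (fun b => by rw [List.map_nil, Tape.mk₂_head_nil]; rfl)
  | cons b v ih =>
    intro X
    have h : Forces 1 (cfg (.mark f) (Tape.mk₂ X ((b :: v).map ltr)) V P T)
        (cfg (.mark f) (Tape.mk₂ (mrk b :: X) (v.map ltr)) V P T) :=
      forces_cfg { q := .mark f, io := (some (aux (.wb b)), R) }
        (fun b => by rw [List.map_cons, Tape.mk₂_head_cons]; rfl) (hI := by simp [mrk])
    have := h.trans (ih (mrk b :: X))
    rw [show ((b :: v).map mrk).reverse ++ X = (v.map mrk).reverse ++ (mrk b :: X) by simp]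
    exact this.mono (by rw [List.length_cons]; omega)

theorem forces_home (f : Bool) (V P T : Tape Sym) (X : List Sym) (hX : ∀ x ∈ X, x ≠ none) :
    ∀ Y : List Sym,
    Forces (X.length + 1) (cfg (.home f) ((Tape.mk₂ X Y).move .left) V P T)
      (cfg (.back (.path f)) (Tape.mk₂ [] (X.reverse ++ Y)) V P (T.move .left)) := by
  induction X with
  | nil =>
    intro Y
    exact forces_cfg { q := .back (.path f), io := (none, R), tr := (none, L) }
      (fun b => by rw [Tape.mk₂_nil_move_left_head]; rfl)
  | cons x X ih =>
    intro Y
    obtain ⟨s, hs⟩ := Option.ne_none_iff_exists'.1 (hX x List.mem_cons_self)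
    have h : Forces 1 (cfg (.home f) ((Tape.mk₂ (x :: X) Y).move .left) V P T)
        (cfg (.home f) ((Tape.mk₂ X (x :: Y)).move .left) V P T) :=
      forces_cfg { q := .home f, io := (none, L) } (fun b => by
        rw [Tape.mk₂_move_left, Tape.mk₂_head_cons, hs]; rfl)
    have := h.trans (ih (fun x hx => hX x (List.mem_cons_of_mem _ hx)) (x :: Y))
    rw [List.reverse_cons, List.append_assoc]
    exact this.mono (by rw [List.length_cons]; omega)

/-- The input tape after the choice string has been marked. -/
noncomputable def ioTape (D : List Rule) (p : ℕ) (w : List Bool) : Tape Sym :=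
  Tape.mk₂ [] ((base D p).map ltr ++ (w.map mrk ++ [aux .ext]))

theorem view_default (m : Mode) : view m default = default := by cases m <;> rfl

/-- The marked letters and the end cell are read as blanks in this mode, and blanks at the right end
do not change a tape. -/
theorem ioTape_map_path (D : List Rule) (p : ℕ) (w : List Bool) (f : Bool) :
    (ioTape D p w).map ⟨view (.path f), view_default _⟩ = Tape.mk₁ ((base D p).map some) := by
  rw [ioTape, Tape.map_mk₂, Tape.mk₁, List.map_nil]
  rw [← Tape.mk₂_append_replicate_default [] ((base D p).map some) (w.length + 1)]
  congr 1
  simp only [List.map_append, List.map_map, List.map_cons, List.map_nil, List.replicate_succ']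
  congr 1
  congr 1
  refine List.eq_replicate_iff.2 ⟨by simp, fun x hx => ?_⟩
  obtain ⟨b, -, rfl⟩ := List.mem_map.1 hx
  rfl

/-- The end cell is read as the letter `e`, so both children can be simulated on the same input
tape. -/
theorem ioTape_map_child (D : List Rule) (p : ℕ) (w : List Bool) (e : Bool) :
    (ioTape D p w).map ⟨view (.child e), view_default _⟩ =
      Tape.mk₁ ((base D p ++ (w ++ [e])).map some) := by
  rw [ioTape, Tape.map_mk₂, Tape.mk₁]
  simp only [List.map_append, List.map_map, List.map_cons, List.map_nil]
  rfl

/-- The time until the first pass. -/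
def selectTime (P n : ℕ) : ℕ := (4 * P + 8) * (n + 2)

/-- The configuration at the start of the passes. -/
noncomputable def checkCfg (D : List Rule) (p : ℕ) (w : List Bool) (m : Mode)
    (σ : List (List Comp)) : U.Cfg :=
  cfg (.back m) (ioTape D p w) blank (Tape.mk₂ [] (ptape D))
    ((Tape.mk₂ (trace 0 σ).reverse []).move .left)

/-- The configuration after the passes. -/
noncomputable def clearCfg (D : List Rule) (p : ℕ) (w : List Bool) (m : Mode) : U.Cfg :=
  cfg (.clear m) (ioTape D p w) blank (Tape.mk₂ [] (ptape D)) blank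

theorem forces_dead {D : List Rule} {p : ℕ} {w : List Bool} (h : sel D w D [] = .dead) :
    ∃ d, Forces (selectTime (ptape D).length ((base D p).length + w.length))
      (U.init (base D p ++ w)) d ∧ d.state = State.acc := by
  obtain ⟨d, h₁, h₂⟩ := (forces_select D blank w [] D [] ((base D p).map ltr).reverse rfl).1 h
  refine ⟨d, ((forces_start D p w).trans h₁).mono ?_, h₂⟩
  rw [selectTime]
  nlinarith [Nat.zero_le ((ptape D).length * (base D p).length)]

theorem forces_checkCfg {D : List Rule} {p : ℕ} {w : List Bool} {f : Bool}
    {σ : List (List Comp)}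
    (h : (f = true ∧ sel D w D [] = .flagged σ) ∨ (f = false ∧ ∃ c, sel D w D [] = .opened σ c)) :
    Forces (selectTime (ptape D).length ((base D p).length + w.length))
      (U.init (base D p ++ w)) (checkCfg D p w (.path f) σ) := by
  obtain ⟨u, v, rfl, h₁⟩ :=
    (forces_select D blank w [] D [] ((base D p).map ltr).reverse rfl).2 f σ h
  have h₂ := forces_mark f blank (Tape.mk₂ [] (ptape D)) (Tape.mk₂ (trace 0 σ).reverse []) v
    ((u.map mrk).reverse ++ ((base D p).map ltr).reverse)
  have h₃ := forces_home f blank (Tape.mk₂ [] (ptape D)) (Tape.mk₂ (trace 0 σ).reverse [])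
    ((v.map mrk).reverse ++ ((u.map mrk).reverse ++ ((base D p).map ltr).reverse)) (by
      intro x hx
      simp only [List.mem_append, List.mem_reverse, List.mem_map] at hx
      rcases hx with ⟨b, -, rfl⟩ | ⟨b, -, rfl⟩ | ⟨b, -, rfl⟩ <;> simp [mrk, aux, ltr]) [aux .ext]
  have he : ((v.map mrk).reverse ++ ((u.map mrk).reverse ++
      ((base D p).map ltr).reverse)).reverse ++ [aux .ext] =
      (base D p).map ltr ++ ((u ++ v).map mrk ++ [aux .ext]) := by simp
  have hl : ((v.map mrk).reverse ++ ((u.map mrk).reverse ++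
      ((base D p).map ltr).reverse)).length = (base D p).length + (u ++ v).length := by
    simp; omega
  rw [he, hl] at h₃
  refine ((((forces_start D p (u ++ v)).trans h₁).trans h₂).trans h₃).mono ?_
  rw [selectTime, List.length_append]
  nlinarith [Nat.zero_le ((ptape D).length * (base D p).length)]

/-- The only nondeterministic transition of the universal machine: guessing whether to take the rule
at hand. -/
theorem step_select_iff {e : Bool} {I V T : Tape Sym} {done cur : List Rule} {ρ : Rule}
    {τ : List (List Comp)} {d : U.Cfg} (hT : T = Tape.mk₂ (trace 0 τ).reverse []) :
    Step (cfg (.select (some e)) I V (Tape.mk₂ (ptape done).reverse (ptape (ρ :: cur))) T) d ↔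
      d = cfg (.copy (some e)) I V (Tape.mk₂ (ptape done).reverse (ptape (ρ :: cur)))
        (Tape.mk₂ (aux .sep :: (trace 0 τ).reverse) []) ∨
      d = cfg (.skip (some e)) I V (Tape.mk₂ (ptape done).reverse (ptape (ρ :: cur))) T := by
  obtain ⟨s, Y, hs⟩ : ∃ s Y, ptape (ρ :: cur) = some s :: Y := by
    rw [ptape_cons]
    obtain ⟨_ | ⟨c, l⟩, f⟩ := ρ
    · exact ⟨_, _, rfl⟩
    · exact ⟨_, _, rfl⟩
  have hd : ∀ b, delta b (.select (some e)) I.head V.head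
      (Tape.mk₂ (ptape done).reverse (ptape (ρ :: cur))).head T.head =
      if b then some { q := .copy (some e), tr := (some (aux .sep), R) }
      else some { q := .skip (some e) } := by
    intro b
    rw [hs, Tape.mk₂_head_cons]
    rfl
  have hw : apply (some (aux .sep), R) T = Tape.mk₂ (aux .sep :: (trace 0 τ).reverse) [] := by
    rw [hT]; simp
  rw [step_cfg_iff, Bool.exists_bool]
  simp only [hd, if_true, Bool.false_eq_true, if_false]
  constructor
  · rintro (⟨m, hm, rfl⟩ | ⟨m, hm, rfl⟩)
    · rw [← Option.some.inj hm]; exact .inr rfl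
    · rw [← Option.some.inj hm, ← hw]; exact .inl rfl
  · rintro (rfl | rfl)
    · exact .inr ⟨_, rfl, by rw [← hw]; rfl⟩
    · exact .inl ⟨_, rfl, rfl⟩

theorem acceptsIn_cases {M : NTM} {m : ℕ} {c : M.Cfg} (h : AcceptsIn m c) :
    (Halted c ∧ c.state ∈ M.accept) ∨ ∃ m' d, m = m' + 1 ∧ Step c d ∧ AcceptsIn m' d := by
  obtain ⟨e, he, hh⟩ := h
  cases he with
  | refl => exact .inl hh
  | head h₁ h₂ => exact .inr ⟨_, _, rfl, h₁, e, h₂, hh⟩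

/-- An accepting path that guesses a trace guesses an accepting trace. -/
theorem exists_guess {D : List Rule} {e : Bool} {I V : Tape Sym} (m : ℕ) :
    ∀ (done cur : List Rule) (τ : List (List Comp)), D = done ++ cur →
    AcceptsIn m (cfg (.select (some e)) I V (Tape.mk₂ (ptape done).reverse (ptape cur))
      (Tape.mk₂ (trace 0 τ).reverse [])) →
    ∃ (σ : List (List Comp)) (l : List Comp) (m' : ℕ), (∀ ρ ∈ σ, (ρ, false) ∈ D) ∧
      (l, true) ∈ D ∧ AcceptsIn m' (cfg (.back (.child e)) I V (Tape.mk₂ [] (ptape D))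
        ((Tape.mk₂ (trace 0 (τ ++ (σ ++ [l]))).reverse []).move .left)) := by
  induction m using Nat.strong_induction_on with
  | _ m ih =>
  intro done cur τ hD h
  cases cur with
  | nil =>
    have hh : Halted (cfg (.select (some e)) I V (Tape.mk₂ (ptape done).reverse (ptape []))
        (Tape.mk₂ (trace 0 τ).reverse [])) :=
      halted_cfg fun b => by rw [show ptape [] = [] from rfl, Tape.mk₂_head_nil]; rfl
    exact absurd (show State.select (some e) = .acc from (hh.acceptsIn_iff.1 h).2) (by simp)
  | cons ρ cur =>
    rcases acceptsIn_cases h with ⟨-, h⟩ | ⟨m', d, rfl, hs, h⟩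
    · exact absurd (show State.select (some e) = .acc from h) (by simp)
    rcases (step_select_iff rfl).1 hs with rfl | rfl
    · obtain ⟨m'', hm, h'⟩ := (forces_copy_rew (some e) I V done cur ρ τ).acceptsIn_of h
      rw [← hD] at h'
      have hmem : ρ ∈ D := by rw [hD]; simp
      cases hf : ρ.2 with
      | true =>
        rw [hf] at h'
        refine ⟨[], ρ.1, m'', by simp, ?_, h'⟩
        rwa [← hf]
      | false =>
        rw [hf] at h'
        obtain ⟨σ, l, m₃, h₁, h₂, h₃⟩ := ih m'' (by omega) [] D (τ ++ [ρ.1]) rfl h'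
        refine ⟨ρ.1 :: σ, l, m₃, ?_, h₂, by simpa using h₃⟩
        intro ρ' hρ'
        rcases List.mem_cons.1 hρ' with rfl | hρ'
        · rwa [← hf]
        · exact h₁ ρ' hρ'
    · have h₁ := forces_skip (some e) I V (Tape.mk₂ (trace 0 τ).reverse []) ρ
        (ptape done).reverse (ptape cur)
      rw [← List.reverse_append, ← ptape_cons,
          show ptape done ++ (encR ρ).map psym = ptape (done ++ [ρ]) by
            rw [ptape_append, ptape_cons]; simp [ptape, encP]] at h₁
      obtain ⟨m'', hm, h'⟩ := h₁.acceptsIn_of h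
      exact ih m'' (by omega) (done ++ [ρ]) cur τ (by simp [hD]) h'

/-- Any rule can be guessed. -/
theorem acceptsWithin_guess_rule {D : List Rule} {e : Bool} {I V : Tape Sym} {ρ : Rule}
    {τ : List (List Comp)} {b : ℕ}
    (h : AcceptsWithin b (cfg (afterCopy (some e) ρ.2) I V (Tape.mk₂ [] (ptape D))
        (afterCopyTape (some e) ρ.2 (Tape.mk₂ (trace 0 (τ ++ [ρ.1])).reverse [])))) (cur : List Rule) :
    ∀ (done : List Rule), D = done ++ cur → ρ ∈ cur →
    AcceptsWithin (b + 2 * (ptape cur).length + 2 * (ptape D).length + 2)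
      (cfg (.select (some e)) I V (Tape.mk₂ (ptape done).reverse (ptape cur))
        (Tape.mk₂ (trace 0 τ).reverse [])) := by
  induction cur with
  | nil => intro done _ hρ; simp at hρ
  | cons ρ' cur ih =>
    intro done hD hρ
    have hlen : 0 < (encR ρ').length := by simp [encR]
    rcases List.mem_cons.1 hρ with rfl | hρ
    · have h₁ := forces_copy_rew (some e) I V done cur ρ τ
      rw [← hD] at h₁
      have h₂ := (Steps.head ((step_select_iff rfl).2 (.inl rfl)) (.refl _)).acceptsWithin
        (h₁.acceptsWithin h)
      exact h₂.mono (by omega)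
    · have h₁ := forces_skip (some e) I V (Tape.mk₂ (trace 0 τ).reverse []) ρ'
        (ptape done).reverse (ptape cur)
      rw [← List.reverse_append, ← ptape_cons,
          show ptape done ++ (encR ρ').map psym = ptape (done ++ [ρ']) by
            rw [ptape_append, ptape_cons]; simp [ptape, encP]] at h₁
      have h₂ := ih (done ++ [ρ']) (by simp [hD]) hρ
      have h₃ := (Steps.head ((step_select_iff rfl).2 (.inr rfl)) (.refl _)).acceptsWithin
        (h₁.acceptsWithin h₂)
      refine h₃.mono ?_
      rw [ptape_cons, List.length_append, List.length_map]
      omega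

/-- Any accepting trace can be guessed. -/
theorem acceptsWithin_guess {D : List Rule} {e : Bool} {I V : Tape Sym} {l : List Comp} {b : ℕ}
    (hl : (l, true) ∈ D) (σ : List (List Comp)) (hσ : ∀ ρ ∈ σ, (ρ, false) ∈ D) :
    ∀ τ : List (List Comp),
    AcceptsWithin b (cfg (.back (.child e)) I V (Tape.mk₂ [] (ptape D))
        ((Tape.mk₂ (trace 0 (τ ++ (σ ++ [l]))).reverse []).move .left)) →
    AcceptsWithin (b + (σ.length + 1) * (4 * (ptape D).length + 2))
      (cfg (.select (some e)) I V (Tape.mk₂ [] (ptape D)) (Tape.mk₂ (trace 0 τ).reverse [])) := by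
  induction σ with
  | nil =>
    intro τ h
    exact (acceptsWithin_guess_rule (ρ := (l, true)) h D [] rfl hl).mono (by
      rw [List.length_nil]; omega)
  | cons ρ σ ih =>
    intro τ h
    have h₁ := ih (fun ρ' hρ' => hσ ρ' (List.mem_cons_of_mem _ hρ')) (τ ++ [ρ]) (by simpa using h)
    refine (acceptsWithin_guess_rule (ρ := (ρ, false)) h₁ D [] rfl
      (hσ ρ List.mem_cons_self)).mono ?_
    rw [List.length_cons, Nat.succ_mul (σ.length + 1)]
    omega

theorem acceptsIn_acc {c : U.Cfg} (h : c.state = State.acc) : AcceptsIn 0 c :=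
  ⟨c, .refl c, halted_of_acc h, h⟩

section Spec

variable {D : List Rule} {N : ℕ} (p : ℕ) (w : List Bool)

/-- In mode `child` an inconsistent guess stops in a non-accepting state, so the guess of an
accepting path is consistent, and the rest of the path starts after the passes. -/
theorem acceptsBy_of_acceptsIn (hN : ∀ ρ ∈ D, ρ.1.length = N) {e : Bool} {m : ℕ}
    (h : AcceptsIn m (cfg (.select (some e)) (ioTape D p w) blank (Tape.mk₂ [] (ptape D)) blank)) :
    (∃ n, Track.AcceptsBy (view (.child e)) (ioTape D p w) N D n) ∧
      ∃ m', AcceptsIn m' (clearCfg D p w (.child e)) := by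
  obtain ⟨σ, l, m', hσ, hl, h'⟩ := exists_guess m [] D [] rfl h
  have hlen : ∀ l' ∈ σ ++ [l], l'.length = N := by
    intro l' hl'
    rcases List.mem_append.1 hl' with hl' | hl'
    · exact hN _ (hσ l' hl')
    · obtain rfl := List.mem_singleton.1 hl'
      exact hN _ hl
  obtain ⟨h₁, h₂⟩ := forces_check (.child e) (Tape.mk₂ [] (ptape D)) hlen (ioTape D p w)
  by_cases hc : Track.Consistent (view (.child e)) (ioTape D p w) N (σ ++ [l])
  · obtain ⟨m'', -, h''⟩ := (h₁ hc).acceptsIn_of h'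
    exact ⟨⟨_, σ, l, rfl, hσ, hl, hc⟩, m'', h''⟩
  · obtain ⟨d, hd, hh, hs⟩ := h₂ hc
    obtain ⟨m'', -, h''⟩ := hd.acceptsIn_of h'
    have := (hh.acceptsIn_iff.1 h'').2
    obtain ⟨f, hf⟩ := hs.1 this
    simp at hf

theorem acceptsWithin_of_acceptsBy (hN : ∀ ρ ∈ D, ρ.1.length = N) {e : Bool} {m b : ℕ}
    (h : Track.AcceptsBy (view (.child e)) (ioTape D p w) N D m)
    (hb : AcceptsWithin b (clearCfg D p w (.child e))) :
    AcceptsWithin (passTime N (m + 1) + (N + 1) * (m + 1) + b + (m + 1) * (4 * (ptape D).length + 2))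
      (cfg (.select (some e)) (ioTape D p w) blank (Tape.mk₂ [] (ptape D)) blank) := by
  obtain ⟨σ, l, rfl, hσ, hl, hc⟩ := h
  have hlen : ∀ l' ∈ σ ++ [l], l'.length = N := by
    intro l' hl'
    rcases List.mem_append.1 hl' with hl' | hl'
    · exact hN _ (hσ l' hl')
    · obtain rfl := List.mem_singleton.1 hl'
      exact hN _ hl
  have h₁ := ((forces_check (.child e) (Tape.mk₂ [] (ptape D)) hlen
    (ioTape D p w)).1 hc).acceptsWithin hb
  have h₂ := acceptsWithin_guess hl σ hσ [] h₁
  simpa [show trace 0 [] = [] from rfl] using h₂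

theorem forces_clear_path : Forces 1 (clearCfg D p w (.path false))
    (cfg (.select (some false)) (ioTape D p w) blank (Tape.mk₂ [] (ptape D)) blank) :=
  forces_cfg { q := .select (some false) } (fun b => by rw [Tape.mk₂_head_nil]; rfl)

theorem forces_clear_child : Forces 1 (clearCfg D p w (.child false))
    (cfg (.select (some true)) (ioTape D p w) blank (Tape.mk₂ [] (ptape D)) blank) :=
  forces_cfg { q := .select (some true) } (fun b => by rw [Tape.mk₂_head_nil]; rfl)

theorem forces_clear_acc : Forces 1 (clearCfg D p w (.child true))
    (cfg .acc (ioTape D p w) blank (Tape.mk₂ [] (ptape D)) blank) :=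
  forces_cfg { q := .acc } (fun b => by rw [Tape.mk₂_head_nil]; rfl)

theorem not_acceptsIn_clear_path (m : ℕ) : ¬ AcceptsIn m (clearCfg D p w (.path true)) := by
  have hh : Halted (clearCfg D p w (.path true)) :=
    halted_cfg fun b => by rw [Tape.mk₂_head_nil]; rfl
  intro h
  exact absurd (show State.clear (.path true) = .acc from (hh.acceptsIn_iff.1 h).2) (by simp)

end Spec

/-- The rules that are selected belong to the program. -/
theorem sel_mem {D : List Rule} (w : List Bool) : ∀ (cur : List Rule) (τ : List (List Comp)),
    (∀ ρ ∈ cur, ρ ∈ D) → (∀ ρ ∈ τ, (ρ, false) ∈ D) →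
    (∀ σ, sel D w cur τ = .flagged σ → ∃ σ' l, σ = σ' ++ [l] ∧ (∀ ρ ∈ σ', (ρ, false) ∈ D) ∧
      (l, true) ∈ D ∧ σ.length ≤ τ.length + w.length) ∧
    ∀ σ c, sel D w cur τ = .opened σ c → (∀ ρ ∈ σ, (ρ, false) ∈ D) ∧
      σ.length ≤ τ.length + w.length ∧
      w.length + c.length + D.length * τ.length ≤ cur.length + D.length * σ.length := by
  induction w with
  | nil =>
    intro cur τ hcur hτ
    cases cur with
    | nil => simp [sel]
    | cons ρ cur =>
      simp only [sel, Sel.opened.injEq]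
      refine ⟨by simp, ?_⟩
      rintro σ c ⟨rfl, rfl⟩
      exact ⟨hτ, by simp, by simp⟩
  | cons b w ih =>
    intro cur τ hcur hτ
    cases cur with
    | nil => simp [sel]
    | cons ρ cur =>
      cases b with
      | false =>
        obtain ⟨h₁, h₂⟩ := ih cur τ (fun ρ hρ => hcur ρ (List.mem_cons_of_mem _ hρ)) hτ
        refine ⟨fun σ h => ?_, fun σ c h => ?_⟩
        · obtain ⟨σ', l, h₃, h₄, h₅, h₆⟩ := h₁ σ h
          exact ⟨σ', l, h₃, h₄, h₅, by rw [List.length_cons]; omega⟩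
        obtain ⟨h₃, h₄, h₅⟩ := h₂ σ c h
        simp only [List.length_cons]
        exact ⟨h₃, by omega, by omega⟩
      | true =>
        have hρ := hcur ρ List.mem_cons_self
        cases hf : ρ.2 with
        | true =>
          simp only [sel, hf, if_true, Sel.flagged.injEq]
          refine ⟨?_, by simp⟩
          rintro σ rfl
          exact ⟨τ, ρ.1, rfl, hτ, by rwa [← hf], by simp⟩
        | false =>
          simp only [sel, hf, Bool.false_eq_true, if_false]
          have hτ' : ∀ ρ' ∈ τ ++ [ρ.1], (ρ', false) ∈ D := by
            intro ρ' h
            rcases List.mem_append.1 h with h | h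
            · exact hτ ρ' h
            · obtain rfl := List.mem_singleton.1 h
              rwa [← hf]
          obtain ⟨h₁, h₂⟩ := ih D (τ ++ [ρ.1]) (fun _ h => h) hτ'
          refine ⟨fun σ h => ?_, fun σ c h => ?_⟩
          · obtain ⟨σ', l, h₃, h₄, h₅, h₆⟩ := h₁ σ h
            refine ⟨σ', l, h₃, h₄, h₅, ?_⟩
            simp only [List.length_append, List.length_cons, List.length_nil] at h₆ ⊢
            omega
          obtain ⟨h₃, h₄, h₅⟩ := h₂ σ c h
          -- For the last bound: `D.length * τ.length - cur.length` grows by at least one with every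
          -- bit. Here it grows by the length of the old list, since taking a rule resets `cur` to
          -- `D`.
          simp only [List.length_cons, List.length_append, List.length_nil, Nat.mul_add] at *
          exact ⟨h₃, by omega, by omega⟩

/-- Selection works online: the result `opened σ c` contains all that is needed to go on with
further bits. -/
theorem sel_append {D : List Rule} (w u : List Bool) : ∀ (cur : List Rule) (τ σ : List (List Comp))
    (c : List Rule), sel D w cur τ = .opened σ c → sel D (w ++ u) cur τ = sel D u c σ := by
  induction w with
  | nil =>
    intro cur τ σ c h
    cases cur with
    | nil => simp [sel] at h
    | cons ρ cur =>
      simp only [sel, Sel.opened.injEq] at h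
      obtain ⟨rfl, rfl⟩ := h
      rfl
  | cons b w ih =>
    intro cur τ σ c h
    cases cur with
    | nil => simp [sel] at h
    | cons ρ cur =>
      cases b with
      | false => exact ih _ _ _ _ h
      | true =>
        simp only [sel, List.cons_append] at h ⊢
        split_ifs with hf
        · rw [if_pos hf] at h; simp at h
        · rw [if_neg hf] at h
          exact ih _ _ _ _ h

end Universal

/-! ### Acceptance at the nodes of the tree of choice strings -/

namespace Universal

open Turing NTM

section

variable {D : List Rule} {N : ℕ}

/-- The computation is forced, and on a consistent trace it ends in `.clear (.path true)`, where the
machine halts without accepting. -/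
theorem not_consistent_of_accepts_flagged (hN : ∀ ρ ∈ D, ρ.1.length = N) {p : ℕ} {w : List Bool}
    {σ : List (List Comp)} (hs : sel D w D [] = .flagged σ) (h : U.Accepts (base D p ++ w)) :
    ¬ Track.Consistent (view (.path true)) (ioTape D p w) N σ := by
  intro hc
  obtain ⟨m, h⟩ := accepts_iff_acceptsIn.1 h
  obtain ⟨σ', l, hσ, h₁, h₂, -⟩ := (sel_mem w D [] (fun _ h => h) (by simp)).1 σ hs
  have hlen : ∀ l' ∈ σ, l'.length = N := by
    intro l' hl'
    rw [hσ] at hl'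
    rcases List.mem_append.1 hl' with hl' | hl'
    · exact hN _ (h₁ l' hl')
    · obtain rfl := List.mem_singleton.1 hl'
      exact hN _ h₂
  obtain ⟨m', -, h'⟩ := ((forces_checkCfg (.inl ⟨rfl, hs⟩)).trans
    ((forces_check (.path true) (Tape.mk₂ [] (ptape D)) hlen (ioTape D p w)).1 hc)).acceptsIn_of h
  exact not_acceptsIn_clear_path p w m' h'

/-- Everything before the first guess is forced. An accepting path then contains a successful guess
for the letter `false`, followed by one for `true`. -/
theorem children_of_accepts_opened (hN : ∀ ρ ∈ D, ρ.1.length = N) {p : ℕ} {w : List Bool}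
    {σ : List (List Comp)} {c : List Rule} (hs : sel D w D [] = .opened σ c)
    (h : U.Accepts (base D p ++ w))
    (hc : Track.Consistent (view (.path false)) (ioTape D p w) N σ) (e : Bool) :
    ∃ n, Track.AcceptsBy (view (.child e)) (ioTape D p w) N D n := by
  obtain ⟨m, h⟩ := accepts_iff_acceptsIn.1 h
  have hlen : ∀ l' ∈ σ, l'.length = N := fun l' hl' =>
    hN _ (((sel_mem w D [] (fun _ h => h) (by simp)).2 σ c hs).1 l' hl')
  obtain ⟨m', -, h'⟩ := (((forces_checkCfg (.inr ⟨rfl, c, hs⟩)).trans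
    ((forces_check (.path false) (Tape.mk₂ [] (ptape D)) hlen (ioTape D p w)).1 hc)).trans
    (forces_clear_path p w)).acceptsIn_of h
  obtain ⟨h₁, m₂, h₂⟩ := acceptsBy_of_acceptsIn p w hN h'
  obtain ⟨m₃, -, h₃⟩ := (forces_clear_child p w).acceptsIn_of h₂
  obtain ⟨h₄, -⟩ := acceptsBy_of_acceptsIn p w hN h₃
  cases e
  · exact h₁
  · exact h₄

theorem passTime_le (N m : ℕ) :
    passTime N m + (N + 1) * m ≤ (N + 2) * (2 * N + 5) * (m + 1) := by
  rw [passTime]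
  nlinarith [Nat.zero_le (N * m), Nat.zero_le (N * N)]

/-- The time that the universal machine needs for the program `D`, per input letter and rule. -/
def slowdown (D : List Rule) (N : ℕ) : ℕ :=
  3 * (4 * (ptape D).length + 8) + 3 * ((N + 2) * (2 * N + 5)) + 5

theorem acceptsWithin_of_dead {p : ℕ} {w : List Bool} (m : ℕ) (hs : sel D w D [] = .dead) :
    AcceptsWithin (slowdown D N * ((base D p ++ w).length + m + 2)) (U.init (base D p ++ w)) := by
  obtain ⟨d, h₁, h₂⟩ := forces_dead (p := p) hs
  refine (h₁.acceptsWithin ⟨0, le_rfl, acceptsIn_acc h₂⟩).mono ?_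
  rw [selectTime, slowdown, List.length_append]
  set n := (base D p).length + w.length
  set P := (ptape D).length
  set C := (N + 2) * (2 * N + 5)
  nlinarith [Nat.zero_le (C * (n + m + 2)), Nat.zero_le (P * m), Nat.zero_le (P * n)]

theorem acceptsWithin_of_not_consistent (hN : ∀ ρ ∈ D, ρ.1.length = N) {p : ℕ} {w : List Bool}
    {σ : List (List Comp)} {f : Bool} (m : ℕ)
    (hs : (f = true ∧ sel D w D [] = .flagged σ) ∨ (f = false ∧ ∃ c, sel D w D [] = .opened σ c))
    (hc : ¬ Track.Consistent (view (.path f)) (ioTape D p w) N σ) :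
    AcceptsWithin (slowdown D N * ((base D p ++ w).length + m + 2)) (U.init (base D p ++ w)) := by
  have hσ : (∀ l' ∈ σ, l'.length = N) ∧ σ.length ≤ w.length := by
    rcases hs with ⟨-, hs⟩ | ⟨-, c, hs⟩
    · obtain ⟨σ', l, hσ, h₁, h₂, h₃⟩ := (sel_mem w D [] (fun _ h => h) (by simp)).1 σ hs
      refine ⟨fun l' hl' => ?_, by simpa using h₃⟩
      rw [hσ] at hl'
      rcases List.mem_append.1 hl' with hl' | hl'
      · exact hN _ (h₁ l' hl')
      · obtain rfl := List.mem_singleton.1 hl'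
        exact hN _ h₂
    · obtain ⟨h₁, h₂, -⟩ := (sel_mem w D [] (fun _ h => h) (by simp)).2 σ c hs
      exact ⟨fun l' hl' => hN _ (h₁ l' hl'), by simpa using h₂⟩
  obtain ⟨d, h₁, h₂, h₃⟩ :=
    (forces_check (.path f) (Tape.mk₂ [] (ptape D)) hσ.1 (ioTape D p w)).2 hc
  have h₄ := ((forces_checkCfg hs).trans h₁).acceptsWithin
    ⟨0, le_rfl, acceptsIn_acc (h₃.2 ⟨f, rfl⟩)⟩
  refine h₄.mono ?_
  have h₅ := passTime_le N σ.length
  have h₆ : σ.length ≤ (base D p).length + w.length := by omega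
  rw [selectTime, slowdown, List.length_append]
  set n := (base D p).length + w.length
  set P := (ptape D).length
  set C := (N + 2) * (2 * N + 5)
  have h₇ : C * (σ.length + 1) ≤ C * (n + 1) := by gcongr
  nlinarith [Nat.zero_le (C * (n + m + 2)), Nat.zero_le (P * m), Nat.zero_le (P * n),
    Nat.zero_le (C * m), Nat.zero_le (C * n)]

/-- The longest case: the trace of the choice string is checked, then two traces of at most `m + 1`
rules are guessed and checked. These three rounds explain the factors `3` in `slowdown`. -/
theorem acceptsWithin_of_children (hN : ∀ ρ ∈ D, ρ.1.length = N) {p : ℕ} {w : List Bool}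
    {σ : List (List Comp)} {c : List Rule} (m : ℕ) (hs : sel D w D [] = .opened σ c)
    (hch : ∀ e, ∃ n ≤ m, Track.AcceptsBy (view (.child e)) (ioTape D p w) N D n) :
    AcceptsWithin (slowdown D N * ((base D p ++ w).length + m + 2)) (U.init (base D p ++ w)) := by
  by_cases hc : Track.Consistent (view (.path false)) (ioTape D p w) N σ
  swap
  · exact acceptsWithin_of_not_consistent hN m (.inr ⟨rfl, c, hs⟩) hc
  obtain ⟨h₁, h₂, -⟩ := (sel_mem w D [] (fun _ h => h) (by simp)).2 σ c hs
  obtain ⟨n₀, hn₀, ha₀⟩ := hch false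
  obtain ⟨n₁, hn₁, ha₁⟩ := hch true
  have h₃ := (forces_clear_acc (D := D) p w).acceptsWithin ⟨0, le_rfl, acceptsIn_acc rfl⟩
  have h₄ := acceptsWithin_of_acceptsBy p w hN ha₁ h₃
  have h₅ := acceptsWithin_of_acceptsBy p w hN ha₀ ((forces_clear_child p w).acceptsWithin h₄)
  have h₆ := (((forces_checkCfg (p := p) (.inr ⟨rfl, c, hs⟩)).trans
    ((forces_check (.path false) (Tape.mk₂ [] (ptape D)) (fun l' hl' => hN _ (h₁ l' hl'))
      (ioTape D p w)).1 hc)).trans (forces_clear_path p w)).acceptsWithin h₅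
  refine h₆.mono ?_
  have e₁ := passTime_le N σ.length
  have e₂ := passTime_le N (n₀ + 1)
  have e₃ := passTime_le N (n₁ + 1)
  have e₄ : σ.length ≤ (base D p).length + w.length := by
    simp only [List.length_nil] at h₂; omega
  rw [selectTime, slowdown, List.length_append]
  set n := (base D p).length + w.length
  set P := (ptape D).length
  set C := (N + 2) * (2 * N + 5)
  have e₅ : C * (σ.length + 1) ≤ C * (n + 1) := by gcongr
  have e₆ : C * (n₀ + 1 + 1) ≤ C * (m + 1 + 1) := by gcongr
  have e₇ : C * (n₁ + 1 + 1) ≤ C * (m + 1 + 1) := by gcongr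
  have e₈ : (n₀ + 1) * (4 * P + 2) ≤ (m + 1) * (4 * P + 2) := by gcongr
  have e₉ : (n₁ + 1) * (4 * P + 2) ≤ (m + 1) * (4 * P + 2) := by gcongr
  have e₁₀ : (4 * P + 8) * (n + 2) + (C * (n + 1)) + 1 +
      2 * (C * (m + 1 + 1) + (m + 1) * (4 * P + 2) + 1) + 10 ≤
      (3 * (4 * P + 8) + 3 * C + 5) * (n + m + 2) + 10 := by
    nlinarith [Nat.zero_le (C * (n + m + 2)), Nat.zero_le (P * m), Nat.zero_le (P * n),
      Nat.zero_le (C * m), Nat.zero_le (C * n)]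
  omega

end

end Universal

/-! ### Running a machine with a clock -/

namespace NTM

open Turing

theorem step_iff_of_actions_eq {M : NTM} {c d : M.Cfg} {a} (h : actions c = {a}) :
    Step c d ↔ d = ⟨a.1, fun k => act (a.2 k) (c.tape k)⟩ := by
  rw [Step, h]
  simp

namespace Clocked

variable (M C : NTM)

/-- The states of the clocked machine: two states for the preparation of the input of the clock,
and pairs of states. -/
abbrev State : Type := Bool ⊕ (M.Q × C.Q)

abbrev Sym : Type := Option (Bool ⊕ (M.A ⊕ C.A))

/-- The symbols of the machine. -/
def embL : PointedMap M.Sym (Sym M C) := ⟨Option.map (Sum.map id Sum.inl), rfl⟩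

/-- The symbols of the clock. -/
def embR : PointedMap C.Sym (Sym M C) := ⟨Option.map (Sum.map id Sum.inr), rfl⟩

def projL : Sym M C → M.Sym
  | some (.inl b) => some (.inl b)
  | some (.inr (.inl a)) => some (.inr a)
  | _ => none

def projR : Sym M C → C.Sym
  | some (.inl b) => some (.inl b)
  | some (.inr (.inr a)) => some (.inr a)
  | _ => none

theorem projL_embL (a : M.Sym) : projL M C (embL M C a) = a := by
  rcases a with _ | _ | _ <;> rfl

theorem projR_embR (a : C.Sym) : projR M C (embR M C a) = a := by
  rcases a with _ | _ | _ <;> rfl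

open Classical in
/-- An action on the two input tapes only. -/
noncomputable def ioAct (s : M.K ⊕ C.K → Sym M C) (a b : Sym M C × Option Dir) :
    M.K ⊕ C.K → Sym M C × Option Dir :=
  Sum.elim (fun k => if k = M.io then a else (s (.inl k), none))
    (fun k => if k = C.io then b else (s (.inr k), none))

/-- First copy the length of the input to the input tape of the clock, then run the machine until
the clock halts. -/
noncomputable def machine : NTM where
  K := M.K ⊕ C.K
  Q := State M C
  A := M.A ⊕ C.A
  finite_K := inferInstance
  finite_Q := inferInstance
  finite_A := inferInstance
  io := .inl M.io
  start := .inl false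
  accept := {q | ∃ q₁ q₂, q = .inr (q₁, q₂) ∧ q₁ ∈ M.accept}
  trans q s := match q, s (.inl M.io) with
    | .inl false, some b =>
      {(.inl false, ioAct M C s (some b, some .right) (some (.inl true), some .right))}
    | .inl false, none =>
      {(.inl true, ioAct M C s (none, some .left) (s (.inr C.io), some .left))}
    | .inl true, some b =>
      {(.inl true, ioAct M C s (some b, some .left) (s (.inr C.io), some .left))}
    | .inl true, none =>
      {(.inr (M.start, C.start),
        ioAct M C s (none, some .right) (s (.inr C.io), some .right))}
    | .inr (q₁, q₂), _ =>
      {x | ∃ a ∈ M.trans q₁ fun k => projL M C (s (.inl k)),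
        ∃ b ∈ C.trans q₂ fun k => projR M C (s (.inr k)),
        x = (.inr (a.1, b.1), Sum.elim (fun k => (embL M C (a.2 k).1, (a.2 k).2))
          fun k => (embR M C (b.2 k).1, (b.2 k).2))}

variable {M C}

/-- Both machines run. -/
def pair (c : M.Cfg) (d : C.Cfg) : (machine M C).Cfg :=
  ⟨(.inr (c.state, d.state) : State M C), Sum.elim (fun k => (c.tape k).map (embL M C))
    fun k => (d.tape k).map (embR M C)⟩

/-- The tapes of each component carry embedded symbols only, on which the projections invert the
embeddings. A step of the product is thus a pair of steps, and the product stops as soon as one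
component does. -/
theorem step_pair_iff {c : M.Cfg} {d : C.Cfg} {e : (machine M C).Cfg} :
    Step (pair c d) e ↔ ∃ c' d', Step c c' ∧ Step d d' ∧ e = pair c' d' := by
  have hL : (fun k => projL M C (((pair c d).tape (.inl k)).head)) =
      fun k => (c.tape k).head := by
    funext k
    exact (congrArg (projL M C) (Tape.map_fst _ _)).trans (projL_embL M C _)
  have hR : (fun k => projR M C (((pair c d).tape (.inr k)).head)) =
      fun k => (d.tape k).head := by
    funext k
    exact (congrArg (projR M C) (Tape.map_fst _ _)).trans (projR_embR M C _)
  have key : ∀ (a : M.Q × (M.K → M.Sym × Option Dir)) (b : C.Q × (C.K → C.Sym × Option Dir)),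
      (⟨(.inr (a.1, b.1) : State M C), fun k => act (M := machine M C)
        (Sum.elim (fun k => (embL M C (a.2 k).1, (a.2 k).2))
          (fun k => (embR M C (b.2 k).1, (b.2 k).2)) k) ((pair c d).tape k)⟩ :
        (machine M C).Cfg) = pair ⟨a.1, fun k => act (a.2 k) (c.tape k)⟩
          ⟨b.1, fun k => act (b.2 k) (d.tape k)⟩ := by
    intro a b
    unfold pair
    congr 1
    funext k
    cases k with
    | inl k =>
      refine (act_eq _ _ _).trans ?_
      refine Eq.trans ?_ (congrArg (Tape.map (embL M C)) (act_eq _ _ _)).symm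
      rw [Tape.map_move?, Tape.map_write]
      rfl
    | inr k =>
      refine (act_eq _ _ _).trans ?_
      refine Eq.trans ?_ (congrArg (Tape.map (embR M C)) (act_eq _ _ _)).symm
      rw [Tape.map_move?, Tape.map_write]
      rfl
  constructor
  · rintro ⟨x, ⟨a, ha, b, hb, rfl⟩, rfl⟩
    rw [hL] at ha
    rw [hR] at hb
    exact ⟨_, _, ⟨a, ha, rfl⟩, ⟨b, hb, rfl⟩, key a b⟩
  · rintro ⟨_, _, ⟨a, ha, rfl⟩, ⟨b, hb, rfl⟩, rfl⟩
    refine ⟨_, ⟨a, ?_, b, ?_, rfl⟩, (key a b).symm⟩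
    · rw [hL]; exact ha
    · rw [hR]; exact hb

theorem steps_pair_iff {m : ℕ} {c : M.Cfg} {d : C.Cfg} {e : (machine M C).Cfg} :
    Steps m (pair c d) e ↔ ∃ c' d', Steps m c c' ∧ Steps m d d' ∧ e = pair c' d' := by
  induction m generalizing c d with
  | zero =>
    constructor
    · intro h
      exact ⟨c, d, .refl c, .refl d, h.zero_eq.symm⟩
    · rintro ⟨c', d', h₁, h₂, rfl⟩
      rw [h₁.zero_eq, h₂.zero_eq]
      exact .refl _
  | succ m ih =>
    constructor
    · intro h
      obtain ⟨f, h₁, h₂⟩ := h.exists_head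
      obtain ⟨c₁, d₁, hc, hd, rfl⟩ := step_pair_iff.1 h₁
      obtain ⟨c₂, d₂, hc', hd', rfl⟩ := ih.1 h₂
      exact ⟨c₂, d₂, .head hc hc', .head hd hd', rfl⟩
    · rintro ⟨c', d', h₁, h₂, rfl⟩
      obtain ⟨c₁, hc, hc'⟩ := h₁.exists_head
      obtain ⟨d₁, hd, hd'⟩ := h₂.exists_head
      exact .head (step_pair_iff.2 ⟨c₁, d₁, hc, hd, rfl⟩) (ih.2 ⟨c', d', hc', hd', rfl⟩)

variable (M C)

open Classical in
/-- A configuration in which all tapes but the input tapes are blank. -/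
noncomputable def pre (q : State M C) (I J : Tape (Sym M C)) : (machine M C).Cfg :=
  ⟨q, Sum.elim (fun k => if k = M.io then I else Tape.mk₁ [])
    fun k => if k = C.io then J else Tape.mk₁ []⟩

variable {M C}

theorem forces_pre {q q' : State M C} {I J I' J' : Tape (Sym M C)} {a b : Sym M C}
    {d d' : Option Dir}
    (h : (machine M C).trans q (fun k => ((pre M C q I J).tape k).head) =
      {((q' : State M C), ioAct M C (fun k => ((pre M C q I J).tape k).head) (a, d) (b, d'))})
    (hI : (I.write a).move? d = I') (hJ : (J.write b).move? d' = J') :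
    Forces 1 (pre M C q I J) (pre M C q' I' J') := by
  subst hI hJ
  refine Forces.single fun e => ?_
  have h' : actions (pre M C q I J) =
      {((q' : State M C), ioAct M C (fun k => ((pre M C q I J).tape k).head) (a, d) (b, d'))} := h
  rw [step_iff_of_actions_eq h']
  have : (⟨(q' : State M C), fun k => act (M := machine M C) (ioAct M C
      (fun k => ((pre M C q I J).tape k).head) (a, d) (b, d') k) ((pre M C q I J).tape k)⟩ :
      (machine M C).Cfg) = pre M C q' ((I.write a).move? d) ((J.write b).move? d') := by
    unfold pre
    congr 1
    funext k
    cases k with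
    | inl k =>
      by_cases hk : k = M.io
      · simp only [ioAct, Sum.elim_inl, hk, if_true]
        exact act_eq _ _ _
      · simp only [ioAct, Sum.elim_inl, hk, if_false]
        refine (act_eq _ _ _).trans ?_
        rfl
    | inr k =>
      by_cases hk : k = C.io
      · simp only [ioAct, Sum.elim_inr, hk, if_true]
        exact act_eq _ _ _
      · simp only [ioAct, Sum.elim_inr, hk, if_false]
        refine (act_eq _ _ _).trans ?_
        rfl
  rw [this]

theorem pre_head_inl (q : State M C) (I J : Tape (Sym M C)) :
    ((pre M C q I J).tape (.inl M.io)).head = I.head := by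
  simp [pre]

theorem pre_head_inr (q : State M C) (I J : Tape (Sym M C)) :
    ((pre M C q I J).tape (.inr C.io)).head = J.head := by
  simp [pre]

/-- An input letter on the tapes of the clocked machine. -/
def ltr (b : Bool) : Sym M C := some (.inl b)

theorem forces_copy (x : List Bool) : ∀ (X Z : List (Sym M C)),
    Forces (x.length + 1) (pre M C (.inl false) (Tape.mk₂ X (x.map ltr)) (Tape.mk₂ Z []))
      (pre M C (.inl true) ((Tape.mk₂ ((x.map ltr).reverse ++ X) []).move .left)
        ((Tape.mk₂ (List.replicate x.length (ltr true) ++ Z) []).move .left)) := by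
  induction x with
  | nil =>
    intro X Z
    refine forces_pre (a := none) (b := none) (d := some .left) (d' := some .left) ?_ rfl rfl
    simp only [machine, pre_head_inl, pre_head_inr]
    rfl
  | cons b x ih =>
    intro X Z
    have h : Forces 1 (pre M C (.inl false) (Tape.mk₂ X ((b :: x).map ltr)) (Tape.mk₂ Z []))
        (pre M C (.inl false) (Tape.mk₂ (ltr b :: X) (x.map ltr)) (Tape.mk₂ (ltr true :: Z) [])) := by
      refine forces_pre (a := ltr b) (b := ltr true) (d := some .right) (d' := some .right) ?_
        (by simp) (by simp)
      simp only [machine, pre_head_inl, pre_head_inr]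
      rfl
    have := h.trans (ih (ltr b :: X) (ltr true :: Z))
    rw [show ((b :: x).map (ltr : Bool → Sym M C)).reverse ++ X =
      (x.map ltr).reverse ++ (ltr b :: X) by simp,
      show List.replicate (b :: x).length (ltr true) ++ Z =
        List.replicate x.length (ltr true) ++ (ltr true :: Z) by
          rw [List.length_cons, List.replicate_succ', List.append_assoc]; rfl]
    exact this.mono (by rw [List.length_cons]; omega)

theorem forces_back (x : List Bool) : ∀ (Y W : List (Sym M C)),
    Forces (x.length + 1)
      (pre M C (.inl true) ((Tape.mk₂ (x.map ltr) Y).move .left)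
        ((Tape.mk₂ (List.replicate x.length (ltr true)) W).move .left))
      (pre M C (.inr (M.start, C.start)) (Tape.mk₂ [] ((x.map ltr).reverse ++ Y))
        (Tape.mk₂ [] (List.replicate x.length (ltr true) ++ W))) := by
  induction x with
  | nil =>
    have hW : ∀ W : List (Sym M C), ((((Tape.mk₂ [] W).move .left).write none).move? (some .right)) =
        Tape.mk₂ [] W := fun W =>
      (congrArg (Tape.move .right) (Tape.write_self ((Tape.mk₂ [] W).move .left))).trans
        (Tape.move_left_right _)
    intro Y W
    refine forces_pre (a := none) (b := none) (d := some .right) (d' := some .right) ?_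
      (hW Y) (hW W)
    simp only [machine, pre_head_inl, pre_head_inr]
    rfl
  | cons b x ih =>
    intro Y W
    have h : Forces 1
        (pre M C (.inl true) ((Tape.mk₂ ((b :: x).map ltr) Y).move .left)
          ((Tape.mk₂ (List.replicate (b :: x).length (ltr true)) W).move .left))
        (pre M C (.inl true) ((Tape.mk₂ (x.map ltr) (ltr b :: Y)).move .left)
          ((Tape.mk₂ (List.replicate x.length (ltr true)) (ltr true :: W)).move .left)) := by
      refine forces_pre (a := ltr b) (b := ltr true) (d := some .left) (d' := some .left) ?_
        (by simp) (by simp [List.replicate_succ])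
      simp only [machine, pre_head_inl, pre_head_inr, List.map_cons, List.length_cons,
        List.replicate_succ, Tape.mk₂_move_left, Tape.mk₂_head_cons]
      rfl
    have := h.trans (ih (ltr b :: Y) (ltr true :: W))
    rw [show ((b :: x).map (ltr : Bool → Sym M C)).reverse ++ Y =
      (x.map ltr).reverse ++ (ltr b :: Y) by simp,
      show List.replicate (b :: x).length (ltr true) ++ W =
        List.replicate x.length (ltr true) ++ (ltr true :: W) by
          rw [List.length_cons, List.replicate_succ', List.append_assoc]; rfl]
    exact this.mono (by rw [List.length_cons]; omega)

theorem forces_prepare (x : List Bool) :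
    Forces (2 * x.length + 2) ((machine M C).init x)
      (pair (M.init x) (C.init (List.replicate x.length true))) := by
  have h₁ := forces_copy (M := M) (C := C) x [] []
  have h₂ := forces_back (M := M) (C := C) x.reverse [] []
  have e₁ : pre M C (.inl false) (Tape.mk₂ [] (x.map ltr)) (Tape.mk₂ [] []) =
      (machine M C).init x := by
    unfold pre NTM.init
    congr 1
    funext k
    cases k with
    | inl k =>
      by_cases hk : k = M.io
      · simp [hk, machine, wordTape, Tape.mk₁]; rfl
      · simp [hk, machine, wordTape]
    | inr k =>
      by_cases hk : k = C.io
      · simp [hk, machine, wordTape, Tape.mk₁]; rfl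
      · simp [hk, machine, wordTape]
  have e₂ : pre M C (.inr (M.start, C.start)) (Tape.mk₂ [] (x.map ltr))
      (Tape.mk₂ [] (List.replicate x.length (ltr true))) =
      pair (M.init x) (C.init (List.replicate x.length true)) := by
    unfold pre pair NTM.init
    congr 1
    funext k
    cases k with
    | inl k =>
      by_cases hk : k = M.io
      · simp only [Sum.elim_inl, hk, if_true, wordTape]
        refine Eq.trans ?_ (Tape.map_mk₁ (embL M C) _).symm
        rw [List.map_map]
        rfl
      · simp only [Sum.elim_inl, hk, if_false, wordTape]
        exact (Tape.map_mk₁ (embL M C) []).symm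
    | inr k =>
      by_cases hk : k = C.io
      · simp only [Sum.elim_inr, hk, if_true, wordTape]
        refine Eq.trans ?_ (Tape.map_mk₁ (embR M C) _).symm
        rw [List.map_map, List.map_replicate]
        rfl
      · simp only [Sum.elim_inr, hk, if_false, wordTape]
        exact (Tape.map_mk₁ (embR M C) []).symm
  rw [e₁] at h₁
  simp only [List.append_nil, List.length_reverse, List.map_reverse, List.reverse_reverse] at h₁ h₂
  rw [e₂] at h₂
  exact (h₁.trans h₂).mono (by omega)

theorem runsInTime {T : ℕ → ℕ}
    (hT : ∀ n m c, Steps m (C.init (List.replicate n true)) c → m ≤ T n) :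
    (machine M C).RunsInTime fun n => 2 * n + 2 + T n := by
  intro x m c h
  show m ≤ 2 * x.length + 2 + T x.length
  rcases (forces_prepare x).steps_cases h with ⟨h', -⟩ | ⟨l, hl, m', rfl, h'⟩
  · omega
  · obtain ⟨-, d, -, hd, -⟩ := steps_pair_iff.1 h'
    have := hT _ _ _ hd
    omega

/-- The product may halt just because the clock does. As accepting states of `M` have no
transitions, a path that ends in one is nevertheless a halting path of `M`. -/
theorem accepts_of_accepts (hM : ∀ q ∈ M.accept, ∀ s, M.trans q s = ∅) {x : List Bool}
    (h : (machine M C).Accepts x) : M.Accepts x := by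
  obtain ⟨m, c, hc, hh, ha⟩ := h
  rcases (forces_prepare x).steps_cases hc with ⟨-, h'⟩ | ⟨l, hl, m', rfl, h'⟩
  · exact absurd hh h'
  · obtain ⟨c', d, hc', -, rfl⟩ := steps_pair_iff.1 h'
    obtain ⟨q₁, q₂, hq, ha⟩ := ha
    have : c'.state = q₁ := congrArg Prod.fst (Sum.inr.inj hq)
    rw [← this] at ha
    exact ⟨m', c', hc', hM _ ha _, ha⟩

/-- A single long path of the clock suffices: it is cut to the length of the accepting path of `M`.
-/
theorem accepts_of_acceptsWithin {x : List Bool} {b m : ℕ} (h : AcceptsWithin b (M.init x))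
    {d : C.Cfg} (hd : Steps m (C.init (List.replicate x.length true)) d) (hb : b ≤ m) :
    (machine M C).Accepts x := by
  obtain ⟨l, hl, c, hc, hh, ha⟩ := h
  obtain ⟨d', hd'⟩ := hd.exists_steps_of_le l (by omega)
  obtain ⟨k, -, hk⟩ := (forces_prepare (M := M) (C := C) x).exists_steps
  refine ⟨k + l, pair c d', hk.trans (steps_pair_iff.2 ⟨c, d', hc, hd', rfl⟩), ?_,
    ⟨_, _, rfl, ha⟩⟩
  by_contra hn
  obtain ⟨a, ha'⟩ := Set.nonempty_iff_ne_empty.2 hn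
  obtain ⟨c', -, hcc, -⟩ := step_pair_iff.1 ⟨a, ha', rfl⟩
  exact not_halted_of_step hcc hh

end Clocked

end NTM

/-! ### Diagonalization -/

namespace Track

open Turing

/-- Components look at the input tape only through the view. -/
theorem run_isSome_iff_map {S : Type*} [Inhabited S] (v : PointedMap S (Option Bool))
    (l : List Comp) (I : Tape S) (V : Tape Bool) :
    (run v l (I, V)).isSome ↔ (run id l (I.map v, V)).isSome := by
  induction l generalizing I V with
  | nil => simp [run]
  | cons c l ih =>
    simp only [run, step, Tape.map_fst, id]
    split_ifs with h
    · rw [Option.bind_some, Option.bind_some, ih, Tape.map_move?]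
    · simp

theorem consistent_iff_map {S : Type*} [Inhabited S] (v : PointedMap S (Option Bool))
    (I : Tape S) (N : ℕ) (τ : List (List Comp)) :
    Consistent v I N τ ↔ Consistent id (I.map v) N τ :=
  forall₂_congr fun _ _ => run_isSome_iff_map v _ _ _

end Track

namespace Universal

open Turing NTM

/-- In mode `path` consistency depends neither on `w` nor on `f`, so one hypothesis serves all nodes
that share a trace. -/
theorem consistent_path_iff {D : List Rule} {p : ℕ} (w : List Bool) (f : Bool) {N : ℕ}
    {τ : List (List Comp)} : Track.Consistent (view (.path f)) (ioTape D p w) N τ ↔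
      Track.Consistent id (Tape.mk₁ ((base D p).map some)) N τ := by
  rw [← ioTape_map_path D p w f]
  exact Track.consistent_iff_map ⟨view (.path f), view_default _⟩ _ _ _

section

variable {M : NTM} {T : ℕ → ℕ} {L : Language Bool} {p : ℕ}

/-- The machine `M` decides `L` on the inputs that extend the code of `M` by at most
`|D| (T + 1)` letters. -/
def Agrees (M : NTM) (T : ℕ → ℕ) (L : Language Bool) (p : ℕ) : Prop :=
  ∀ w : List Bool, w.length ≤ M.program.length * (T (base M.program p).length + 1) →
    (base M.program p ++ w ∈ L ↔ M.Accepts (base M.program p ++ w))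

/-- A consistent trace is a computation path on `base`, so it has at most `T` rules, each selected
by at most `|D|` bits. The list `c` of remaining rules is nonempty, which leaves room for one more
letter: the children of the node lie in the window of `Agrees`. -/
theorem length_le_of_consistent (hT : M.RunsInTime T) {w : List Bool} {σ : List (List Comp)}
    {c : List Rule} (hs : sel M.program w M.program [] = .opened σ c)
    (hc : Track.Consistent (view (.path false)) (ioTape M.program p w) M.numTracks σ) :
    w.length + 1 ≤ M.program.length * (T (base M.program p).length + 1) := by
  obtain ⟨h₁, -, h₂⟩ := (sel_mem w M.program [] (fun _ h => h) (by simp)).2 σ c hs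
  obtain ⟨d, hd⟩ := ((M.simulates_program).2 (view (.path false)) (view_default _) _ _
    (ioTape_map_path M.program p w false)).2 σ h₁ hc
  have h₃ := hT _ _ _ hd
  have h₄ : 0 < c.length := by
    rw [List.length_pos_iff]
    rintro rfl
    have := sel_append w [] _ _ _ _ hs
    rw [List.append_nil, hs] at this
    simp [sel] at this
  have h₅ : M.program.length * σ.length ≤ M.program.length * T (base M.program p).length := by
    gcongr
  rw [mul_add, mul_one]
  simp only [List.length_nil, mul_zero] at h₂
  omega

/-- As the path is genuine, `U` can only have accepted by finding that `M` accepts the children, and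
at their length `M` agrees with `L`. -/
theorem mem_append_of_mem (hT : M.RunsInTime T) (hL : ∀ x ∈ L, U.Accepts x)
    (hA : Agrees M T L p) {w : List Bool} {σ : List (List Comp)} {c : List Rule}
    (hs : sel M.program w M.program [] = .opened σ c)
    (hc : Track.Consistent id (Tape.mk₁ ((base M.program p).map some)) M.numTracks σ)
    (hw : base M.program p ++ w ∈ L) (e : Bool) : base M.program p ++ (w ++ [e]) ∈ L := by
  have hc' := (consistent_path_iff w false).2 hc
  have hlen := length_le_of_consistent hT hs hc'
  obtain ⟨n, hn⟩ := children_of_accepts_opened M.simulates_program.1 hs (hL _ hw) hc' e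
  refine (hA _ (by simpa using hlen)).2 ?_
  obtain ⟨d, hd⟩ := (((M.simulates_program).2 (view (.child e)) (view_default _) _ _
    (ioTape_map_child M.program p w e)).1 n).2 hn
  exact ⟨n, d, hd⟩

/-- Each letter `false` discards one rule of `a`; all words on the way are open nodes with the same
genuine path, so membership is inherited. -/
theorem exists_mem_of_skip (hT : M.RunsInTime T) (hL : ∀ x ∈ L, U.Accepts x)
    (hA : Agrees M T L p) {σ : List (List Comp)} {b : List Rule} {ρ : Rule}
    (hc : Track.Consistent id (Tape.mk₁ ((base M.program p).map some)) M.numTracks σ)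
    (a : List Rule) : ∀ w : List Bool, sel M.program w M.program [] = .opened σ (a ++ ρ :: b) →
      base M.program p ++ w ∈ L → ∃ w', sel M.program w' M.program [] = .opened σ (ρ :: b) ∧
        base M.program p ++ w' ∈ L := by
  induction a with
  | nil => exact fun w hs hw => ⟨w, hs, hw⟩
  | cons x a ih =>
    intro w hs hw
    refine ih (w ++ [false]) ?_ (mem_append_of_mem hT hL hA hs hc hw false)
    rw [sel_append w [false] _ _ _ _ hs]
    cases a <;> rfl

theorem exists_mem_of_take (hT : M.RunsInTime T) (hL : ∀ x ∈ L, U.Accepts x)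
    (hA : Agrees M T L p) {σ : List (List Comp)} {ρ : Rule} (hρ : ρ ∈ M.program)
    (hc : Track.Consistent id (Tape.mk₁ ((base M.program p).map some)) M.numTracks σ)
    {w : List Bool} (hs : sel M.program w M.program [] = .opened σ M.program)
    (hw : base M.program p ++ w ∈ L) :
    ∃ w', sel M.program w' M.program [] =
      (if ρ.2 then .flagged (σ ++ [ρ.1]) else .opened (σ ++ [ρ.1]) M.program) ∧
        base M.program p ++ w' ∈ L := by
  obtain ⟨a, b, hab⟩ := List.append_of_mem hρ
  obtain ⟨w', hs', hw'⟩ := exists_mem_of_skip hT hL hA hc a w (hs.trans (by rw [← hab])) hw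
  refine ⟨w' ++ [true], ?_, mem_append_of_mem hT hL hA hs' hc hw' true⟩
  rw [sel_append w' [true] _ _ _ _ hs', sel]
  congr 1
  rw [hab]
  cases a <;> rfl

theorem exists_mem_of_trace (hT : M.RunsInTime T) (hL : ∀ x ∈ L, U.Accepts x)
    (hA : Agrees M T L p) (τ : List (List Comp)) : ∀ (σ : List (List Comp)) (w : List Bool),
    (∀ l ∈ τ, (l, false) ∈ M.program) →
    Track.Consistent id (Tape.mk₁ ((base M.program p).map some)) M.numTracks (σ ++ τ) →
    sel M.program w M.program [] = .opened σ M.program → base M.program p ++ w ∈ L →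
    ∃ w', sel M.program w' M.program [] = .opened (σ ++ τ) M.program ∧
        base M.program p ++ w' ∈ L := by
  induction τ with
  | nil => exact fun σ w _ _ hs hw => ⟨w, by simpa using hs, hw⟩
  | cons l τ ih =>
    intro σ w hτ hc hs hw
    obtain ⟨w', hs', hw'⟩ := exists_mem_of_take hT hL hA (hτ l (by simp)) hc.of_append hs hw
    obtain ⟨w₂, h₁, h₂⟩ := ih (σ ++ [l]) w' (fun l hl => hτ l (by simp [hl])) (by simpa using hc)
      (by simpa using hs') hw'
    exact ⟨w₂, by simpa using h₁, h₂⟩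

/-- Otherwise `M` accepts `base`, and membership can be followed along an accepting trace to a leaf
that `U` rejects. -/
theorem base_not_mem (hT : M.RunsInTime T) (hL : ∀ x ∈ L, U.Accepts x) (hA : Agrees M T L p) :
    base M.program p ∉ L := by
  intro h
  have h₀ := (hA [] (Nat.zero_le _)).1 (by simpa using h)
  rw [List.append_nil] at h₀
  obtain ⟨m, c, hc⟩ := h₀
  obtain ⟨τ, l, -, hτ, hl, hcons⟩ := (((M.simulates_program).2 (view (.path false))
    (view_default _) _ _ (ioTape_map_path M.program p [] false)).1 m).1 ⟨c, hc⟩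
  rw [consistent_path_iff] at hcons
  have hs : sel M.program [] M.program [] = .opened [] M.program := by
    rcases hD : M.program with _ | ⟨ρ, D⟩
    · simp [hD] at hl
    · rfl
  obtain ⟨w, h₁, h₂⟩ := exists_mem_of_trace hT hL hA τ [] [] hτ hcons.of_append hs (by simpa using h)
  obtain ⟨w', h₃, h₄⟩ := exists_mem_of_take hT hL hA hl hcons.of_append h₁ h₂
  exact not_consistent_of_accepts_flagged M.simulates_program.1 (by simpa using h₃) (hL _ h₄)
    ((consistent_path_iff w' true).2 hcons)

/-- A dead node is accepted outright. At a flagged node the trace is inconsistent, since `M` rejects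
`base`. At an open node with a genuine path, the children lie in the window and in `L`, so `M`
accepts them, by paths that its time bound makes short enough for `U` to find in time. -/
theorem mem_of_children (hT : M.RunsInTime T) {R : ℕ → ℕ}
    (hL : ∀ x b, AcceptsWithin b (U.init x) → b ≤ R x.length → x ∈ L) (hA : Agrees M T L p)
    (h : ¬ M.Accepts (base M.program p)) (w : List Bool)
    (hR : slowdown M.program M.numTracks * ((base M.program p ++ w).length +
      T ((base M.program p ++ w).length + 1) + 2) ≤ R (base M.program p ++ w).length)
    (hw : w.length + 1 ≤ M.program.length * (T (base M.program p).length + 1) →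
      ∀ e, base M.program p ++ (w ++ [e]) ∈ L) : base M.program p ++ w ∈ L := by
  have hN := M.simulates_program.1
  have hpath := fun f => ((M.simulates_program).2 (view (.path f)) (view_default _) _ _
      (ioTape_map_path M.program p w f))
  refine hL _ _ ?_ hR
  rcases hs : sel M.program w M.program [] with _ | σ | ⟨σ, c⟩
  · exact acceptsWithin_of_dead _ hs
  · refine acceptsWithin_of_not_consistent hN _ (.inl ⟨rfl, hs⟩) fun hc => h ?_
    obtain ⟨σ', l, rfl, h₁, h₂, -⟩ := (sel_mem w M.program [] (fun _ h => h) (by simp)).1 σ hs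
    obtain ⟨d, hd⟩ := ((hpath true).1 σ'.length).2 ⟨σ', l, rfl, h₁, h₂, hc⟩
    exact ⟨_, d, hd⟩
  · by_cases hc : Track.Consistent (view (.path false)) (ioTape M.program p w) M.numTracks σ
    · have hlen := length_le_of_consistent hT hs hc
      refine acceptsWithin_of_children hN _ hs fun e => ?_
      obtain ⟨m, d, hd⟩ := (hA _ (by simpa using hlen)).1 (hw hlen e)
      refine ⟨m, ?_, (((M.simulates_program).2 (view (.child e)) (view_default _) _ _
        (ioTape_map_child M.program p w e)).1 m).1 ⟨d, hd⟩⟩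
      have := hT _ _ _ hd.1
      rwa [← List.append_assoc, List.length_append, List.length_singleton] at this
    · exact acceptsWithin_of_not_consistent hN _ (.inr ⟨rfl, c, hs⟩) hc

/-- Induction from the longest words of the window up to the root. At maximal length the premise on
the children in `mem_of_children` is void. -/
theorem mem_of_not_accepts (hT : M.RunsInTime T) {R : ℕ → ℕ}
    (hL : ∀ x b, AcceptsWithin b (U.init x) → b ≤ R x.length → x ∈ L) (hA : Agrees M T L p)
    (hR : ∀ n, (base M.program p).length ≤ n →
      slowdown M.program M.numTracks * (n + T (n + 1) + 2) ≤ R n)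
    (h : ¬ M.Accepts (base M.program p)) (k : ℕ) : ∀ w : List Bool,
    w.length + k = M.program.length * (T (base M.program p).length + 1) →
      base M.program p ++ w ∈ L := by
  induction k with
  | zero => exact fun w hw => mem_of_children hT hL hA h w (hR _ (by simp)) fun _ => by omega
  | succ k ih =>
    exact fun w hw => mem_of_children hT hL hA h w (hR _ (by simp)) fun _ e =>
      ih _ (by rw [List.length_append, List.length_singleton]; omega)

/-- The clock need not be exact: it is enough that `L` lies between the words that `U` accepts
within `R` steps and the words that it accepts at all. -/
theorem not_agrees (hT : M.RunsInTime T) {R : ℕ → ℕ} (hL : ∀ x ∈ L, U.Accepts x)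
    (hL' : ∀ x b, AcceptsWithin b (U.init x) → b ≤ R x.length → x ∈ L)
    (hR : ∀ n, (base M.program p).length ≤ n →
      slowdown M.program M.numTracks * (n + T (n + 1) + 2) ≤ R n) : ¬ Agrees M T L p := by
  intro hA
  have h := base_not_mem hT hL hA
  have h' := hA [] (Nat.zero_le _)
  rw [List.append_nil] at h'
  have := mem_of_not_accepts hT hL' hA hR (fun h₀ => h (h'.2 h₀)) _ [] (Nat.zero_add _)
  rw [List.append_nil] at this
  exact h this

end

end Universal

/-! ### The separation theorem for clocks -/

open NTM Universal

/-- The `m` supplied by robustness may lie below the threshold `N`. In that case `N` itself is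
taken: the exponent was chosen larger than `B N`, so already `2 ^ (B N)` keeps `B N` within the
interval. -/
theorem Robust.exists_of_eventually_le_pow {S : Set ℕ} (hS : Robust S) {B : ℕ → ℕ} {k N₀ : ℕ}
    (hB : ∀ᶠ n in atTop, B n ≤ n ^ k) : ∃ n₀ ≥ N₀, ∀ n, n₀ ≤ n → n ≤ B n₀ → n ∈ S := by
  obtain ⟨N₁, hN₁⟩ := eventually_atTop.1 hB
  set N := max N₀ N₁
  obtain ⟨m, hm, hmS⟩ := hS.2 (max k (B N) + 1) (Nat.succ_pos _)
  rcases le_total N m with h | h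
  · refine ⟨m, (le_max_left _ _).trans h, fun n h₁ h₂ => hmS n h₁ (h₂.trans ?_)⟩
    exact (hN₁ m ((le_max_right _ _).trans h)).trans (Nat.pow_le_pow_right (by omega) (by omega))
  · refine ⟨N, le_max_left _ _, fun n h₁ h₂ => hmS n (h.trans h₁) (h₂.trans ?_)⟩
    calc B N ≤ max k (B N) + 1 := by omega
      _ ≤ 2 ^ (max k (B N) + 1) := Nat.lt_two_pow_self.le
      _ ≤ m ^ (max k (B N) + 1) := Nat.pow_le_pow_left hm _

theorem Universal.exists_length_base (D : List Rule) {n : ℕ} (hn : (base D 0).length ≤ n) :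
    ∃ p, (base D p).length = n := by
  refine ⟨n - (base D 0).length, ?_⟩
  simp only [base, List.length_append, List.length_replicate, List.length_singleton] at hn ⊢
  omega

theorem eventually_le_of_isLittleO {f g : ℕ → ℕ}
    (h : (fun n => (f n : ℝ)) =o[atTop] fun n => (g n : ℝ)) : ∀ᶠ n in atTop, f n ≤ g n := by
  filter_upwards [h.bound one_pos] with n hn
  simpa using hn

/-- The bound on all paths of the clock `C` puts the clocked language into the larger class, and one
path of length at least `R n` gives `U` the time for its simulation. -/
theorem not_NTIME_subset_ro {t₁ t₂ : ℕ → ℝ} {k : ℕ} {C : NTM} {T' R : ℕ → ℕ}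
    (hC : ∀ n m c, Steps m (C.init (List.replicate n true)) c → m ≤ T' n)
    (hC' : ∀ n, ∃ m ≥ R n, ∃ c, Steps m (C.init (List.replicate n true)) c)
    (hT' : (fun n => (T' n : ℝ)) =O[atTop] t₂) (ht₂ : (fun n : ℕ => (n : ℝ)) =O[atTop] t₂)
    (hR : (fun n => t₁ (n + 1)) =o[atTop] fun n => (R n : ℝ))
    (ht₁ : (fun n : ℕ => (n : ℝ)) =O[atTop] t₁) (ht₁' : t₁ =O[atTop] fun n : ℕ => (n : ℝ) ^ k) :
    ¬ NTIME t₂ ⊆ ro (NTIME t₁) := by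
  intro hsub
  have hone : (fun _ : ℕ => (1 : ℝ)) =O[atTop] fun n : ℕ => (n : ℝ) := by
    refine IsBigO.of_bound 1 (eventually_atTop.2 ⟨1, fun n hn => ?_⟩)
    simpa using hn
  have hmem : ({x | (Clocked.machine U C).Accepts x} : Language Bool) ∈ NTIME t₂ := by
    refine ⟨Clocked.machine U C, _, Clocked.runsInTime hC, ?_, fun x => Iff.rfl⟩
    have h := (((ht₂.const_mul_left 2).add ((hone.trans ht₂).const_mul_left 2)).add hT')
    refine h.congr_left fun n => ?_
    push_cast
    ring
  obtain ⟨S, hS, L', ⟨M, T, hT, hTO, hM⟩, hSL⟩ := hsub hmem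
  have hTO' : (fun n => (T (n + 1) : ℝ)) =O[atTop] fun n => t₁ (n + 1) :=
    hTO.comp_tendsto (tendsto_add_atTop_nat 1)
  have hid' : (fun n : ℕ => ((n + 1 : ℕ) : ℝ)) =O[atTop] fun n => t₁ (n + 1) :=
    ht₁.comp_tendsto (tendsto_add_atTop_nat 1)
  have hone' : (fun _ : ℕ => (1 : ℝ)) =O[atTop] fun n => t₁ (n + 1) :=
    (hone.trans ht₁).comp_tendsto (tendsto_add_atTop_nat 1)
  have hslow : ∀ᶠ n in atTop, slowdown M.program M.numTracks * (n + T (n + 1) + 2) ≤ R n := by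
    refine eventually_le_of_isLittleO (IsBigO.trans_isLittleO ?_ hR)
    refine (((hid'.add hTO').add hone').const_mul_left
      (slowdown M.program M.numTracks : ℝ)).congr_left fun n => ?_
    push_cast
    ring
  obtain ⟨N₀, hN₀⟩ := eventually_atTop.1 hslow
  -- The left side is the upper end of the window of `Agrees`. It is `O(n ^ (k + 1))`, the `1`
  -- covering the linear term, and one further power absorbs the constant.
  have hB : ∀ᶠ n in atTop, n + M.program.length * (T n + 1) ≤ n ^ (k + 2) := by
    refine eventually_le_of_isLittleO (IsBigO.trans_isLittleO (g := fun n : ℕ => (n : ℝ) ^ (k + 1))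
      ?_ ?_)
    · have hpow : ∀ j ≤ k + 1, (fun n : ℕ => (n : ℝ) ^ j) =O[atTop]
          fun n : ℕ => (n : ℝ) ^ (k + 1) := by
        intro j hj
        refine IsBigO.of_bound 1 (eventually_atTop.2 ⟨1, fun n hn => ?_⟩)
        rw [one_mul, Real.norm_of_nonneg (by positivity), Real.norm_of_nonneg (by positivity)]
        exact pow_le_pow_right₀ (by exact_mod_cast hn) hj
      have h₁ := hpow 1 (by omega)
      have h₂ := (hTO.trans ht₁').trans (hpow k (by omega))
      have h₃ := hpow 0 (by omega)
      refine (h₁.add ((h₂.add h₃).const_mul_left (M.program.length : ℝ))).congr_left fun n => ?_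
      push_cast
      ring
    · have := (isLittleO_pow_pow_atTop_of_lt (𝕜 := ℝ) (Nat.lt_succ_self (k + 1))).comp_tendsto
        tendsto_natCast_atTop_atTop
      refine this.congr (fun n => rfl) fun n => ?_
      simp
  obtain ⟨n₀, hn₀, hn₀S⟩ := hS.exists_of_eventually_le_pow
    (N₀ := max N₀ (base M.program 0).length) hB
  -- Padding places `base` exactly at the left end of an interval contained in `S`.
  obtain ⟨p, hp⟩ := exists_length_base M.program ((le_max_right _ _).trans hn₀)
  refine not_agrees (M := M) (p := p) (R := R) hT
    (L := {x | (Clocked.machine U C).Accepts x}) ?_ ?_ ?_ ?_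
  · intro x hx
    exact Clocked.accepts_of_accepts trans_eq_empty_of_mem_accept hx
  · intro x b hx hb
    obtain ⟨m, hm, c, hc⟩ := hC' x.length
    exact Clocked.accepts_of_acceptsWithin hx hc (hb.trans hm)
  · intro n hn
    exact hN₀ n (((le_max_left _ _).trans hn₀).trans (hp ▸ hn))
  · intro w hw
    have h := hn₀S (base M.program p ++ w).length (by simp [hp]) (by simp [hp] at hw ⊢; omega)
    have h₁ := Set.ext_iff.1 (hSL _ h) (base M.program p ++ w)
    rw [← hM]
    simpa [slice] using h₁

/-! ### Clocks for time-constructible functions -/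

namespace NTM

open Turing

/-- The tape symbols to the right of position `B` are blank. -/
def BlankFrom {Γ : Type*} [Inhabited Γ] (B : ℕ) (T : Tape Γ) : Prop :=
  ∀ i : ℤ, (B : ℤ) ≤ i → T.nth i = default

theorem nth_mk₁ {Γ : Type*} [Inhabited Γ] (l : List Γ) (i : ℕ) :
    (Tape.mk₁ l).nth i = l.getI i := by
  rw [Tape.mk₁, Tape.mk₂, Tape.mk'_nth_nat, ListBlank.nth_mk]

theorem blankFrom_wordTape {M : NTM} (x : List Bool) {B : ℕ} (h : x.length ≤ B) :
    BlankFrom B (M.wordTape x) := by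
  intro i hi
  lift i to ℕ using (Int.natCast_nonneg B).trans hi
  rw [wordTape, nth_mk₁, List.getI_eq_default]
  rw [List.length_map]
  omega

theorem BlankFrom.act {M : NTM} {B : ℕ} {T : Tape M.Sym} (h : BlankFrom B T) (hB : 1 ≤ B)
    (a : M.Sym × Option Dir) : BlankFrom (B + 1) (NTM.act a T) := by
  obtain ⟨a, d⟩ := a
  intro i hi
  have h₁ : -1 ≤ shift d := by rcases d with _ | _ | _ <;> simp [shift]
  push_cast at hi
  rw [act_eq, nth_move?, Tape.write_nth, if_neg (by omega)]
  exact h _ (by omega)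

/-- Positions are counted from the head. A step writes at position `0`, which is below `B`, and
shifts the boundary by at most one. -/
theorem Steps.blankFrom {M : NTM} {m : ℕ} {c d : M.Cfg} (h : Steps m c d) {k : M.K} {B : ℕ}
    (hB : 1 ≤ B) (hc : BlankFrom B (c.tape k)) : BlankFrom (B + m) (d.tape k) := by
  induction h generalizing B with
  | refl c => exact hc
  | head h _ ih =>
    obtain ⟨a, -, rfl⟩ := h
    exact fun i hi => ih (by omega) (hc.act hB _) i (by push_cast at hi ⊢; omega)

end NTM

open NTM

/-- By determinism every path is a prefix of the halting one. After `m` steps all positions from `n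
+ 1 + m` on are blank, so an output of `t n` letters needs at least `t n - (n + 1)` steps. -/
theorem TimeConstructible.exists_clock {t : ℕ → ℕ} (h : TimeConstructible t) :
    ∃ (C : NTM) (T : ℕ → ℕ), (fun n => (T n : ℝ)) =O[atTop] (fun n => (t n : ℝ)) ∧
      (∀ n m c, Steps m (C.init (List.replicate n true)) c → m ≤ T n) ∧
      ∀ n, ∃ m ≥ t n - (n + 1), ∃ c, Steps m (C.init (List.replicate n true)) c := by
  obtain ⟨C, T, hdet, hTO, hC⟩ := h
  refine ⟨C, T, hTO, fun n m c hc => ?_, fun n => ?_⟩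
  · obtain ⟨m', hm', d, hd, hh, -⟩ := hC n
    rcases (hdet.forces hd).steps_cases hc with ⟨h, -⟩ | ⟨l, hl, k, rfl, h⟩
    · omega
    · cases h with
      | refl => omega
      | head h _ => exact absurd hh (not_halted_of_step h)
  · obtain ⟨m, hm, d, hd, hh, ht⟩ := hC n
    refine ⟨m, ?_, d, hd⟩
    have h₁ : BlankFrom (n + 1) ((C.init (List.replicate n true)).tape C.io) := by
      simp only [NTM.init, if_true]
      exact blankFrom_wordTape _ (by simp)
    have h₂ := hd.blankFrom (by omega) h₁
    rw [ht] at h₂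
    by_contra hlt
    have h₃ := h₂ ((t n - 1 : ℕ) : ℤ) (by omega)
    rw [wordTape, nth_mk₁, List.map_replicate, List.getI_eq_getElem _ (by simp; omega)] at h₃
    simp at h₃

theorem not_NTIME_subset_ro_of_timeConstructible {t₁ t₂ : ℕ → ℕ} {c : ℝ}
    (ht₂ : TimeConstructible t₂)
    (h : (fun n => (t₁ (n + 1) : ℝ)) =o[atTop] (fun n => (t₂ n : ℝ)))
    (hc : ∀ᶠ n : ℕ in atTop, (n : ℝ) ≤ (t₁ n : ℝ) ∧ (t₁ n : ℝ) ≤ (n : ℝ) ^ c) :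
    ¬ NTIME (fun n => (t₂ n : ℝ)) ⊆ ro (NTIME (fun n => (t₁ n : ℝ))) := by
  obtain ⟨C, T, hTO, hC, hC'⟩ := ht₂.exists_clock
  have hid : (fun n : ℕ => (n : ℝ)) =O[atTop] fun n => (t₁ n : ℝ) := by
    refine IsBigO.of_bound 1 (hc.mono fun n hn => ?_)
    rw [one_mul, Real.norm_of_nonneg (by positivity), Real.norm_of_nonneg (by positivity)]
    exact hn.1
  have hid' : (fun n : ℕ => ((n + 1 : ℕ) : ℝ)) =o[atTop] fun n => (t₂ n : ℝ) :=
    (hid.comp_tendsto (tendsto_add_atTop_nat 1)).trans_isLittleO h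
  refine not_NTIME_subset_ro (k := ⌈c⌉₊) hC hC' hTO ?_ ?_ hid ?_
  · refine (IsBigO.of_bound 1 (Eventually.of_forall fun n => ?_)).trans hid'.isBigO
    rw [one_mul, Real.norm_of_nonneg (by positivity), Real.norm_of_nonneg (by positivity)]
    push_cast
    linarith
  · refine h.trans_isBigO (IsBigO.of_bound 2 ?_)
    -- For large `n` the loss `n + 1` is at most half of `t₂ n`.
    filter_upwards [hid'.bound (c := 1 / 2) (by norm_num)] with n hn
    rw [Real.norm_of_nonneg (by positivity), Real.norm_of_nonneg (by positivity)] at hn ⊢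
    have : (t₂ n : ℝ) ≤ ((t₂ n - (n + 1) : ℕ) : ℝ) + ((n + 1 : ℕ) : ℝ) := by
      exact_mod_cast (by omega)
    linarith
  · refine IsBigO.of_bound 1 ?_
    filter_upwards [hc, eventually_ge_atTop 1] with n hn hn1
    rw [one_mul, Real.norm_of_nonneg (by positivity), Real.norm_of_nonneg (by positivity)]
    refine hn.2.trans ?_
    rw [← Real.rpow_natCast]
    exact Real.rpow_le_rpow_of_exponent_le (by exact_mod_cast hn1) (Nat.le_ceil c)

/-! ### Clocks for powers with rational exponents -/

namespace Counter

/-- The value of the digits below `k` in base `m + 1`. -/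
def val (m k : ℕ) (e : ℕ → ℕ) : ℕ := ∑ j ∈ Finset.range k, e j * (m + 1) ^ j

/-- Increase digit `i`, and reset the digits below. -/
def incr (i : ℕ) (e : ℕ → ℕ) (j : ℕ) : ℕ := if j < i then 0 else if j = i then e i + 1 else e j

theorem val_lt {m k : ℕ} {e : ℕ → ℕ} (h : ∀ j < k, e j ≤ m) : val m k e < (m + 1) ^ k := by
  induction k with
  | zero => simp [val]
  | succ k ih =>
    have h₁ := ih fun j hj => h j (by omega)
    have h₂ := Nat.mul_le_mul_right ((m + 1) ^ k) (h k (by omega))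
    rw [val, Finset.sum_range_succ, pow_succ]
    rw [val] at h₁
    linarith

theorem val_eq_of_forall {m k : ℕ} {e : ℕ → ℕ} (h : ∀ j < k, e j = m) :
    val m k e + 1 = (m + 1) ^ k := by
  induction k with
  | zero => simp [val]
  | succ k ih =>
    have h₁ := ih fun j hj => h j (by omega)
    rw [val, Finset.sum_range_succ, pow_succ, h k (by omega)]
    rw [val] at h₁
    linarith

theorem val_zero (m k : ℕ) {e : ℕ → ℕ} (h : ∀ j < k, e j = 0) : val m k e = 0 :=
  Finset.sum_eq_zero fun j hj => by rw [h j (Finset.mem_range.1 hj), zero_mul]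

/-- A carry: resetting the digits below `i`, all equal to `m`, loses `(m + 1) ^ i - 1`, and digit
`i` gains `(m + 1) ^ i`. -/
theorem val_incr {m k i : ℕ} {e : ℕ → ℕ} (hi : i < k) (h : ∀ j < i, e j = m) :
    val m k (incr i e) = val m k e + 1 := by
  induction k with
  | zero => omega
  | succ k ih =>
    rw [val, val, Finset.sum_range_succ, Finset.sum_range_succ]
    rcases Nat.lt_succ_iff_lt_or_eq.1 hi with hi | rfl
    · have h₁ := ih hi
      rw [val, val] at h₁
      rw [h₁, incr, if_neg (by omega), if_neg (by omega)]
      omega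
    · have h₁ : val m i (incr i e) = 0 := val_zero m i fun j hj => if_pos hj
      have h₂ := val_eq_of_forall h
      rw [val] at h₁ h₂
      rw [h₁, incr, if_neg (lt_irrefl i), if_pos rfl, add_mul, one_mul, ← h₂]
      omega

theorem exists_lt_of_val {m k : ℕ} {e : ℕ → ℕ} (h : val m k e + 1 < (m + 1) ^ k) :
    ∃ i < k, e i ≠ m ∧ ∀ j < i, e j = m := by
  have hex : ∃ i, i < k ∧ e i ≠ m := by
    by_contra! hn
    exact absurd (val_eq_of_forall hn) h.ne
  classical
  refine ⟨Nat.find hex, (Nat.find_spec hex).1, (Nat.find_spec hex).2, fun j hj => ?_⟩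
  have := Nat.find_min hex hj
  have := (Nat.find_spec hex).1
  by_contra hne
  exact absurd ⟨by omega, hne⟩ ‹¬ (j < k ∧ e j ≠ m)›

theorem forall_of_val {m k : ℕ} {e : ℕ → ℕ} (hle : ∀ j, e j ≤ m)
    (h : val m k e + 1 = (m + 1) ^ k) : ∀ j < k, e j = m := by
  by_contra! hn
  classical
  have hex : ∃ i, i < k ∧ e i ≠ m := hn
  have hmin : ∀ j < Nat.find hex, e j = m := fun j hj => by
    by_contra hne
    exact Nat.find_min hex hj ⟨by have := (Nat.find_spec hex).1; omega, hne⟩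
  have h₁ := val_incr (Nat.find_spec hex).1 hmin
  have h₂ : val m k (incr (Nat.find hex) e) < (m + 1) ^ k := by
    refine val_lt fun j _ => ?_
    have := (Nat.find_spec hex).2
    have := hle (Nat.find hex)
    have := hle j
    rw [incr]
    split_ifs <;> omega
  omega

end Counter

/-! ### The odometer, a nondeterministic clock -/

namespace NTM

namespace Odometer

open Turing Counter

variable {α : Type}

/-- A tape with the marks `false` in cell `0` and `true` in cell `m`, and the head in cell `a`. -/
def Mark (m a : ℤ) (T : Tape (Option (Bool ⊕ α))) : Prop :=
  ∀ i : ℤ, T.nth i = if i + a = 0 then some (.inl false) else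
    if i + a = m then some (.inl true) else none

theorem Mark.move? {m a : ℤ} {T : Tape (Option (Bool ⊕ α))} (h : Mark m a T) (d : Option Dir) :
    Mark m (a + shift d) (T.move? d) := by
  intro i
  rw [nth_move?, h, show i + shift d + a = i + (a + shift d) by ring]

theorem Mark.head {m a : ℤ} {T : Tape (Option (Bool ⊕ α))} (h : Mark m a T) :
    T.head = if a = 0 then some (.inl false) else if a = m then some (.inl true) else none := by
  rw [← Tape.nth_zero, h, zero_add]

/-- The input tape has exactly `b` letters from the head on. -/
def Rest (b : ℕ) (T : Tape (Option (Bool ⊕ α))) : Prop := ∀ i : ℕ, T.nth i ≠ none ↔ i < b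

theorem Rest.head {b : ℕ} {T : Tape (Option (Bool ⊕ α))} (h : Rest b T) :
    T.head ≠ none ↔ 0 < b := by
  have := h 0
  rwa [Nat.cast_zero, Tape.nth_zero] at this

theorem Rest.move {b : ℕ} {T : Tape (Option (Bool ⊕ α))} (h : Rest (b + 1) T) :
    Rest b (T.move? (some .right)) := by
  intro i
  rw [nth_move?]
  have := h (i + 1)
  rw [Nat.cast_add, Nat.cast_one] at this
  rw [show (i : ℤ) + shift (some .right) = i + 1 from rfl, this]
  omega

variable (p q : ℕ)

/-- The states of the clock: two states for guessing a length, and the states in which the heads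
sweep over the marked segments, where the directions of the heads are stored. -/
abbrev State : Type := Bool ⊕ (Bool × (Fin p → Bool))

abbrev Sym : Type := Option (Bool ⊕ Empty)

/-- The number of tapes that take part in the first or in the second sweep. -/
def size (f : Bool) : ℕ := if f then p else q

variable {p}

/-- Head `i` moves, and the heads below change their direction. -/
def advance (f : Bool) (dir : Fin p → Bool) (s : Option (Fin p) → Sym) (i : Fin p) :
    State p × (Option (Fin p) → Sym × Option Dir) :=
  (.inr (f, fun j => if j < i then !dir j else dir j), fun k => (s k, match k with
    | none => if f then none else some .right
    | some j => if j = i then some (if dir i then .right else .left) else none))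

/-- Tape `i` is the first one on which the head is not yet at the end. -/
def First (f : Bool) (dir : Fin p → Bool) (s : Option (Fin p) → Sym) (i : Fin p) : Prop :=
  i.val < size p q f ∧ s (some i) ≠ some (.inl (dir i)) ∧
    ∀ j < i, s (some j) = some (.inl (dir j))

variable (p)

/-- The second sweep starts. -/
def turnBack (dir : Fin p → Bool) (s : Option (Fin p) → Sym) :
    State p × (Option (Fin p) → Sym × Option Dir) :=
  (.inr (true, fun j => if j.val < q then !dir j else dir j), fun k => (s k, none))

/-- The actions of the clock. -/
def acts (st : State p) (s : Option (Fin p) → Sym) :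
    Set (State p × (Option (Fin p) → Sym × Option Dir)) :=
  match st with
  | .inl false =>
    {(.inl true, fun k => k.elim (s none, none) fun _ => (some (.inl false), some .right))}
  | .inl true => {a | (s none ≠ none ∧
      a = (.inl true, fun k => k.elim (s none, some .right) fun _ => (none, some .right))) ∨
    a = (.inr (false, fun _ => false), fun k =>
      k.elim (s none, none) fun _ => (some (.inl true), none))}
  | .inr (f, dir) => {a | (∃ i, First q f dir s i ∧ (f = false → s none ≠ none) ∧
      a = advance f dir s i) ∨
    (f = false ∧ (∀ i : Fin p, i.val < q → s (some i) = some (.inl (dir i))) ∧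
      a = turnBack p q dir s)}

/-- Guess `m ≥ 1` and mark `m + 1` cells on each of `p` tapes; check that the input has enough
letters for `(m + 1) ^ q` steps; then run for `(m + 1) ^ p` steps. -/
def machine : NTM where
  K := Option (Fin p)
  Q := State p
  A := Empty
  finite_K := inferInstance
  finite_Q := inferInstance
  finite_A := inferInstance
  io := none
  start := .inl false
  accept := ∅
  trans := acts p q

variable {p}

/-- A configuration of the clock. -/
def cfg (st : State p) (t : Option (Fin p) → Tape Sym) : (machine p q).Cfg := ⟨st, t⟩

/-- The effect of an action on the tapes. -/
def apply (a : Option (Fin p) → Sym × Option Dir) (t : Option (Fin p) → Tape Sym)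
    (k : Option (Fin p)) : Tape Sym := ((t k).write (a k).1).move? (a k).2

variable {q}

theorem step_cfg_iff {st : State p} {t : Option (Fin p) → Tape Sym} {d : (machine p q).Cfg} :
    Step (cfg q st t) d ↔
      ∃ a ∈ acts p q st fun k => (t k).head, d = cfg q a.1 (apply a.2 t) := by
  refine exists_congr fun a => and_congr_right' ?_
  have : (fun k => act (M := machine p q) (a.2 k) ((cfg q st t).tape k)) = apply a.2 t :=
    funext fun k => act_eq _ _ _
  rw [this]
  rfl

theorem First.unique {f : Bool} {dir : Fin p → Bool} {s : Option (Fin p) → Sym} {i j : Fin p}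
    (hi : First q f dir s i) (hj : First q f dir s j) : i = j := by
  rcases lt_trichotomy i j with h | h | h
  · exact absurd (hj.2.2 _ h) hi.2.1
  · exact h
  · exact absurd (hi.2.2 _ h) hj.2.1

/-- The tapes during a sweep: head `i` has moved by `e i` cells in its direction. -/
structure Sweep (m : ℕ) (e : ℕ → ℕ) (b : ℕ) (dir : Fin p → Bool)
    (t : Option (Fin p) → Tape Sym) : Prop where
  le : ∀ j, e j ≤ m
  mark : ∀ i : Fin p, Mark m (if dir i then (e i : ℤ) else m - e i) (t (some i))
  rest : Rest b (t none)

section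

variable {m b : ℕ} {e : ℕ → ℕ} {f : Bool} {dir : Fin p → Bool} {t : Option (Fin p) → Tape Sym}

/-- The marks are `false` in cell `0` and `true` in cell `m`, so the mark that equals the direction
sits where the head is going. The condition `1 ≤ m` keeps the two marks apart. -/
theorem Sweep.head_eq_iff (h : Sweep m e b dir t) (hm : 1 ≤ m) (i : Fin p) :
    (t (some i)).head = some (.inl (dir i)) ↔ e i = m := by
  have h₁ := h.le i
  rw [(h.mark i).head]
  cases hd : dir i
  · simp only [Bool.false_eq_true, if_false]
    split_ifs <;> simp <;> omega
  · simp only [if_true]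
    split_ifs <;> simp <;> omega

theorem Sweep.first_iff (h : Sweep m e b dir t) (hm : 1 ≤ m) (i : Fin p) :
    First q f dir (fun k => (t k).head) i ↔
      i.val < size p q f ∧ e i ≠ m ∧ ∀ j < i, e j = m := by
  unfold First
  rw [Ne, h.head_eq_iff hm]
  exact and_congr_right' (and_congr_right' (forall₂_congr fun j _ => h.head_eq_iff hm j))

/-- A head at the end of its segment has digit `m`; with its direction reversed the same position
means digit `0`. A carry therefore resets all lower digits without moving their heads, and each
increment takes a single step. -/
theorem Sweep.step (h : Sweep m e b dir t) (hm : 1 ≤ m) {b' : ℕ}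
    (hb : b = if f then b' else b' + 1) {i : Fin p} (hi : i.val < size p q f) (hei : e i ≠ m)
    (hj : ∀ j < i.val, e j = m) :
    ∃ dir' t', Sweep m (incr i e) b' dir' t' ∧
      ∀ x, Step (cfg q (.inr (f, dir)) t) x ↔ x = cfg q (.inr (f, dir')) t' := by
  have hF := (h.first_iff (q := q) (f := f) hm i).2 ⟨hi, hei, fun j hji => hj j hji⟩
  have ha : acts p q (.inr (f, dir)) (fun k => (t k).head) =
      {advance f dir (fun k => (t k).head) i} := by
    ext a
    constructor
    · rintro (⟨i', hi', -, rfl⟩ | ⟨rfl, hall, -⟩)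
      · rw [hF.unique hi']
        rfl
      · exact absurd ((h.head_eq_iff hm i).1 (hall i hi)) hei
    · rintro rfl
      refine .inl ⟨i, hF, ?_, rfl⟩
      rintro rfl
      rw [h.rest.head]
      simp at hb
      omega
  refine ⟨fun j => if j < i then !dir j else dir j,
    apply (advance f dir (fun k => (t k).head) i).2 t, ⟨fun j => ?_, fun j => ?_, ?_⟩, fun x => ?_⟩
  rotate_left 3
  · rw [step_cfg_iff, ha]
    simp only [Set.mem_singleton_iff, exists_eq_left]
    rfl
  · have := h.le j
    have := h.le i
    rw [incr]
    split_ifs with h₁ h₂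
    · omega
    · subst h₂; omega
    · omega
  · have h₂ := (h.mark j).move? (if j = i then some (if dir i then Dir.right else .left) else none)
    have h₄ := hj j
    simp only [apply, advance, Tape.write_self]
    convert h₂ using 1
    simp only [incr, Fin.lt_def, Fin.ext_iff]
    rcases lt_trichotomy j.val i.val with hlt | heq | hgt
    · rw [if_pos hlt, if_pos hlt, if_neg hlt.ne, h₄ hlt]
      cases dir j <;> simp [shift]
    · obtain rfl : j = i := Fin.ext heq
      cases dir j <;> simp [shift]
      ring
    · rw [if_neg hgt.not_gt, if_neg hgt.not_gt, if_neg hgt.ne', if_neg hgt.ne']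
      simp [shift]
  · simp only [apply, advance, Tape.write_self]
    cases f
    · simp at hb
      subst hb
      exact h.rest.move
    · simp at hb
      subst hb
      exact h.rest

/-- The second sweep takes `(m + 1) ^ p` steps. -/
theorem Sweep.steps_true (hm : 1 ≤ m) (k : ℕ) : ∀ {e : ℕ → ℕ} {dir : Fin p → Bool}
    {t : Option (Fin p) → Tape Sym}, Sweep m e b dir t → val m p e + 1 + k = (m + 1) ^ p →
    (∀ l d, Steps l (cfg q (.inr (true, dir)) t) d → l ≤ k) ∧
      ∃ d, Steps k (cfg q (.inr (true, dir)) t) d := by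
  induction k with
  | zero =>
    intro e dir t h hv
    refine ⟨fun l d hd => ?_, _, .refl _⟩
    have hall := forall_of_val h.le hv
    cases hd with
    | refl => exact le_rfl
    | head hs _ =>
      obtain ⟨a, (⟨i, hi, -, -⟩ | ⟨hf, -⟩), -⟩ := step_cfg_iff.1 hs
      · exact absurd (hall i i.2) ((h.first_iff hm i).1 hi).2.1
      · simp at hf
  | succ k ih =>
    intro e dir t h hv
    obtain ⟨i, hi, hei, hj⟩ := exists_lt_of_val (m := m) (k := p) (e := e) (by omega)
    obtain ⟨dir', t', h', hs⟩ := h.step (q := q) (f := true) (i := ⟨i, hi⟩) hm rfl hi hei hj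
    obtain ⟨h₁, d, h₂⟩ := ih h' (by rw [val_incr hi hj]; omega)
    refine ⟨fun l x hx => ?_, d, .head ((hs _).2 rfl) h₂⟩
    cases hx with
    | refl => omega
    | head hx₁ hx₂ =>
      rw [(hs _).1 hx₁] at hx₂
      have := h₁ _ _ hx₂
      omega

/-- The first `q` heads are at the far ends and are reversed, the others have not moved; so all
digits are `0` at the start of the second sweep. -/
theorem Sweep.turn (h : Sweep m e b dir t) (hm : 1 ≤ m) (hall : ∀ j < q, e j = m)
    (he : ∀ j, q ≤ j → e j = 0) :
    ∃ dir' t', Sweep m (fun _ => 0) b dir' t' ∧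
      ∀ x, Step (cfg q (.inr (false, dir)) t) x ↔ x = cfg q (.inr (true, dir')) t' := by
  have ha : acts p q (.inr (false, dir)) (fun k => (t k).head) =
      {turnBack p q dir (fun k => (t k).head)} := by
    ext a
    constructor
    · rintro (⟨i, hi, -⟩ | ⟨-, -, rfl⟩)
      · have := (h.first_iff hm i).1 hi
        exact absurd (hall i this.1) this.2.1
      · rfl
    · rintro rfl
      exact .inr ⟨rfl, fun i hi => (h.head_eq_iff hm i).2 (hall i hi), rfl⟩
  refine ⟨fun j => if j.val < q then !dir j else dir j,
    apply (turnBack p q dir (fun k => (t k).head)).2 t,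
    ⟨fun _ => Nat.zero_le _, fun j => ?_, h.rest⟩, fun x => ?_⟩
  · have h₁ := h.mark j
    simp only [apply, turnBack, Tape.write_self]
    show Mark _ _ (t (some j))
    convert h₁ using 1
    by_cases hj : j.val < q
    · rw [hall _ hj, if_pos hj]
      cases dir j <;> simp
    · rw [he _ (not_lt.1 hj), if_neg hj]
  · rw [step_cfg_iff, ha]
    simp only [Set.mem_singleton_iff, exists_eq_left]
    rfl

/-- The first sweep takes `(m + 1) ^ q` steps if the input is long enough. -/
theorem Sweep.steps_false (hm : 1 ≤ m) (hq : q ≤ p) (k : ℕ) : ∀ {b : ℕ} {e : ℕ → ℕ}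
    {dir : Fin p → Bool} {t : Option (Fin p) → Tape Sym}, Sweep m e b dir t →
    val m q e + 1 + k = (m + 1) ^ q → (∀ j, q ≤ j → e j = 0) →
    (∀ l d, Steps l (cfg q (.inr (false, dir)) t) d →
      l ≤ b ∨ (k ≤ b ∧ l ≤ k + (m + 1) ^ p)) ∧
      (k ≤ b → ∃ d, Steps (k + (m + 1) ^ p) (cfg q (.inr (false, dir)) t) d) := by
  have hpos : 0 < (m + 1) ^ p := by positivity
  induction k with
  | zero =>
    intro b e dir t h hv he
    obtain ⟨dir', t', h', hs⟩ := h.turn hm (forall_of_val h.le hv) he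
    obtain ⟨h₁, d, h₂⟩ := h'.steps_true (q := q) hm ((m + 1) ^ p - 1)
      (by rw [val_zero _ _ fun _ _ => rfl]; omega)
    refine ⟨fun l x hx => ?_, fun _ => ⟨d, ?_⟩⟩
    · cases hx with
      | refl => omega
      | head hx₁ hx₂ =>
        rw [(hs _).1 hx₁] at hx₂
        have := h₁ _ _ hx₂
        omega
    · have := Steps.head ((hs _).2 rfl) h₂
      rwa [show (m + 1) ^ p - 1 + 1 = 0 + (m + 1) ^ p by omega] at this
  | succ k ih =>
    intro b e dir t h hv he
    obtain ⟨i, hi, hei, hj⟩ := exists_lt_of_val (m := m) (k := q) (e := e) (by omega)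
    rcases b with _ | b
    · refine ⟨fun l x hx => .inl ?_, fun h => by omega⟩
      cases hx with
      | refl => exact le_rfl
      | head hx₁ _ =>
        obtain ⟨a, (⟨i, -, hb, -⟩ | ⟨-, hall, -⟩), -⟩ := step_cfg_iff.1 hx₁
        · exact absurd (h.rest.head.1 (hb rfl)) (lt_irrefl 0)
        · exact absurd ((h.head_eq_iff hm ⟨i, by omega⟩).1 (hall ⟨i, by omega⟩ hi)) hei
    · obtain ⟨dir', t', h', hs⟩ := h.step (q := q) (f := false) (i := ⟨i, by omega⟩) hm rfl hi hei hj
      obtain ⟨h₁, h₂⟩ := ih h' (by rw [val_incr hi hj]; omega) fun j hj => by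
        rw [incr, if_neg (by simp; omega), if_neg (by simp; omega), he j hj]
      refine ⟨fun l x hx => ?_, fun hk => ?_⟩
      · cases hx with
        | refl => omega
        | head hx₁ hx₂ =>
          rw [(hs _).1 hx₁] at hx₂
          have := h₁ _ _ hx₂
          omega
      · obtain ⟨d, hd⟩ := h₂ (by omega)
        have := Steps.head ((hs _).2 rfl) hd
        exact ⟨d, by rwa [show k + (m + 1) ^ p + 1 = k + 1 + (m + 1) ^ p by omega] at this⟩

/-- The tapes when the length `j` has been reached in the guessing phase. -/
structure Guess (j b : ℕ) (t : Option (Fin p) → Tape Sym) : Prop where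
  nth : ∀ (i : Fin p) (x : ℤ), (t (some i)).nth x = if x + j = 0 then some (.inl false) else none
  rest : Rest b (t none)

theorem Guess.right {j : ℕ} (h : Guess j (b + 1) t) (hj : 1 ≤ j) : Guess (j + 1) b
    (apply (fun k => k.elim ((t none).head, some .right) fun _ => (none, some .right)) t) := by
  refine ⟨fun i x => ?_, h.rest.move⟩
  simp only [apply, Option.elim]
  rw [nth_move?, Tape.write_nth, h.nth]
  have hs : shift (some .right) = 1 := rfl
  rw [hs]
  push_cast
  split_ifs <;> first | rfl | omega

theorem Guess.sweep {j : ℕ} (h : Guess j b t) (hj : 1 ≤ j) : Sweep j (fun _ => 0) b (fun _ => false)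
    (apply (fun k => k.elim ((t none).head, none) fun _ => (some (.inl true), none)) t) := by
  refine ⟨fun _ => Nat.zero_le _, fun i x => ?_, h.rest⟩
  simp only [apply, Option.elim]
  rw [nth_move?, Tape.write_nth, h.nth]
  simp only [shift, Nat.cast_zero, Bool.false_eq_true, if_false, sub_zero, add_zero]
  split_ifs <;> first | rfl | omega

/-- If the first sweep for a guessed length `j` succeeds, it has used `(j + 1) ^ q - 1` letters, and
`x = j + 1` serves. All other paths have linear length, and `x = 1` serves. -/
theorem Guess.le_of_steps (hq : q ≤ p) : ∀ {b j l : ℕ}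
    {t : Option (Fin p) → Tape Sym} {d : (machine p q).Cfg}, Guess j b t → 1 ≤ j →
    Steps l (cfg q (.inl true) t) d → ∃ x, x ^ q ≤ b + 1 ∧ l ≤ 2 * b + 1 + x ^ p := by
  intro b
  have key : ∀ {b j l : ℕ} {t : Option (Fin p) → Tape Sym} {d e : (machine p q).Cfg},
      Guess j b t → 1 ≤ j → ∀ a, a = ((.inr (false, fun _ => false), fun k =>
        k.elim ((t none).head, none) fun _ => (some (.inl true), none)) :
        State p × (Option (Fin p) → Sym × Option Dir)) → e = cfg q a.1 (apply a.2 t) →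
      Steps l e d → ∃ x, x ^ q ≤ b + 1 ∧ l + 1 ≤ 2 * b + 1 + x ^ p := by
    rintro b j l t d _ h hj _ rfl rfl hd
    have hpos : 0 < (j + 1) ^ q := by positivity
    obtain ⟨h₁, -⟩ := (h.sweep hj).steps_false hj hq ((j + 1) ^ q - 1)
      (by rw [val_zero _ _ fun _ _ => rfl]; omega) fun _ _ => rfl
    rcases h₁ _ _ hd with h₁ | ⟨h₁, h₂⟩
    · exact ⟨1, by simp, by simp; omega⟩
    · exact ⟨j + 1, by omega, by omega⟩
  induction b with
  | zero =>
    intro j l t d h hj hd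
    cases hd with
    | refl => exact ⟨1, by simp, by rw [one_pow]; omega⟩
    | head hs hd =>
      obtain ⟨a, (⟨ha, -⟩ | ha), he⟩ := step_cfg_iff.1 hs
      · exact absurd (h.rest.head.1 ha) (lt_irrefl 0)
      · exact key h hj a ha he hd
  | succ b ih =>
    intro j l t d h hj hd
    cases hd with
    | refl => exact ⟨1, by simp, by rw [one_pow]; omega⟩
    | head hs hd =>
      obtain ⟨a, (⟨-, rfl⟩ | ha), he⟩ := step_cfg_iff.1 hs
      · subst he
        obtain ⟨x, h₁, h₂⟩ := ih (h.right hj) (by omega) hd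
        exact ⟨x, by omega, by omega⟩
      · exact key h hj a ha he hd

/-- The guess is extended `i` times before the sweeps start; this uses up `i` letters, which the
hypothesis sets aside. -/
theorem Guess.exists_steps (hq : q ≤ p) (i : ℕ) : ∀ {b j : ℕ} {t : Option (Fin p) → Tape Sym},
    Guess j b t → 1 ≤ j → (j + i + 1) ^ q + i ≤ b + 1 →
    ∃ l ≥ (j + i + 1) ^ p, ∃ d, Steps l (cfg q (.inl true) t) d := by
  induction i with
  | zero =>
    intro b j t h hj hb
    obtain ⟨-, h₁⟩ := (h.sweep hj).steps_false hj hq ((j + 1) ^ q - 1)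
      (by rw [val_zero _ _ fun _ _ => rfl]; have : 0 < (j + 1) ^ q := by positivity
          omega) fun _ _ => rfl
    obtain ⟨d, hd⟩ := h₁ (by simpa using hb)
    exact ⟨_, by simp; omega, d, .head (step_cfg_iff.2 ⟨_, .inr rfl, rfl⟩) hd⟩
  | succ i ih =>
    intro b j t h hj hb
    rcases b with _ | b
    · have : 0 < (j + (i + 1) + 1) ^ q := by positivity
      omega
    obtain ⟨l, hl, d, hd⟩ := ih (h.right hj) (by omega)
      (by rw [show j + 1 + i + 1 = j + (i + 1) + 1 by ring]; omega)
    rw [show j + 1 + i + 1 = j + (i + 1) + 1 by ring] at hl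
    exact ⟨l + 1, by omega, d,
      .head (step_cfg_iff.2 ⟨_, .inl ⟨h.rest.head.2 (by omega), rfl⟩, rfl⟩) hd⟩

theorem exists_guess (n : ℕ) : ∃ t, Guess 1 n t ∧ ∀ x,
    Step ((machine p q).init (List.replicate n true)) x ↔ x = cfg q (.inl true) t := by
  set t₀ : Option (Fin p) → Tape Sym :=
    fun k => Tape.mk₁ (((if k = none then List.replicate n true else []) : List Bool).map
      fun b => some (.inl b)) with ht₀
  have hinit : (machine p q).init (List.replicate n true) = cfg q (.inl false) t₀ := by
    unfold NTM.init cfg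
    congr 1
    funext k
    simp only [ht₀, wordTape]
    congr
  refine ⟨apply (fun k => k.elim ((t₀ none).head, none) fun _ => (some (.inl false), some .right)) t₀,
    ⟨fun i x => ?_, fun i => ?_⟩, fun x => ?_⟩
  · simp only [apply, Option.elim]
    have h : ∀ x : ℤ, (t₀ (some i)).nth x = none := by
      rintro ((_ | _) | _) <;> rfl
    rw [nth_move?, Tape.write_nth, h]
    rfl
  · simp only [apply, Option.elim, Tape.write_self]
    show (t₀ none).nth i ≠ none ↔ _
    rw [ht₀, nth_mk₁, if_pos rfl, List.map_replicate]
    by_cases hi : i < n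
    · rw [List.getI_eq_getElem _ (by simpa using hi)]
      simpa using hi
    · rw [List.getI_eq_default _ (by simpa using hi)]
      exact iff_of_false (not_not.2 rfl) hi
  · rw [hinit, step_cfg_iff]
    simp only [acts, Set.mem_singleton_iff, exists_eq_left]

theorem le_of_steps (hq : q ≤ p) {n l : ℕ} {d : (machine p q).Cfg}
    (hd : Steps l ((machine p q).init (List.replicate n true)) d) :
    ∃ x, x ^ q ≤ n + 1 ∧ l ≤ 2 * n + 2 + x ^ p := by
  obtain ⟨t, h, hs⟩ := exists_guess (p := p) (q := q) n
  cases hd with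
  | refl => exact ⟨1, by simp, by rw [one_pow]; omega⟩
  | head hs' hd =>
    rw [(hs _).1 hs'] at hd
    obtain ⟨x, h₁, h₂⟩ := h.le_of_steps hq le_rfl hd
    exact ⟨x, h₁, by omega⟩

theorem exists_steps (hq : q ≤ p) {n x : ℕ} (hx : 2 ≤ x) (hn : x ^ q + x ≤ n) :
    ∃ l ≥ x ^ p, ∃ d, Steps l ((machine p q).init (List.replicate n true)) d := by
  obtain ⟨t, h, hs⟩ := exists_guess (p := p) (q := q) n
  -- The guessed length is `x - 1`, reached from length `1` by `x - 2` extensions.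
  have hx' : 1 + (x - 2) + 1 = x := by omega
  obtain ⟨l, hl, d, hd⟩ := h.exists_steps hq (x - 2) le_rfl (by rw [hx']; omega)
  rw [hx'] at hl
  exact ⟨l + 1, by omega, d, .head ((hs _).2 rfl) hd⟩

end

end Odometer

end NTM

open NTM

/-! ### Growth of powers, and the separation for real exponents -/

theorem isBigO_rpow_natCast_succ {r : ℝ} (hr : 0 ≤ r) :
    (fun n : ℕ => ((n + 1 : ℕ) : ℝ) ^ r) =O[atTop] fun n : ℕ => (n : ℝ) ^ r := by
  refine IsBigO.of_bound (2 ^ r) (eventually_atTop.2 ⟨1, fun n hn => ?_⟩)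
  have hn' : (1 : ℝ) ≤ n := by exact_mod_cast hn
  rw [Real.norm_of_nonneg (by positivity), Real.norm_of_nonneg (by positivity),
    ← Real.mul_rpow (by norm_num) (by positivity)]
  refine Real.rpow_le_rpow (by positivity) ?_ hr
  push_cast
  linarith

theorem isBigO_rpow_natCast {r s : ℝ} (h : r ≤ s) :
    (fun n : ℕ => (n : ℝ) ^ r) =O[atTop] fun n : ℕ => (n : ℝ) ^ s := by
  refine IsBigO.of_bound 1 (eventually_atTop.2 ⟨1, fun n hn => ?_⟩)
  rw [Real.norm_of_nonneg (by positivity), Real.norm_of_nonneg (by positivity), one_mul]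
  exact Real.rpow_le_rpow_of_exponent_le (by exact_mod_cast hn) h

theorem isLittleO_rpow_natCast {r s : ℝ} (h : r < s) :
    (fun n : ℕ => (n : ℝ) ^ r) =o[atTop] fun n : ℕ => (n : ℝ) ^ s := by
  refine isLittleO_of_tendsto' (eventually_atTop.2 ⟨1, fun n hn h₀ => ?_⟩) ?_
  · have : (0 : ℝ) < n := by exact_mod_cast hn
    exact absurd h₀ (by positivity)
  · refine ((tendsto_rpow_neg_atTop (sub_pos.2 h)).comp tendsto_natCast_atTop_atTop).congr' ?_
    filter_upwards [eventually_ge_atTop 1] with n hn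
    have : (0 : ℝ) < n := by exact_mod_cast hn
    rw [Function.comp_apply, neg_sub, Real.rpow_sub this]

theorem rpow_pow_div {x : ℝ} (hx : 0 ≤ x) {p q : ℕ} (hq : q ≠ 0) :
    (x ^ q) ^ ((p : ℝ) / q) = x ^ p := by
  rw [← Real.rpow_natCast x q, ← Real.rpow_mul hx, mul_div_cancel₀ _ (by exact_mod_cast hq),
    Real.rpow_natCast]

theorem not_NTIME_rpow_subset_ro {r s : ℝ} (hr : 1 ≤ r) (hrs : r < s) :
    ¬ NTIME (fun n => (n : ℝ) ^ s) ⊆ ro (NTIME fun n => (n : ℝ) ^ r) := by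
  obtain ⟨a, hra, has⟩ := exists_rat_btwn hrs
  obtain ⟨p, q, hq, hqp, ha⟩ : ∃ p q : ℕ, 0 < q ∧ q ≤ p ∧ (a : ℝ) = (p : ℝ) / q := by
    have h₀ : (1 : ℚ) < a := by exact_mod_cast hr.trans_lt hra
    have h₁ : ((a.num.toNat : ℕ) : ℤ) = a.num :=
      Int.toNat_of_nonneg (Rat.num_nonneg.2 (by linarith))
    have h₂ : a = (a.num.toNat : ℚ) / a.den := by
      rw [show (a.num.toNat : ℚ) = ((a.num.toNat : ℤ) : ℚ) by norm_cast, h₁, Rat.num_div_den]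
    refine ⟨a.num.toNat, a.den, a.pos, ?_, ?_⟩
    · rw [h₂, one_lt_div (by exact_mod_cast a.pos)] at h₀
      exact_mod_cast h₀.le
    · refine (congrArg (Rat.cast (K := ℝ)) h₂).trans ?_
      push_cast
      rfl
  rw [ha] at hra has
  set b : ℝ := (p : ℝ) / q with hb
  have hb0 : 0 ≤ b := by positivity
  have hid : ∀ t : ℝ, 1 ≤ t → (fun n : ℕ => (n : ℝ)) =O[atTop] fun n : ℕ => (n : ℝ) ^ t :=
    fun t ht => (isBigO_rpow_natCast ht).congr_left fun n => Real.rpow_one _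
  have hone : (fun _ : ℕ => (1 : ℝ)) =O[atTop] fun n : ℕ => (n : ℝ) ^ s :=
    (isBigO_rpow_natCast (r := 0) (by linarith)).congr_left fun n => Real.rpow_zero _
  -- For `x = ⌊y n⌋₊` one has `x ^ q + x ≤ 2 * x ^ q ≤ n`, which is the room that the odometer needs
  -- for the guess and the first sweep.
  set y : ℕ → ℝ := fun n => ((n : ℝ) / 2) ^ (1 / (q : ℝ)) with hy
  have hy0 : ∀ n, 0 ≤ y n := fun n => by positivity
  have hyq : ∀ n, y n ^ q = n / 2 := fun n => by
    rw [hy, ← Real.rpow_natCast, ← Real.rpow_mul (by positivity),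
      one_div_mul_cancel (by exact_mod_cast hq.ne'), Real.rpow_one]
  have hylim : Tendsto y atTop atTop :=
    (tendsto_rpow_atTop (by positivity)).comp
      (tendsto_natCast_atTop_atTop.atTop_div_const (by norm_num))
  refine not_NTIME_subset_ro (k := ⌈r⌉₊) (C := Odometer.machine p q)
    (T' := fun n => 2 * n + 2 + ⌊((n + 1 : ℕ) : ℝ) ^ b⌋₊)
    (R := fun n => if 2 ≤ ⌊y n⌋₊ then ⌊y n⌋₊ ^ p else 0) ?_ ?_ ?_ (hid s (by linarith)) ?_ (hid r hr)
    ?_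
  · intro n l c hc
    obtain ⟨x, hx, hl⟩ := Odometer.le_of_steps hqp hc
    refine hl.trans (Nat.add_le_add_left (Nat.le_floor ?_) _)
    push_cast
    rw [← rpow_pow_div x.cast_nonneg hq.ne']
    exact Real.rpow_le_rpow (by positivity) (by exact_mod_cast hx) hb0
  · intro n
    by_cases hx : 2 ≤ ⌊y n⌋₊
    · rw [if_pos hx]
      refine Odometer.exists_steps hqp hx ?_
      have h₁ : (⌊y n⌋₊ : ℝ) ^ q ≤ n / 2 := by
        rw [← hyq]
        exact pow_le_pow_left₀ (by positivity) (Nat.floor_le (hy0 n)) q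
      have h₂ : (⌊y n⌋₊ : ℝ) ≤ (⌊y n⌋₊ : ℝ) ^ q :=
        le_self_pow₀ (by exact_mod_cast (by omega)) hq.ne'
      have h₃ : (⌊y n⌋₊ : ℝ) ^ q + ⌊y n⌋₊ ≤ n := by linarith
      exact_mod_cast h₃
    · rw [if_neg hx]
      exact ⟨0, le_rfl, _, .refl _⟩
  · have h₁ : (fun n : ℕ => (⌊((n + 1 : ℕ) : ℝ) ^ b⌋₊ : ℝ)) =O[atTop]
        fun n : ℕ => (n : ℝ) ^ s := by
      refine IsBigO.trans (IsBigO.of_bound 1 (Eventually.of_forall fun n => ?_))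
        ((isBigO_rpow_natCast_succ hb0).trans (isBigO_rpow_natCast has.le))
      rw [Real.norm_of_nonneg (by positivity), Real.norm_of_nonneg (by positivity), one_mul]
      exact Nat.floor_le (by positivity)
    refine ((((hid s (by linarith)).const_mul_left 2).add (hone.const_mul_left 2)).add
      h₁).congr_left fun n => ?_
    push_cast
    ring
  · refine ((isBigO_rpow_natCast_succ (by linarith)).trans_isLittleO
      (isLittleO_rpow_natCast hra)).trans_isBigO (IsBigO.of_bound (2 ^ b * 2 ^ p) ?_)
    -- The factor `2 ^ b` undoes the halving of `n` in `y`, and `2 ^ p` pays for rounding `y n`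
    -- down, which loses at most half of it.
    filter_upwards [hylim.eventually_ge_atTop 4] with n hn
    have h₁ : y n / 2 ≤ ⌊y n⌋₊ := by
      have := Nat.lt_floor_add_one (y n)
      linarith
    have h₂ : 2 ≤ ⌊y n⌋₊ := Nat.le_floor (by push_cast; linarith)
    rw [if_pos h₂, Real.norm_of_nonneg (by positivity), Real.norm_of_nonneg (by positivity)]
    have h₃ : y n ^ p = ((n : ℝ) / 2) ^ b := by rw [← hyq, rpow_pow_div (hy0 n) hq.ne']
    calc (n : ℝ) ^ b = 2 ^ b * y n ^ p := by
          rw [h₃, ← Real.mul_rpow (by norm_num) (by positivity)]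
          congr 1
          ring
      _ = 2 ^ b * 2 ^ p * (y n / 2) ^ p := by
          rw [mul_assoc, ← mul_pow]
          congr 2
          ring
      _ ≤ 2 ^ b * 2 ^ p * (⌊y n⌋₊ ^ p : ℕ) := by
          push_cast
          have := hy0 n
          gcongr
  · refine (isBigO_rpow_natCast (Nat.le_ceil r)).congr_right fun n => Real.rpow_natCast _ _

theorem mainTheorem2 :
    (∀ (t₁ t₂ : ℕ → ℕ) (c : ℝ), TimeConstructible t₁ → TimeConstructible t₂ →
      (fun n => (t₁ n : ℝ)) =o[atTop] (fun n => (t₂ n : ℝ)) →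
      (fun n => (t₁ (n + 1) : ℝ)) =o[atTop] (fun n => (t₂ n : ℝ)) →
      (∀ᶠ n : ℕ in atTop, (n : ℝ) ≤ (t₁ n : ℝ) ∧ (t₁ n : ℝ) ≤ (n : ℝ) ^ c) →
      ¬ NTIME (fun n => (t₂ n : ℝ)) ⊆ ro (NTIME (fun n => (t₁ n : ℝ)))) ∧
    (∀ r s : ℝ, 1 ≤ r → r < s →
      ¬ NTIME (fun n => (n : ℝ) ^ s) ⊆ ro (NTIME (fun n => (n : ℝ) ^ r))) :=
  ⟨fun _ _ _ _ ht₂ _ h hc => not_NTIME_subset_ro_of_timeConstructible ht₂ h hc,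
    fun _ _ hr hrs => not_NTIME_rpow_subset_ro hr hrs⟩
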